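/- Let $k$ be a field of odd characteristic $p$, let $K=k(t)$ be the field of rational functions over $k$, and let $f\colon \mathbf{P}^1_{K}\to\mathbf{P}^1_{K}$ be the $K$-morphism given by the rational function $y\mapsto \frac{t-y^p}{y}$. For $a\in K^*$ let $\langle a\rangle\in \mathrm{GW}(K)$ be the class of the form $(x,y)\mapsto axy$ in the Grothendieck–Witt group of nondegenerate symmetric bilinear forms, and let $h=\langle 1\rangle+\langle -1\rangle$. Write $Y$ and $X$ for the source and the target of $f$, and regard $df$ as a section of the line bundle $\mathcal V=\mathrm{Hom}(f^*T^\vee X, T^\vee Y)$. A relative orientation of $\mathcal V$ is a line bundle $M$ on $Y$ with an isomorphism $\mathrm{Hom}(TY,\mathcal V)\cong M^{\otimes 2}$. The local index $\mathrm{ind}_y\, df\in \mathrm{GW}(K)$ at a zero $y$ of $df$ is the following class. Choose an étale map $\phi\colon U\to\mathbf{A}^1_K$ from an open neighbourhood $U$ of $y$, inducing an isomorphism on the residue fields at $y$, and a local generator $s$ of $\mathcal V$ at $y$ such that the homomorphism $TY\to\mathcal V$ taking the dual basis of $d\phi$ to $s$ corresponds to $m\otimes m$ for a local section $m$ of $M$;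 write $df=g\cdot s$, choose a germ $F$ at $\phi(y)$ with $\phi^*F\equiv g$ modulo a sufficiently high power of the maximal ideal $\mathfrak m_y$, and take the Scheja–Storch form of $F$ on $\mathcal O_{\mathbf{A}^1,\phi(y)}/(F)$. Then there is a relative orientation of $\mathcal V$ such that $df$ vanishes exactly at the closed point $(y^p-t)$ and at $\infty$, the local indices at these two points do not depend on the choices, and $$\mathrm{ind}_{(y^p-t)}\,df=\frac{p-1}{2}\,h+\langle 1\rangle,\qquad \mathrm{ind}_{\infty}\,df=\frac{p-3}{2}\,h+\langle -1\rangle .$$ Consequently $\sum_{\{y\,:\,df(y)=0\}}\mathrm{ind}_y\,df=(p-1)\,h$, and the enriched Riemann–Hurwitz formula $$\chi^{\mathbf{A}^1}(Y)=\deg(f)\cdot\chi^{\mathbf{A}^1}(X)-\sum_{\{y\,:\,df(y)=0\}}\mathrm{ind}_y\,df$$ holds in $\mathrm{GW}(K)$, where $\chi^{\mathbf{A}^1}(C)=(1-g(C))\,h$ for a smooth proper curve $C$ of genus $g(C)$. -/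

import Mathlib

open CategoryTheory AlgebraicGeometry TensorProduct Polynomial LaurentPolynomial

universe u

noncomputable section

namespace EnrichedRH

/-! ## The Grothendieck-Witt group -/

section GW

variable (K : Type u) [Field K]

/-- A nondegenerate symmetric bilinear form on a finite dimensional `K`-vector space. -/
structure SymSpace : Type (u + 1) where
  carrier : Type u
  [addCommGroup : AddCommGroup carrier]
  [module : Module K carrier]
  [finite : Module.Finite K carrier]
  form : carrier →ₗ[K] carrier →ₗ[K] K
  symm : ∀ x y, form x y = form y x
  nondeg : ∀ x, (∀ y, form x y = 0) → x = 0

attribute [instance] SymSpace.addCommGroup SymSpace.module SymSpace.finite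

variable {K}

namespace SymSpace

/-- Two symmetric bilinear forms are isomorphic if there is an isometry between them. -/
def Isometric (A B : SymSpace K) : Prop :=
  ∃ e : A.carrier ≃ₗ[K] B.carrier, ∀ x y, B.form (e x) (e y) = A.form x y

variable (K) in
/-- Isometry is an equivalence relation. -/
instance setoid : Setoid (SymSpace K) where
  r := Isometric
  iseqv :=
    { refl := fun _ => ⟨LinearEquiv.refl _ _, fun _ _ => rfl⟩
      symm := fun ⟨e, he⟩ => ⟨e.symm, fun x y => by rw [← he]; simp⟩
      trans := fun ⟨e, he⟩ ⟨e', he'⟩ =>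
        ⟨e.trans e', fun x y => by simp [he, he']⟩ }

/-- The orthogonal direct sum. -/
def sum (A B : SymSpace K) : SymSpace K where
  carrier := A.carrier × B.carrier
  form := A.form.compl₁₂ (LinearMap.fst K A.carrier B.carrier)
      (LinearMap.fst K A.carrier B.carrier) +
    B.form.compl₁₂ (LinearMap.snd K A.carrier B.carrier) (LinearMap.snd K A.carrier B.carrier)
  symm x y := by simp [A.symm x.1 y.1, B.symm x.2 y.2]
  nondeg x h := Prod.ext (A.nondeg _ fun y => by simpa using h (y, 0))
    (B.nondeg _ fun y => by simpa using h (0, y))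

@[simp] lemma sum_form (A B : SymSpace K) (x y : A.carrier × B.carrier) :
    (A.sum B).form x y = A.form x.1 y.1 + B.form x.2 y.2 := rfl

variable (K) in
/-- The form on the zero space. -/
def zero : SymSpace K where
  carrier := PUnit
  form := 0
  symm _ _ := rfl
  nondeg _ _ := rfl

/-- The one-dimensional form `⟨a⟩ : (x, y) ↦ a x y`. -/
def unary (a : Kˣ) : SymSpace K where
  carrier := K
  form := (a : K) • LinearMap.mul K K
  symm x y := by simp [mul_comm x y]
  nondeg x h := by simpa using h 1

end SymSpace

variable (K) in
/-- Isometry classes of nondegenerate symmetric bilinear forms. -/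
def SymClass : Type (u + 1) := Quotient (SymSpace.setoid K)

namespace SymClass

instance : Zero (SymClass K) := ⟨Quotient.mk _ (SymSpace.zero K)⟩

instance : Add (SymClass K) where
  add := Quotient.map₂ SymSpace.sum fun A B ⟨e, he⟩ A' B' ⟨e', he'⟩ =>
    ⟨e.prodCongr e', fun x y => by
      change B.form (e x.1) (e y.1) + B'.form (e' x.2) (e' y.2) = A.form x.1 y.1 + A'.form x.2 y.2
      rw [he, he']⟩

/-- Isometry classes form a commutative monoid under orthogonal direct sum. -/
instance : AddCommMonoid (SymClass K) where
  add_assoc a b c := by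
    induction a using Quotient.inductionOn
    induction b using Quotient.inductionOn
    induction c using Quotient.inductionOn
    exact Quotient.sound ⟨LinearEquiv.prodAssoc K _ _ _, fun x y => (add_assoc _ _ _).symm⟩
  zero_add a := Quotient.inductionOn a fun A => Quotient.sound
    ⟨(LinearEquiv.uniqueProd : (PUnit.{u + 1} × A.carrier) ≃ₗ[K] A.carrier),
      fun x y => (zero_add (A.form x.2 y.2)).symm⟩
  add_zero a := Quotient.inductionOn a fun A => Quotient.sound
    ⟨(LinearEquiv.prodUnique : (A.carrier × PUnit.{u + 1}) ≃ₗ[K] A.carrier),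
      fun x y => (add_zero (A.form x.1 y.1)).symm⟩
  add_comm a b := by
    induction a using Quotient.inductionOn
    induction b using Quotient.inductionOn
    exact Quotient.sound ⟨LinearEquiv.prodComm K _ _, fun x y => add_comm _ _⟩
  nsmul := nsmulRec

end SymClass

variable (K) in
/-- The (additive) Grothendieck-Witt group: the group completion of the monoid of isometry
classes of nondegenerate symmetric bilinear forms. -/
abbrev GW : Type (u + 1) := Algebra.GrothendieckAddGroup (SymClass K)

/-- The class in `GW K` of a form. -/
def GW.mk (A : SymSpace K) : GW K := Algebra.GrothendieckAddGroup.of (Quotient.mk _ A)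

/-- The class `⟨a⟩`. -/
def GW.unary (a : Kˣ) : GW K := GW.mk (SymSpace.unary a)

variable (K) in
/-- The hyperbolic class `h = ⟨1⟩ + ⟨-1⟩`. -/
def GW.h : GW K := GW.unary 1 + GW.unary (-1)

end GW

/-! ## The Scheja-Storch functional in one variable -/

section SchejaStorch

variable {K : Type u} [Field K] {R : Type u} [CommRing R] [Algebra K R]

/-- The canonical map `Q ⊗ Q → Hom (Hom (Q, K), Q)`, which takes `b ⊗ c` to `μ ↦ μ(b) c`. -/
def dualMap (Q : Type u) [CommRing Q] [Algebra K Q] (Δ : Q ⊗[K] Q) : Module.Dual K Q →ₗ[K] Q where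
  toFun μ := TensorProduct.lid K Q (LinearMap.rTensor Q μ Δ)
  map_add' μ ν := by simp [LinearMap.rTensor_add]
  map_smul' c μ := by simp [LinearMap.rTensor_smul]

/-- `η` is the Scheja-Storch functional on `Q = R / (F)` with respect to the coordinate `x`
of the local ring `R`: for `a` with `F ⊗ 1 - 1 ⊗ F = a (x ⊗ 1 - 1 ⊗ x)` and `Δ` the image
of `a` in `Q ⊗ Q`, the map `Θ : Hom (Q, K) → Q` given by `Δ` is bijective, and `Θ η = 1`. -/
def IsSchejaStorch (x F : R) (η : Module.Dual K (R ⧸ Ideal.span {F})) : Prop :=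
  ∃ a : R ⊗[K] R,
    F ⊗ₜ[K] (1 : R) - (1 : R) ⊗ₜ[K] F = a * (x ⊗ₜ[K] (1 : R) - (1 : R) ⊗ₜ[K] x) ∧
    Function.Bijective (dualMap (K := K) (R ⧸ Ideal.span {F})
      (Algebra.TensorProduct.map (Ideal.Quotient.mkₐ K (Ideal.span {F}))
        (Ideal.Quotient.mkₐ K (Ideal.span {F})) a)) ∧
    dualMap (K := K) (R ⧸ Ideal.span {F})
      (Algebra.TensorProduct.map (Ideal.Quotient.mkₐ K (Ideal.span {F}))
        (Ideal.Quotient.mkₐ K (Ideal.span {F})) a) η = 1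

end SchejaStorch

/-! ## Schemes over a field -/

section Schemes

variable (K : Type u) [Field K]

/-- `Spec K`. -/
abbrev pt : Scheme.{u} := Spec (.of K)

variable (Y : Scheme.{u}) [Y.Over (pt K)]

/-- The structure map `K → Γ(Y, U)` of a `K`-scheme. -/
def toSections (U : Y.Opens) : K →+* Γ(Y, U) :=
  ((Scheme.ΓSpecIso (.of K)).inv ≫ (Y ↘ pt K).appTop ≫
    Y.presheaf.map (homOfLE (le_top : U ≤ ⊤)).op).hom

/-- The structure map from `K` to the local ring at `y`. -/
def toStalk (y : Y) : CommRingCat.of K ⟶ Y.presheaf.stalk y :=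
  (Scheme.ΓSpecIso (.of K)).inv ≫ (Y ↘ pt K).appTop ≫
    Y.presheaf.germ ⊤ y (TopologicalSpace.Opens.mem_top y)

/-- The local rings of a `K`-scheme are `K`-algebras. -/
instance stalkAlgebra (y : Y) : Algebra K (Y.presheaf.stalk y) := (toStalk K Y y).hom.toAlgebra

variable {Y} in
lemma stalkSpecializes_algebraMap {y z : Y} (h : y ⤳ z) (c : K) :
    Y.presheaf.stalkSpecializes h (algebraMap K (Y.presheaf.stalk z) c) =
      algebraMap K (Y.presheaf.stalk y) c := by
  have e : toStalk K Y z ≫ Y.presheaf.stalkSpecializes h = toStalk K Y y := by simp [toStalk]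
  exact congr($e c)

variable {X Y : Scheme.{u}} [X.Over (pt K)] [Y.Over (pt K)]

lemma stalkMap_algebraMap (f : Y ⟶ X) [f.IsOver (pt K)] (y : Y) (c : K) :
    f.stalkMap y (algebraMap K (X.presheaf.stalk (f y)) c) =
      algebraMap K (Y.presheaf.stalk y) c := by
  have e : toStalk K X (f y) ≫ f.stalkMap y = toStalk K Y y := by
    have h : (X ↘ pt K).appTop ≫ f.appTop = (Y ↘ pt K).appTop := by
      rw [← Scheme.Hom.comp_appTop, comp_over f (pt K)]
    simp only [toStalk, ← h, Category.assoc, Scheme.Hom.germ_stalkMap]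
    rfl
  exact congr($e c)

end Schemes

/-! ## Vector bundles on an integral scheme, through their stalks -/

section Bundles

variable (Y : Scheme.{u}) [IsIntegral Y]

/-- The local ring at `y`, as a subring of the function field of `Y`. -/
def localRing (y : Y) : Subring Y.functionField :=
  (algebraMap (Y.presheaf.stalk y) Y.functionField).range

/-- A torsion-free sheaf on the integral scheme `Y`, given by its stalk at the generic point
and all its stalks inside of it. The sections over an open `U` are the elements of the generic
stalk which lie in the stalk at every point of `U`. -/
structure StalkSheaf : Type (u + 1) where
  generic : Type u
  [addCommGroup : AddCommGroup generic]
  [module : Module Y.functionField generic]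
  stalk : ∀ y : Y, Submodule (localRing Y y) generic

attribute [instance] StalkSheaf.addCommGroup StalkSheaf.module

namespace StalkSheaf

variable {Y}

/-- A line bundle: the generic stalk is one-dimensional, and `Y` is covered by opens on
which one element `e` generates all stalks. -/
def IsLineBundle (A : StalkSheaf Y) : Prop :=
  Module.finrank Y.functionField A.generic = 1 ∧
  ∀ y : Y, ∃ U : Y.Opens, y ∈ U ∧ ∃ e : A.generic, e ≠ 0 ∧
    ∀ z ∈ U, A.stalk z = Submodule.span (localRing Y z) {e}

/-- A (generic) section vanishes at `y` if it lies in `𝔪_y` times the stalk at `y`. -/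
def VanishesAt (A : StalkSheaf Y) (σ : A.generic) (y : Y) : Prop :=
  σ ∈ Submodule.span (localRing Y y) {v : A.generic |
    ∃ a ∈ IsLocalRing.maximalIdeal (Y.presheaf.stalk y), ∃ w ∈ A.stalk y,
      v = algebraMap (Y.presheaf.stalk y) Y.functionField a • w}

variable (Y) in
/-- The structure sheaf. -/
def structureSheaf : StalkSheaf Y where
  generic := Y.functionField
  stalk y := Submodule.span (localRing Y y) {1}

/-- The sheaf of homomorphisms. -/
def hom (A B : StalkSheaf Y) : StalkSheaf Y where
  generic := A.generic →ₗ[Y.functionField] B.generic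
  stalk y :=
    { carrier := {φ | ∀ a ∈ A.stalk y, φ a ∈ B.stalk y}
      add_mem' := fun hφ hψ a ha => add_mem (hφ a ha) (hψ a ha)
      zero_mem' := fun _ _ => zero_mem _
      smul_mem' := fun c _ hφ a ha => (B.stalk y).smul_mem c (hφ a ha) }

/-- The tensor product. -/
def tensor (A B : StalkSheaf Y) : StalkSheaf Y where
  generic := A.generic ⊗[Y.functionField] B.generic
  stalk y := Submodule.span (localRing Y y)
    {v | ∃ a ∈ A.stalk y, ∃ b ∈ B.stalk y, v = a ⊗ₜ[Y.functionField] b}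

/-- An isomorphism: it identifies the generic stalks, and the stalk at every point. -/
structure Iso (A B : StalkSheaf Y) where
  toEquiv : A.generic ≃ₗ[Y.functionField] B.generic
  mem_stalk_iff : ∀ (y : Y) (a : A.generic), toEquiv a ∈ B.stalk y ↔ a ∈ A.stalk y

end StalkSheaf

end Bundles

/-! ## Differentials -/

section Differentials

variable (K : Type u) [Field K] (Y : Scheme.{u}) [IsIntegral Y] [Y.Over (pt K)]

/-- The cotangent sheaf `T^∨ Y` of a smooth integral `K`-scheme: the stalk at `y` is generated by
the differentials of the elements of the local ring at `y`. -/
def cotangent : StalkSheaf Y where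
  generic := Ω[Y.functionField⁄K]
  stalk y := Submodule.span (localRing Y y)
    {ω | ∃ a ∈ localRing Y y, ω = KaehlerDifferential.D K Y.functionField a}

/-- The tangent sheaf. -/
def tangent : StalkSheaf Y := (cotangent K Y).hom (StalkSheaf.structureSheaf Y)

/-- The `K`-vector space of global sections of the cotangent sheaf. -/
def globalDifferentials : Submodule K Ω[Y.functionField⁄K] where
  carrier := {ω | ∀ y, ω ∈ (cotangent K Y).stalk y}
  add_mem' h h' y := add_mem (h y) (h' y)
  zero_mem' y := zero_mem _
  smul_mem' c ω h y := by
    have hc : algebraMap K Y.functionField c ∈ localRing Y y :=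
      ⟨algebraMap K (Y.presheaf.stalk y) c, stalkSpecializes_algebraMap K _ c⟩
    have := ((cotangent K Y).stalk y).smul_mem ⟨_, hc⟩ (h y)
    rwa [← algebraMap_smul Y.functionField c ω]

/-- The genus of a smooth proper geometrically connected curve. -/
def genus : ℕ := Module.finrank K (globalDifferentials K Y)

/-- The `𝔸¹`-Euler characteristic `(1 - g) h` of a smooth proper curve. -/
def eulerChar : GW K := (1 - (genus K Y : ℤ)) • GW.h K

variable {K Y}
variable {X : Scheme.{u}} [X.Over (pt K)] (f : Y ⟶ X)

/-- The local ring of `X` at the image of the generic point of `Y`. If `f` is dominant, this is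
the function field of `X`. -/
abbrev ImageStalk : CommRingCat := X.presheaf.stalk (f (genericPoint Y))

/-- The pullback of functions makes the function field of `Y` an algebra over `ImageStalk f`. -/
@[reducible] def imageAlgebra : Algebra (ImageStalk f) Y.functionField :=
  (f.stalkMap (genericPoint Y)).hom.toAlgebra

/-- The degree of a dominant map of curves: the degree of the extension of function fields. -/
def degree : ℕ :=
  letI := imageAlgebra f
  Module.finrank (ImageStalk f) Y.functionField

variable (K) in
/-- The pullback `f^* T^∨ X`: the stalk at `y` is generated by the pullbacks of differentials of
elements of the local ring of `X` at `f y`. -/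
def pullbackCotangent : StalkSheaf Y :=
  letI := imageAlgebra f
  { generic := Y.functionField ⊗[ImageStalk f] Ω[ImageStalk f⁄K]
    stalk := fun y => Submodule.span (localRing Y y)
      {v | ∃ a : X.presheaf.stalk (f y), v = 1 ⊗ₜ[ImageStalk f] KaehlerDifferential.D K (ImageStalk f)
        (X.presheaf.stalkSpecializes
          (((genericPoint_spec Y).specializes trivial).map f.continuous) a)} }

variable (K) in
/-- The line bundle `Hom (f^* T^∨ X, T^∨ Y)`. -/
def diffBundle : StalkSheaf Y := (pullbackCotangent K f).hom (cotangent K Y)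

variable (K) in
/-- The section `df` of `Hom (f^* T^∨ X, T^∨ Y)`. -/
def differential [f.IsOver (pt K)] : (diffBundle K f).generic :=
  letI := imageAlgebra f
  haveI : IsScalarTower K (ImageStalk f) Y.functionField :=
    .of_algebraMap_eq fun c => (stalkMap_algebraMap K f _ c).symm
  KaehlerDifferential.mapBaseChange K (ImageStalk f) Y.functionField

end Differentials

/-! ## Relative orientations and local indices on curves -/

section Index

variable {K : Type u} [Field K] {Y : Scheme.{u}} [IsIntegral Y] [Y.Over (pt K)]

variable (K) in
/-- A relative orientation of a line bundle `V` on a smooth curve `Y`: a line bundle `M` and an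
isomorphism `Hom (T Y, V) ≅ M ⊗ M`. -/
structure RelativeOrientation (V : StalkSheaf Y) where
  M : StalkSheaf Y
  isLineBundle : M.IsLineBundle
  iso : ((tangent K Y).hom V).Iso (M.tensor M)

variable (K) in
/-- The `K`-morphism `U → 𝔸¹` given by a function `g` on `U`. -/
def coordMap (U : Y.Opens) (g : Γ(Y, U)) : U.toScheme ⟶ Spec (.of K[X]) :=
  U.toSpecΓ ≫ Spec.map (CommRingCat.ofHom (Polynomial.eval₂RingHom (toSections K Y U) g))

variable (K) in
/-- The map `U → 𝔸¹` given by `g` is a Nisnevich coordinate around `y`: it is étale and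
induces an isomorphism on residue fields at `y`. -/
def IsNisnevichCoordinate (U : Y.Opens) (y : Y) (hy : y ∈ U) (g : Γ(Y, U)) : Prop :=
  Etale (coordMap K U g) ∧
    Function.Bijective ((coordMap K U g).residueFieldMap ⟨y, hy⟩)

/-- A local trivialization of `V` near `y`, given by a generator `s` of the stalk, is compatible
with a relative orientation and a coordinate function `x` (an element of the function field) if
the homomorphism `T Y → V` which takes the dual basis `∂x` of `dx` to `s` corresponds to the
square `m ⊗ m` of a local section `m` of `M`. -/
def IsCompatible {V : StalkSheaf Y} (ρ : RelativeOrientation K V) (y : Y) (x : Y.functionField)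
    (s : V.generic) : Prop :=
  ∃ τ : (tangent K Y).generic, ∃ E : ((tangent K Y).hom V).generic, ∃ m ∈ ρ.M.stalk y,
    (show Ω[Y.functionField⁄K] →ₗ[Y.functionField] Y.functionField from τ)
      (KaehlerDifferential.D K Y.functionField x) = 1 ∧
    (show (tangent K Y).generic →ₗ[Y.functionField] V.generic from E) τ = s ∧
    ρ.iso.toEquiv E = m ⊗ₜ[Y.functionField] m

end Index

section AffineLine

variable {K : Type u} [Field K] {O : Type u} [CommRing O] [IsLocalRing O] [Algebra K O]

variable (K) in
/-- The prime ideal of `K[X]` at the image of the closed point of `Spec O` in `𝔸¹`. -/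
def imagePrime (x : O) : Ideal K[X] :=
  (IsLocalRing.maximalIdeal O).comap (Polynomial.aeval (R := K) x)

instance (x : O) : (imagePrime K x).IsPrime := by
  unfold imagePrime; infer_instance

variable (K) in
/-- The local ring of `𝔸¹` at the image of the closed point of `Spec O`. -/
abbrev LineLocalRing (x : O) : Type u := Localization.AtPrime (imagePrime K x)

variable (K) in
/-- Pullback of germs of functions along `x`. -/
def linePullback (x : O) : LineLocalRing K x →+* O :=
  IsLocalization.lift (M := (imagePrime K x).primeCompl)
    (g := (Polynomial.aeval (R := K) x).toRingHom) fun s => by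
      simpa [imagePrime, Ideal.primeCompl] using s.2

/-- The coordinate of `𝔸¹`, in the local ring. -/
def lineCoord (x : O) : LineLocalRing K x := algebraMap K[X] _ Polynomial.X

/-- `α` is the class of the form `(b, c) ↦ η (b c)` on `Q = O_{𝔸¹, x} / (F)`, where `F` is a
function near the image of the closed point whose pullback agrees with `f` up to an element of
`𝔪 ^ N`, with `N` sufficiently large (at least twice the order of vanishing of `f`), and `η` is
the Scheja-Storch functional of `F`. -/
def IsIndexForm (x f : O) (α : GW K) : Prop :=
  ∃ (F : LineLocalRing K x) (N : ℕ),
    IsLocalRing.maximalIdeal O ^ N ≤ Ideal.span {f ^ 2} ∧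
    linePullback K x F - f ∈ IsLocalRing.maximalIdeal O ^ N ∧
    ∃ η : Module.Dual K (LineLocalRing K x ⧸ Ideal.span {F}),
      IsSchejaStorch (lineCoord x) F η ∧
      ∃ (β : SymSpace K) (e : β.carrier ≃ₗ[K] (LineLocalRing K x ⧸ Ideal.span {F})),
        (∀ b c, β.form b c = η (e b * e c)) ∧ α = GW.mk β

end AffineLine

section Index

variable {K : Type u} [Field K] {Y : Scheme.{u}} [IsIntegral Y] [Y.Over (pt K)]

/-- `α` is computed as local index of the section `σ` of `V` at `y` by some choice of Nisnevich
coordinate around `y` and compatible local trivialization, in which `σ` becomes the function `f`. -/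
def IsLocalIndex {V : StalkSheaf Y} (ρ : RelativeOrientation K V) (σ : V.generic) (y : Y)
    (α : GW K) : Prop :=
  ∃ (U : Y.Opens) (hy : y ∈ U) (g : Γ(Y, U)) (s : V.generic) (f : Y.presheaf.stalk y),
    IsNisnevichCoordinate K U y hy g ∧
    V.stalk y = Submodule.span (localRing Y y) {s} ∧
    IsCompatible ρ y
      (algebraMap (Y.presheaf.stalk y) Y.functionField (Y.presheaf.germ U y hy g)) s ∧
    σ = algebraMap (Y.presheaf.stalk y) Y.functionField f • s ∧
    IsIndexForm (Y.presheaf.germ U y hy g) f α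

open Classical in
/-- The local index `ind_y σ`, computed with any choice of coordinate and trivialization. -/
def localIndex {V : StalkSheaf Y} (ρ : RelativeOrientation K V) (σ : V.generic) (y : Y) : GW K :=
  if h : ∃ α, IsLocalIndex ρ σ y α then h.choose else 0

/-- The Euler number of `V` with respect to a section `σ`. -/
def eulerNumber {V : StalkSheaf Y} (ρ : RelativeOrientation K V) (σ : V.generic) : GW K :=
  ∑ᶠ y ∈ {y : Y | V.VanishesAt σ y}, localIndex ρ σ y

end Index

/-! ## The projective line -/

section ProjectiveLine

variable (K : Type u) [Field K]

/-- The grading of the homogeneous coordinate ring `K[X₀, X₁]`. -/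
abbrev grading : ℕ → Submodule K (MvPolynomial (Fin 2) K) :=
  MvPolynomial.homogeneousSubmodule (Fin 2) K

instance : GradedAlgebra (grading K) := MvPolynomial.gradedAlgebra

/-- The projective line over `K`. -/
def P1 : Scheme.{u} := Proj (grading K)

instance : (P1 K).Over (pt K) where
  hom := Proj.toSpecZero (grading K) ≫
    Spec.map (CommRingCat.ofHom (algebraMap K (grading K 0)))

/-- The evaluation `K[X₀, X₁] → K[X]` at `X_i = 1` and `X_j = X` for `j ≠ i`. -/
def evalLine (i : Fin 2) : MvPolynomial (Fin 2) K →+* K[X] :=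
  (MvPolynomial.aeval (fun j : Fin 2 => if j = i then (1 : K[X]) else X)).toRingHom

/-- The restriction of a fraction of homogeneous polynomials to the line `X_i = 1`. -/
def dehomogenize (i : Fin 2) :
    HomogeneousLocalization.Away (grading K) (MvPolynomial.X i) →+* K[X] :=
  (IsLocalization.Away.lift (S := Localization.Away (MvPolynomial.X i : MvPolynomial (Fin 2) K))
    (MvPolynomial.X i) (g := evalLine K i) (by simp [evalLine])).comp
  (algebraMap (HomogeneousLocalization.Away (grading K) (MvPolynomial.X i))
    (Localization.Away (MvPolynomial.X i : MvPolynomial (Fin 2) K)))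

/-- The standard chart `𝔸¹ → ℙ¹` onto `X_i ≠ 0`. The coordinate on the chart `0` is `X₁ / X₀`, and
the coordinate on the chart `1` is `X₀ / X₁`. -/
def chart (i : Fin 2) : Spec (.of K[X]) ⟶ P1 K :=
  Spec.map (CommRingCat.ofHom (dehomogenize K i)) ≫
    Proj.awayι (grading K) (MvPolynomial.X i) (MvPolynomial.isHomogeneous_X K i) one_pos

/-- The point at infinity: the origin of the chart `1`. -/
def infinity : P1 K :=
  chart K 1 (⟨Ideal.span {X}, (Ideal.span_singleton_prime X_ne_zero).2 prime_X⟩ : PrimeSpectrum K[X])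

/-- The point of `ℙ¹` which corresponds to the zero ideal. -/
def zeroPoint : ProjectiveSpectrum (grading K) where
  asHomogeneousIdeal := ⊥
  isPrime := by
    change (⊥ : Ideal (MvPolynomial (Fin 2) K)).IsPrime
    exact Ideal.isPrime_bot
  not_irrelevant_le h := by
    have h1 : (MvPolynomial.X 0 : MvPolynomial (Fin 2) K) ∈
        (HomogeneousIdeal.irrelevant (grading K)) :=
      HomogeneousIdeal.mem_irrelevant_of_mem _ one_pos (MvPolynomial.isHomogeneous_X K 0)
    have h2 : (MvPolynomial.X 0 : MvPolynomial (Fin 2) K) ∈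
        (⊥ : Ideal (MvPolynomial (Fin 2) K)) := h h1
    exact MvPolynomial.X_ne_zero (R := K) (0 : Fin 2) ((Submodule.mem_bot _).1 h2)

instance : IrreducibleSpace (P1 K) := by
  have hd : closure {zeroPoint K} = (Set.univ : Set (ProjectiveSpectrum (grading K))) := by
    refine Set.eq_univ_of_forall fun x => ?_
    rw [← ProjectiveSpectrum.le_iff_mem_closure]
    exact (bot_le : (⊥ : HomogeneousIdeal (grading K)) ≤ x.asHomogeneousIdeal)
  change IrreducibleSpace (ProjectiveSpectrum (grading K))
  exact
    { isPreirreducible_univ := hd ▸ (isPreirreducible_singleton).closure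
      toNonempty := ⟨zeroPoint K⟩ }

instance : IsReduced (P1 K) := by
  have : ∀ x : P1 K, _root_.IsReduced ((P1 K).presheaf.stalk x) := fun x => by
    let e := (Proj.stalkIso (grading K) x).commRingCatIsoToRingEquiv
    let P := x.asHomogeneousIdeal.toIdeal
    have : P.IsPrime := x.isPrime
    have : IsDomain (Localization.AtPrime P) :=
      IsLocalization.isDomain_localization P.primeCompl_le_nonZeroDivisors
    exact isReduced_of_injective
      ((algebraMap (HomogeneousLocalization.AtPrime (grading K) P) (Localization.AtPrime P)).comp
        e.toRingHom)
      ((HomogeneousLocalization.val_injective _).comp e.injective)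
  exact isReduced_of_isReduced_stalk _

instance : IsIntegral (P1 K) := isIntegral_of_irreducibleSpace_of_isReduced _

variable {K} in
/-- `f : ℙ¹ → ℙ¹` is the map given by the rational function `y ↦ r(y)`, for a Laurent polynomial
`r`: on the complement of `{0, ∞}` in the source, `f` is the morphism to the affine line which
pulls back the coordinate to `r`. -/
def IsGivenBy (f : P1 K ⟶ P1 K) (r : K[T;T⁻¹]) : Prop :=
  Spec.map (CommRingCat.ofHom (Polynomial.toLaurentAlg (R := K)).toRingHom) ≫ chart K 0 ≫ f =
    Spec.map (CommRingCat.ofHom (Polynomial.aeval (R := K) r).toRingHom) ≫ chart K 0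

end ProjectiveLine

end EnrichedRH

end

/-! Let `y` be the coordinate of the source, `u = y⁻¹`, and `ρ = (a - y ^ p) / y` the pullback of
the coordinate of the target, with `a = t`. Differentiating `y ρ = a - y ^ p` in characteristic `p`
gives `ρ dy + y dρ = 0`, that is, `dρ = (y ^ p - a) y⁻² dy` (`diffEquiv_differential`). The rest is
reading this formula in the right local generators and evaluating the resulting forms.

All bundles are trivialized at the generic point and recorded by their local generators in the
function field: a power `y ^ i` on the chart `0` and a power `y ^ j` at infinity (`twist`). In this
notation `T^∨ Y` is `(0, -2)` and `f^* T^∨ X` is `(2, -2p + 2)`, so `V` is `(-2, 2p - 4)` and `Hom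
(T Y, V)` is `(-2, 2p - 6)`, the square of `(-1, p - 3)`: this square root is the `orientation`.
Against the generators of `V`, the section `df` is `y ^ p - a` on the chart `0` and `u ^ (p - 2) (1
- a u ^ p)` at infinity. So it vanishes exactly at the point of the irreducible polynomial `y ^ p -
t` and, as `p ≥ 3`, at infinity. The generator compatible with the coordinate `u` carries a sign,
because `du = -y⁻² dy`.

At both zeros the local function is `c G (1 + G e)` with `c = ±1` and `G = π ^ k = x ^ (m + 1) - b`,
where `π` is irreducible: `π = x ^ p - t`, `k = 1`, `b = t` at the first zero, and `π = x`, `k = p -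
2`, `b = 0` at the second. The difference quotient of `G` is `∑ x ^ i ⊗ x ^ (m - i)`, so the
Scheja-Storch functional of `G` is the coefficient of `x ^ m`, and the Gram matrix in the power
basis is antidiagonal (`coord_mul`). In odd rank such a form is a sum of hyperbolic planes and one
unary form (`antidiagonal_odd`); the ranks here are `p` and `p - 2`.

Independence of the choices is `eq_antidiagonal_of_isIndexForm`. Another coordinate `x` and
compatible generator change the local function by the derivative of `x` and the square of a unit.
The derivative cancels against the change of the difference quotient, and the square is absorbed by
an isometry. `isLocalIndex_iff` translates this to the curve.

Finally `ℙ¹` has genus `0` and `f` has degree `p`, so the Riemann-Hurwitz formula reads `h = p h -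
(p - 1) h`. -/

noncomputable section

namespace EnrichedRH

/-! ### Antidiagonal forms and hyperbolic planes in the Grothendieck-Witt group. -/

section AntidiagonalForms

variable {K : Type u} [Field K]

lemma GW.mk_eq_mk {A B : SymSpace K} (e : A.carrier ≃ₗ[K] B.carrier)
    (he : ∀ x y, B.form (e x) (e y) = A.form x y) : GW.mk A = GW.mk B :=
  congrArg Algebra.GrothendieckAddGroup.of (Quotient.sound ⟨e, he⟩)

lemma GW.mk_sum (A B : SymSpace K) : GW.mk (A.sum B) = GW.mk A + GW.mk B :=
  map_add Algebra.GrothendieckAddGroup.of (M := SymClass K) (Quotient.mk _ A) (Quotient.mk _ B)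

/-- The form `(x, y) ↦ c ∑ i, x i * y (n - 1 - i)` on `K ^ n`. -/
def antidiagonal (n : ℕ) (c : Kˣ) : SymSpace K where
  carrier := Fin n → K
  form := LinearMap.mk₂ K (fun x y => c * ∑ i, x i * y i.rev)
    (fun x x' y => by simp [add_mul, Finset.sum_add_distrib, mul_add])
    (fun a x y => by simp only [Pi.smul_apply, smul_eq_mul, mul_assoc, ← Finset.mul_sum]; ring)
    (fun x y y' => by simp [Finset.sum_add_distrib, mul_add])
    (fun a x y => by
      simp only [Pi.smul_apply, smul_eq_mul, mul_left_comm _ a, ← Finset.mul_sum])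
  symm x y := by
    simp only [LinearMap.mk₂_apply]
    congr 1
    rw [← Equiv.sum_comp Fin.revPerm]
    simp [mul_comm]
  nondeg x h := by
    funext i
    have := h (Pi.single i.rev 1)
    simp only [LinearMap.mk₂_apply, mul_eq_zero, c.ne_zero, false_or] at this
    rw [Finset.sum_eq_single i] at this
    · simpa using this
    · intro j _ hj
      rw [Pi.single_eq_of_ne (by simpa using hj), mul_zero]
    · simp

lemma antidiagonal_one (c : Kˣ) : GW.mk (antidiagonal 1 c) = GW.unary c := by
  refine GW.mk_eq_mk (LinearEquiv.funUnique (Fin 1) K K) fun (x y : Fin 1 → K) => ?_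
  change (c : K) * (x 0 * y 0) = c * ∑ i, x i * y i.rev
  simp

/-- Splitting off a hyperbolic plane from the antidiagonal form. -/
def antidiagonalSplit (h2 : (2 : K) ≠ 0) (n : ℕ) (c : Kˣ) :
    (Fin (n + 2) → K) ≃ₗ[K] (K × K) × (Fin n → K) where
  toFun x := ((x 0 + c / 2 * x (Fin.last _), x 0 - c / 2 * x (Fin.last _)),
    fun i => x i.succ.castSucc)
  map_add' x y := by
    ext <;> simp <;> ring
  map_smul' a x := by
    ext <;> simp <;> ring
  invFun v := Fin.snoc (Fin.cons ((v.1.1 + v.1.2) / 2) v.2 : Fin (n + 1) → K)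
    ((v.1.1 - v.1.2) / c)
  left_inv x := by
    have hc := c.ne_zero
    funext i
    refine Fin.lastCases ?_ (fun j => ?_) i
    · simp only [Fin.snoc_last]; field_simp; ring
    · simp only [Fin.snoc_castSucc]
      refine Fin.cases ?_ (fun j => ?_) j
      · simp only [Fin.cons_zero, Fin.castSucc_zero]; field_simp; ring
      · simp
  right_inv v := by
    have hc := c.ne_zero
    have h0 : (Fin.snoc (Fin.cons ((v.1.1 + v.1.2) / 2) v.2 : Fin (n + 1) → K)
        ((v.1.1 - v.1.2) / c) : Fin (n + 2) → K) 0 = (v.1.1 + v.1.2) / 2 := by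
      rw [← Fin.castSucc_zero, Fin.snoc_castSucc, Fin.cons_zero]
    refine Prod.ext (Prod.ext ?_ ?_) ?_
    · simp only [h0, Fin.snoc_last]; field_simp; ring
    · simp only [h0, Fin.snoc_last]; field_simp; ring
    · funext i
      simp only [Fin.snoc_castSucc, Fin.cons_succ]

/-- The outer coordinates span a plane with form `c (x₀ y₁ + x₁ y₀)`. Substituting `x₀ ± (c / 2) x₁`
turns it into a difference of two squares whatever `c` is, and the inner coordinates again carry an
antidiagonal form. -/
lemma antidiagonal_add_two (h2 : (2 : K) ≠ 0) (n : ℕ) (c : Kˣ) :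
    GW.mk (antidiagonal (n + 2) c) = GW.h K + GW.mk (antidiagonal n c) := by
  rw [GW.h, GW.unary, GW.unary, ← GW.mk_sum, ← GW.mk_sum]
  refine GW.mk_eq_mk (antidiagonalSplit h2 n c) fun (x y : Fin (n + 2) → K) => ?_
  change ((1 : Kˣ) : K) * ((x 0 + c / 2 * x (Fin.last _)) * (y 0 + c / 2 * y (Fin.last _))) +
    ((-1 : Kˣ) : K) * ((x 0 - c / 2 * x (Fin.last _)) * (y 0 - c / 2 * y (Fin.last _))) +
    c * ∑ i : Fin n, x i.succ.castSucc * y i.rev.succ.castSucc =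
    c * ∑ i, x i * y i.rev
  rw [Fin.sum_univ_castSucc, Fin.sum_univ_succ]
  simp only [Fin.rev_castSucc, Fin.rev_succ, Fin.rev_last, Fin.castSucc_zero, Fin.rev_zero,
    Fin.succ_castSucc]
  push_cast
  field_simp
  simp
  ring

/-- Only the middle coordinate, which is paired with itself, remembers `c`. -/
lemma antidiagonal_odd (h2 : (2 : K) ≠ 0) (m : ℕ) (c : Kˣ) :
    GW.mk (antidiagonal (2 * m + 1) c) = m • GW.h K + GW.unary c := by
  induction m with
  | zero => simpa using antidiagonal_one c
  | succ m ih =>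
    rw [show 2 * (m + 1) + 1 = 2 * m + 1 + 2 by ring, antidiagonal_add_two h2, ih, succ_nsmul]
    abel

end AntidiagonalForms

/-! ### Functionals dual to an element of `Q ⊗ Q`, and power bases. -/

section Duality

variable {K : Type u} [Field K] {Q : Type u} [CommRing Q] [Algebra K Q]

lemma dualMap_tmul (b c : Q) (μ : Module.Dual K Q) :
    dualMap Q (b ⊗ₜ[K] c) μ = μ b • c := by
  simp [dualMap]

lemma dualMap_add (Δ Δ' : Q ⊗[K] Q) (μ : Module.Dual K Q) :
    dualMap Q (Δ + Δ') μ = dualMap Q Δ μ + dualMap Q Δ' μ := by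
  simp [dualMap]

lemma dualMap_zero (μ : Module.Dual K Q) : dualMap Q (0 : Q ⊗[K] Q) μ = 0 := by
  simp [dualMap]

lemma dualMap_sum {ι : Type*} (s : Finset ι) (Δ : ι → Q ⊗[K] Q) (μ : Module.Dual K Q) :
    dualMap Q (∑ i ∈ s, Δ i) μ = ∑ i ∈ s, dualMap Q (Δ i) μ := by
  simp [dualMap]

lemma dualMap_mul_tmul_one (Δ : Q ⊗[K] Q) (s : Q) (μ : Module.Dual K Q) :
    dualMap Q (Δ * s ⊗ₜ[K] 1) μ = dualMap Q Δ (μ ∘ₗ LinearMap.mulLeft K s) := by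
  induction Δ with
  | zero => simp [dualMap_zero]
  | add x y hx hy => simp [add_mul, dualMap_add, hx, hy]
  | tmul b c => simp [dualMap_tmul, mul_comm]

lemma dualMap_map {Q' : Type u} [CommRing Q'] [Algebra K Q'] (ψ : Q ≃ₐ[K] Q') (Δ : Q ⊗[K] Q)
    (μ : Module.Dual K Q) :
    dualMap Q' (Algebra.TensorProduct.map (ψ : Q →ₐ[K] Q') (ψ : Q →ₐ[K] Q') Δ)
      (μ ∘ₗ ψ.symm.toLinearMap) = ψ (dualMap Q Δ μ) := by
  induction Δ with
  | zero => simp [dualMap_zero]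
  | add x y hx hy => simp only [map_add, dualMap_add, hx, hy]
  | tmul b c => simp [dualMap_tmul]

variable {m : ℕ} (e : Module.Basis (Fin (m + 1)) K Q)

/-- The element `∑ e i ⊗ e (m - i)`. -/
def casimir : Q ⊗[K] Q := ∑ i, e i ⊗ₜ[K] e i.rev

lemma dualMap_casimir (μ : Module.Dual K Q) :
    dualMap Q (casimir e) μ = ∑ i, μ (e i) • e i.rev := by
  simp [casimir, dualMap_sum, dualMap_tmul]

lemma dualMap_casimir_injective : Function.Injective (dualMap Q (casimir e)) := by
  rw [← LinearMap.ker_eq_bot, LinearMap.ker_eq_bot']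
  intro μ hμ
  rw [dualMap_casimir, ← Equiv.sum_comp Fin.revPerm] at hμ
  simp only [Fin.revPerm_apply, Fin.rev_rev] at hμ
  refine e.ext fun i => ?_
  simpa using Fintype.linearIndependent_iff.1 e.linearIndependent _ hμ i.rev

lemma dualMap_casimir_bijective : Function.Bijective (dualMap Q (casimir e)) := by
  have := Module.Basis.finiteDimensional_of_finite e
  exact ⟨dualMap_casimir_injective e, (LinearMap.injective_iff_surjective_of_finrank_eq_finrank
    (Subspace.dual_finrank_eq)).1 (dualMap_casimir_injective e)⟩

/-- The only surviving term is the last one, and its partner is `e 0 = 1`. So the last coordinate is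
the functional that the Scheja-Storch construction attaches to `casimir e`. -/
lemma dualMap_casimir_coord (h0 : e 0 = 1) :
    dualMap Q (casimir e) (e.coord (Fin.last m)) = 1 := by
  rw [dualMap_casimir, Finset.sum_eq_single (Fin.last m)]
  · simp [h0]
  · intro i _ hi
    simp [Finsupp.single_eq_of_ne hi.symm]
  · simp

variable {e} {y : Q}

/-- Past the exponent `m` the powers wrap around: `y ^ (i + j) = b y ^ (i + j - m - 1)`, with
exponent at most `m - 1`. They never reach `y ^ m`, so the value of `b` is irrelevant. -/
lemma coord_basis_mul (he : ∀ i, e i = y ^ (i : ℕ)) {b : K} (hb : y ^ (m + 1) = algebraMap K Q b)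
    (i j : Fin (m + 1)) : e.coord (Fin.last m) (e i * e j) = if j = i.rev then 1 else 0 := by
  rw [he, he, ← pow_add]
  by_cases h : (i : ℕ) + j < m + 1
  · have : y ^ ((i : ℕ) + j) = e ⟨i + j, h⟩ := (he ⟨i + j, h⟩).symm
    rw [this, Module.Basis.coord_apply, Module.Basis.repr_self, Finsupp.single_apply]
    refine if_congr ?_ rfl rfl
    simp only [Fin.ext_iff, Fin.val_last, Fin.val_rev]
    omega
  · obtain ⟨l, hl⟩ := Nat.exists_eq_add_of_le (not_lt.1 h)
    have hl' : l < m + 1 := by omega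
    have : y ^ ((i : ℕ) + j) = b • e ⟨l, hl'⟩ := by
      rw [hl, pow_add, hb, he, Algebra.smul_def]
    rw [this, map_smul, Module.Basis.coord_apply, Module.Basis.repr_self,
      Finsupp.single_eq_of_ne, smul_zero, if_neg]
    · simp only [Fin.ext_iff, Fin.val_rev]; omega
    · simp only [ne_eq, Fin.ext_iff, Fin.val_last]; omega

lemma coord_mul (he : ∀ i, e i = y ^ (i : ℕ)) {b : K} (hb : y ^ (m + 1) = algebraMap K Q b)
    (v w : Q) : e.coord (Fin.last m) (v * w) = ∑ i, e.repr v i * e.repr w i.rev := by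
  conv_lhs => rw [← e.sum_repr v, ← e.sum_repr w, Finset.sum_mul_sum]
  simp only [smul_mul_smul_comm, map_sum, map_smul, coord_basis_mul he hb]
  simp

/-- The class of the form `(v, w) ↦ c η (v w)`, where `η` is the last coordinate with respect to
a basis of powers of an element `y` with `y ^ (m + 1) ∈ K`. -/
lemma mk_eq_antidiagonal (he : ∀ i, e i = y ^ (i : ℕ)) {b : K}
    (hb : y ^ (m + 1) = algebraMap K Q b) (c : Kˣ) (w : Qˣ) (β : SymSpace K)
    (E : β.carrier ≃ₗ[K] Q)
    (hE : ∀ v v', β.form v v' = c * e.coord (Fin.last m) (w * E v * (w * E v'))) :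
    GW.mk β = GW.mk (antidiagonal (m + 1) c) := by
  -- Multiplication by the unit `w` is the isometry that absorbs the square `w ^ 2`.
  let W : Q ≃ₗ[K] Q := LinearEquiv.ofBijective (LinearMap.mulLeft K (w : Q))
    ⟨w.isUnit.mul_right_injective, fun v => ⟨↑w⁻¹ * v, by simp⟩⟩
  refine GW.mk_eq_mk ((E.trans W).trans e.equivFun) fun v v' => ?_
  rw [hE, coord_mul he hb]
  rfl

/-- The factor `s ⊗ 1` can be moved onto the functional, and the map given by `casimir e` is
injective. -/
lemma functional_eq_of_dualMap_eq_one (h0 : e 0 = 1) (s : Q) (η : Module.Dual K Q)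
    (h : dualMap Q (casimir e * s ⊗ₜ[K] 1) η = 1) (v : Q) :
    η (s * v) = e.coord (Fin.last m) v := by
  rw [dualMap_mul_tmul_one, ← dualMap_casimir_coord e h0] at h
  exact congr($(dualMap_casimir_injective e h) v)

end Duality

/-! ### The ideal of the diagonal for localizations of `K[X]`. -/

section Diagonal

variable {K : Type u} [Field K]

/-- The difference of the two pullbacks of a function to the product. -/
def diff {R : Type u} [CommRing R] [Algebra K R] (x : R) : R ⊗[K] R :=
  x ⊗ₜ[K] (1 : R) - (1 : R) ⊗ₜ[K] x

variable {R : Type u} [CommRing R] [Algebra K R]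

lemma diff_mul (x y : R) :
    diff (K := K) (x * y) = diff x * (y ⊗ₜ 1) + (1 ⊗ₜ x) * diff y := by
  simp only [diff, sub_mul, mul_sub, Algebra.TensorProduct.tmul_mul_tmul, mul_one, one_mul]
  abel

lemma diff_add (x y : R) : diff (K := K) (x + y) = diff x + diff y := by
  simp only [diff, TensorProduct.add_tmul, TensorProduct.tmul_add]
  abel

lemma diff_algebraMap (c : K) : diff (K := K) (algebraMap K R c) = 0 := by
  simp [diff, Algebra.algebraMap_eq_smul_one, TensorProduct.smul_tmul]

lemma map_diff {S : Type u} [CommRing S] [Algebra K S] (φ : R →ₐ[K] S) (x : R) :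
    Algebra.TensorProduct.map φ φ (diff (K := K) x) = diff (φ x) := by
  simp [diff]

/-- By the Leibniz rule the linear map `a ⊗ b ↦ a • D b` sends `(a ⊗ b) * diff y` to `-(a b) • D y`;
apply this to both sides. So the image of `d` under multiplication plays the role of `dx / dy`. -/
lemma derivation_eq_of_diff_eq {M : Type*} [AddCommGroup M] [Module R M] [Module K M]
    [IsScalarTower K R M] (D : Derivation K R M) {x y : R} {d : R ⊗[K] R}
    (h : diff x = d * diff y) : D x = Algebra.TensorProduct.lmul' K d • D y := by
  let T : R ⊗[K] R →ₗ[K] M := TensorProduct.lift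
    (LinearMap.mk₂ K (fun a b => a • D b) (fun a b c => add_smul _ _ _) (fun c a b => smul_assoc _ _ _)
      (fun a b c => by rw [map_add, smul_add])
      (fun c a b => by rw [D.map_smul, smul_algebra_smul_comm]))
  have hT (a b : R) : T (a ⊗ₜ b) = a • D b := by simp [T]
  have key (d : R ⊗[K] R) (y : R) :
      T (d * diff y) = - (Algebra.TensorProduct.lmul' K d • D y) := by
    induction d with
    | zero => simp
    | add a b ha hb => simp only [add_mul, map_add, ha, hb, add_smul, neg_add]
    | tmul a b =>
      simp only [diff, mul_sub, Algebra.TensorProduct.tmul_mul_tmul, map_sub, hT, mul_one,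
        Derivation.leibniz, smul_add, smul_smul, Algebra.TensorProduct.lmul'_apply_tmul]
      abel
  have h1 := key 1 x
  rw [one_mul, h, key] at h1
  simpa using h1.symm

variable [Algebra K[X] R] [IsScalarTower K K[X] R]

variable (R) in
/-- The image of the variable. -/
def coordinate : R := algebraMap K[X] R X

/-- Every difference is a multiple of the difference of the coordinate. -/
lemma diff_coordinate_dvd (M : Submonoid K[X]) [IsLocalization M R] (x : R) :
    diff (K := K) (coordinate (K := K) R) ∣ diff x := by
  have hpoly (h : K[X]) : diff (K := K) (coordinate (K := K) R) ∣ diff (algebraMap K[X] R h) := by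
    induction h using Polynomial.induction_on' with
    | add p q hp hq => rw [map_add, diff_add]; exact dvd_add hp hq
    | monomial n a =>
      rw [← C_mul_X_pow_eq_monomial, map_mul, diff_mul, map_pow]
      refine dvd_add ?_ (Dvd.dvd.mul_left ?_ _)
      · rw [Polynomial.C_eq_algebraMap, ← IsScalarTower.algebraMap_apply, diff_algebraMap,
          zero_mul]
        exact dvd_zero _
      · induction n with
        | zero => rw [pow_zero, ← map_one (algebraMap K R), diff_algebraMap]; exact dvd_zero _
        | succ n ih =>
          rw [pow_succ, diff_mul]
          exact dvd_add (ih.mul_right _) (dvd_mul_left _ _)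
  obtain ⟨⟨h, s⟩, hs⟩ := IsLocalization.surj M x
  obtain ⟨t, ht⟩ : ∃ t, t * algebraMap K[X] R s = 1 :=
    (IsLocalization.map_units R s).exists_left_inv
  -- This is the quotient rule for `x = h / s`.
  have h1 : diff (K := K) x * (algebraMap K[X] R s ⊗ₜ 1) =
      diff (algebraMap K[X] R h) - (1 ⊗ₜ x) * diff (algebraMap K[X] R s) := by
    rw [← hs, diff_mul, add_sub_cancel_right]
  have h2 : diff (K := K) x = (diff (algebraMap K[X] R h) - (1 ⊗ₜ x) *
      diff (algebraMap K[X] R s)) * (t ⊗ₜ 1) := by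
    rw [← h1, mul_assoc, Algebra.TensorProduct.tmul_mul_tmul, mul_comm _ t, ht, one_mul,
      ← Algebra.TensorProduct.one_def, mul_one]
  rw [h2]
  exact (dvd_sub (hpoly _) ((hpoly _).mul_left _)).mul_right _

/-- The kernel of multiplication is generated by the elements `1 ⊗ s - s ⊗ 1`, and each of them is a
multiple of the difference of the coordinate. -/
lemma diff_coordinate_dvd_of_lmul'_eq_zero (M : Submonoid K[X]) [IsLocalization M R]
    {d : R ⊗[K] R} (hd : Algebra.TensorProduct.lmul' K d = 0) :
    diff (K := K) (coordinate (K := K) R) ∣ d := by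
  have h : d ∈ KaehlerDifferential.ideal K R := hd
  rw [← KaehlerDifferential.span_range_eq_ideal] at h
  rw [← Ideal.mem_span_singleton]
  refine (Ideal.span_le.2 ?_) h
  rintro _ ⟨s, rfl⟩
  rw [SetLike.mem_coe, Ideal.mem_span_singleton]
  convert (diff_coordinate_dvd M s).neg_right using 1
  exact (neg_sub _ _).symm

/-- The difference of the coordinate is not a zero divisor. -/
lemma diff_coordinate_mul_cancel (M : Submonoid K[X]) (hM : M ≤ nonZeroDivisors K[X])
    [IsLocalization M R] {w : R ⊗[K] R} (h : w * diff (coordinate (K := K) R) = 0) : w = 0 := by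
  let ι : K[X] →ₐ[K] R := IsScalarTower.toAlgHom K K[X] R
  have hι : Function.Injective ι := IsLocalization.injective R hM
  have hιι : Function.Injective (Algebra.TensorProduct.map ι ι) := by
    have : Function.Injective (TensorProduct.map ι.toLinearMap ι.toLinearMap) :=
      TensorProduct.map_injective_of_flat_flat _ _ hι hι
    exact this
  -- Denominators are cleared in both tensor factors, which reduces the claim to `K[X] ⊗ K[X]`.
  have hden (w : R ⊗[K] R) : ∃ s ∈ M, ∃ t ∈ M, ∃ v : K[X] ⊗[K] K[X],
      w * (ι s ⊗ₜ ι t) = Algebra.TensorProduct.map ι ι v := by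
    induction w with
    | zero => exact ⟨1, M.one_mem, 1, M.one_mem, 0, by simp⟩
    | tmul a b =>
      obtain ⟨⟨a', s⟩, hs⟩ := IsLocalization.surj M a
      obtain ⟨⟨b', t⟩, ht⟩ := IsLocalization.surj M b
      refine ⟨s, s.2, t, t.2, a' ⊗ₜ b', ?_⟩
      rw [Algebra.TensorProduct.tmul_mul_tmul, Algebra.TensorProduct.map_tmul]
      exact congrArg₂ _ hs ht
    | add a b ha hb =>
      obtain ⟨s, hs, t, ht, v, hv⟩ := ha
      obtain ⟨s', hs', t', ht', v', hv'⟩ := hb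
      refine ⟨s * s', M.mul_mem hs hs', t * t', M.mul_mem ht ht',
        v * (s' ⊗ₜ t') + v' * (s ⊗ₜ t), ?_⟩
      have h1 : ι (s * s') ⊗ₜ[K] ι (t * t') = (ι s ⊗ₜ ι t) * (ι s' ⊗ₜ ι t') := by simp
      simp only [map_add, map_mul (Algebra.TensorProduct.map ι ι), ← hv, ← hv',
        Algebra.TensorProduct.map_tmul, h1]
      ring
  -- `K[X] ⊗ K[X]` is the domain `K[X][X]`, in which the difference of the variables is the nonzero
  -- element `C X - X`.
  have hX (v : K[X] ⊗[K] K[X]) (hv : v * diff X = 0) : v = 0 := by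
    let ε := (polyEquivTensor K K[X]).symm
    have h1 : ε v * (Polynomial.C Polynomial.X - Polynomial.X) = 0 := by
      rw [← map_zero ε, ← hv, map_mul]
      congr 1
      simp [ε, diff, polyEquivTensor_symm_apply_tmul_eq_smul, Algebra.smul_def]
    rcases mul_eq_zero.1 h1 with h2 | h2
    · simpa using h2
    · rw [sub_eq_zero] at h2
      exact absurd h2 (Polynomial.X_ne_C _).symm
  obtain ⟨s, hs, t, ht, v, hv⟩ := hden w
  have h1 : v * diff X = 0 := by
    apply hιι
    rw [map_mul, ← hv, map_diff, map_zero, mul_right_comm]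
    change w * diff (coordinate (K := K) R) * _ = 0
    rw [h, zero_mul]
  rw [hX v h1, map_zero] at hv
  obtain ⟨s', hs'⟩ := (IsLocalization.map_units R ⟨s, hs⟩).exists_right_inv
  obtain ⟨t', ht'⟩ := (IsLocalization.map_units R ⟨t, ht⟩).exists_right_inv
  have : (ι s ⊗ₜ[K] ι t) * (s' ⊗ₜ t') = 1 := by
    rw [Algebra.TensorProduct.tmul_mul_tmul, Algebra.TensorProduct.one_def]
    exact congrArg₂ _ hs' ht'
  rw [← mul_one w, ← this, ← mul_assoc, hv, zero_mul]

end Diagonal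

/-! ### Quotients of local rings under unramified maps with equal residue fields. -/

section LocalRings

variable {L O : Type*} [CommRing L] [IsLocalRing L] [CommRing O] [IsLocalRing O] (φ : L →+* O)

/-- The power `𝔪 ^ j` of the target is generated by images of elements of the source. Replacing the
coefficients of a combination of these generators by residue representatives gains one more power of
`𝔪`. -/
lemma exists_sub_mem_maximalIdeal_pow
    (hm : (IsLocalRing.maximalIdeal L).map φ = IsLocalRing.maximalIdeal O)
    (hres : ∀ b, ∃ l, b - φ l ∈ IsLocalRing.maximalIdeal O) (j : ℕ) (b : O) :
    ∃ l, b - φ l ∈ IsLocalRing.maximalIdeal O ^ j := by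
  have step (j : ℕ) (z : O) (hz : z ∈ IsLocalRing.maximalIdeal O ^ j) :
      ∀ a, ∃ l, a * z - φ l ∈ IsLocalRing.maximalIdeal O ^ (j + 1) := by
    rw [← hm, ← Ideal.map_pow] at hz
    refine Submodule.span_induction ?_ (fun _ => ⟨0, by simp⟩) ?_ ?_ hz
    · rintro _ ⟨l, hl, rfl⟩ a
      obtain ⟨l', hl'⟩ := hres a
      refine ⟨l' * l, ?_⟩
      rw [map_mul, ← sub_mul, pow_succ']
      refine Ideal.mul_mem_mul hl' ?_
      rw [← hm, ← Ideal.map_pow]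
      exact Ideal.mem_map_of_mem _ hl
    · intro x y _ _ hx hy a
      obtain ⟨l, hl⟩ := hx a
      obtain ⟨l', hl'⟩ := hy a
      refine ⟨l + l', ?_⟩
      rw [map_add, mul_add, add_sub_add_comm]
      exact add_mem hl hl'
    · intro c x _ hx a
      rw [smul_eq_mul, ← mul_assoc]
      exact hx _
  induction j with
  | zero => exact ⟨0, by simp⟩
  | succ j ih =>
    obtain ⟨l, hl⟩ := ih
    obtain ⟨l', hl'⟩ := step j _ hl 1
    exact ⟨l + l', by rwa [map_add, ← sub_sub, ← one_mul (b - φ l)]⟩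

/-- Surjectivity is approximation modulo `𝔪 ^ j ⊆ (g)`. For injectivity, divisibility in `L` is
total: if `F = l * l'` while `g` divides `φ l`, then `φ l'` is a unit, hence so is `l'`, and `F`
divides `l`. -/
lemma quotient_lift_bijective [PreValuationRing L] [IsDomain O] [IsLocalHom φ]
    (hm : (IsLocalRing.maximalIdeal L).map φ = IsLocalRing.maximalIdeal O)
    (hres : ∀ b, ∃ l, b - φ l ∈ IsLocalRing.maximalIdeal O) {F : L} {g v : O}
    (hF : φ F = g * v) (hv : IsUnit v) (hg : g ≠ 0) {j : ℕ}
    (hj : IsLocalRing.maximalIdeal O ^ j ≤ Ideal.span {g})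
    (ψ : L ⧸ Ideal.span {F} →+* O ⧸ Ideal.span {g})
    (hψ : ∀ l, ψ (Ideal.Quotient.mk _ l) = Ideal.Quotient.mk _ (φ l)) :
    Function.Bijective ψ := by
  constructor
  · rw [injective_iff_map_eq_zero]
    intro l hl
    obtain ⟨l, rfl⟩ := Ideal.Quotient.mk_surjective l
    rw [hψ, Ideal.Quotient.eq_zero_iff_mem, Ideal.mem_span_singleton] at hl
    obtain ⟨h, hh⟩ := hl
    rw [Ideal.Quotient.eq_zero_iff_mem, Ideal.mem_span_singleton]
    obtain h1 | ⟨l', rfl⟩ := ValuationRing.dvd_total F l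
    · exact h1
    · have hu : h * φ l' = v := by
        apply mul_left_cancel₀ hg
        rw [← hF, map_mul, hh, mul_assoc]
      have : IsUnit l' := (isUnit_map_iff φ l').1 (isUnit_of_mul_isUnit_right (hu ▸ hv))
      obtain ⟨l'', hl''⟩ := this.exists_right_inv
      exact ⟨l'', by rw [mul_assoc, hl'', mul_one]⟩
  · intro b
    obtain ⟨b, rfl⟩ := Ideal.Quotient.mk_surjective b
    obtain ⟨l, hl⟩ := exists_sub_mem_maximalIdeal_pow φ hm hres j b
    exact ⟨Ideal.Quotient.mk _ l, by rw [hψ]; exact (Ideal.Quotient.eq.2 (hj hl)).symm⟩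

end LocalRings

/-! ### Local rings of the affine line. -/

section LineLocalRing

variable {K : Type u} [Field K] {O : Type u} [CommRing O] [IsLocalRing O] [Algebra K O] (x : O)

/-- Every ideal of a localization of `K[X]` is extended from `K[X]`, hence principal, and a local
principal ideal domain is a valuation ring. The prime `imagePrime K x` may be zero here. -/
instance : PreValuationRing (LineLocalRing K x) := by
  have : IsPrincipalIdealRing (LineLocalRing K x) := by
    refine ⟨fun S => ?_⟩
    rw [← IsLocalization.map_under (imagePrime K x).primeCompl _ S]
    obtain ⟨g, hg⟩ := IsPrincipalIdealRing.principal (S.under K[X])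
    refine ⟨algebraMap K[X] _ g, ?_⟩
    rw [hg, Ideal.submodule_span_eq, Ideal.map_span, Set.image_singleton]
  infer_instance

lemma linePullback_algebraMap (h : K[X]) :
    linePullback K x (algebraMap K[X] (LineLocalRing K x) h) = aeval x h :=
  IsLocalization.lift_eq _ _

/-- Pullback of germs of functions, as a homomorphism of algebras. -/
def linePullbackₐ : LineLocalRing K x →ₐ[K] O where
  __ := linePullback K x
  commutes' c := by
    change linePullback K x (algebraMap K (LineLocalRing K x) c) = _
    rw [IsScalarTower.algebraMap_apply K K[X] (LineLocalRing K x), linePullback_algebraMap]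
    simp

lemma linePullback_lineCoord : linePullback K x (lineCoord x) = x := by
  rw [lineCoord, linePullback_algebraMap, aeval_X]

instance : IsLocalHom (linePullback K x) where
  map_nonunit l hl := by
    obtain ⟨h, s, rfl⟩ := IsLocalization.exists_mk'_eq (imagePrime K x).primeCompl l
    rw [IsLocalization.AtPrime.isUnit_mk'_iff _ (imagePrime K x)]
    intro hh
    have h1 : linePullback K x (IsLocalization.mk' _ h s) *
        linePullback K x (algebraMap _ _ (s : K[X])) = aeval x h := by
      rw [← map_mul, IsLocalization.mk'_spec, linePullback_algebraMap]
    have h2 : ¬ IsUnit (aeval x h) := hh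
    apply h2
    rw [← h1]
    refine hl.mul ?_
    exact (IsLocalization.map_units (LineLocalRing K x) s).map _

end LineLocalRing

/-! ### The power basis of the quotient by `X ^ (m + 1) - b`. -/

section PowerBasis

variable {K : Type u} [Field K] {R : Type u} [CommRing R] [Algebra K R] [Algebra K[X] R]
  [IsScalarTower K K[X] R] {P : Ideal K[X]} [P.IsPrime] [IsLocalization.AtPrime R P]
  {π : K[X]} {m k : ℕ} {b : K}

include P in
/-- The residue classes of the powers of the coordinate form a basis. -/
lemma exists_basis_pow (hP : P = Ideal.span {π}) (hG : π ^ k = X ^ (m + 1) - Polynomial.C b)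
    {J : Ideal R} (hJ : J = Ideal.span {algebraMap K[X] R (π ^ k)}) :
    ∃ e : Module.Basis (Fin (m + 1)) K (R ⧸ J),
      ∀ i, e i = (Ideal.Quotient.mk J (coordinate (K := K) R)) ^ (i : ℕ) := by
  have hmonic : (π ^ k).Monic := hG ▸ monic_X_pow_sub_C b m.succ_ne_zero
  have hdeg : (π ^ k).natDegree = m + 1 := hG ▸ natDegree_X_pow_sub_C
  have hk : k ≠ 0 := by
    rintro rfl
    simp at hdeg
  have hπ0 : π ≠ 0 := by
    rintro rfl
    rw [zero_pow hk] at hmonic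
    exact not_monic_zero hmonic
  have hπ : Prime π := (Ideal.span_singleton_prime hπ0).1 (hP ▸ ‹P.IsPrime›)
  have hM : P.primeCompl ≤ nonZeroDivisors K[X] := P.primeCompl_le_nonZeroDivisors
  have hcompl (s : P.primeCompl) : ¬ π ∣ s := fun hd =>
    s.2 (hP.ge (Ideal.mem_span_singleton.2 hd))
  let q : K[X] →ₐ[K] R ⧸ J := (Ideal.Quotient.mkₐ K J).comp (IsScalarTower.toAlgHom K K[X] R)
  have hq (h : K[X]) : q h = Ideal.Quotient.mk J (algebraMap K[X] R h) := rfl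
  have hq0 : q (π ^ k) = 0 := by
    rw [hq, Ideal.Quotient.eq_zero_iff_mem, hJ]
    exact Ideal.mem_span_singleton_self _
  let lift : AdjoinRoot (π ^ k) →ₐ[K] R ⧸ J :=
    Ideal.Quotient.liftₐ (Ideal.span {π ^ k}) q fun h hh => by
      obtain ⟨h', rfl⟩ := Ideal.mem_span_singleton.1 hh
      rw [map_mul, hq0, zero_mul]
  have hlift (h : K[X]) : lift (AdjoinRoot.mk _ h) = q h := rfl
  -- The localization inverts only polynomials prime to `π`, and these are already invertible modulo
  -- `π ^ k`; so the quotient agrees with `K[X] / (π ^ k)`.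
  have hbij : Function.Bijective lift := by
    constructor
    · rw [injective_iff_map_eq_zero]
      intro h hh
      obtain ⟨h, rfl⟩ := AdjoinRoot.mk_surjective h
      rw [hlift, hq, Ideal.Quotient.eq_zero_iff_mem, hJ, Ideal.mem_span_singleton] at hh
      obtain ⟨w, hw⟩ := hh
      obtain ⟨⟨a, s⟩, hs⟩ := IsLocalization.surj P.primeCompl w
      have h1 : h * s = π ^ k * a := by
        apply IsLocalization.injective R hM
        rw [map_mul, map_mul, hw, ← hs, mul_assoc]
      rw [AdjoinRoot.mk_eq_zero]
      exact hπ.pow_dvd_of_dvd_mul_right k (hcompl s) ⟨a, h1⟩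
    · intro z
      obtain ⟨z, rfl⟩ := Ideal.Quotient.mk_surjective z
      obtain ⟨h, s, rfl⟩ := IsLocalization.exists_mk'_eq P.primeCompl z
      have hcop : IsCoprime (s : K[X]) (π ^ k) := by
        refine IsCoprime.pow_right (IsCoprime.symm ?_)
        exact (hπ.irreducible.coprime_iff_not_dvd).2 (hcompl s)
      obtain ⟨a, a', ha⟩ := hcop
      refine ⟨AdjoinRoot.mk _ (h * a), ?_⟩
      have h1 : q a * q s = 1 := by
        rw [← map_mul, ← map_one q, ← ha, map_add, map_mul _ a', hq0, mul_zero, add_zero]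
      rw [hlift, map_mul]
      have h2 : q h = Ideal.Quotient.mk J (IsLocalization.mk' R h s) * q s := by
        rw [hq, hq, ← map_mul, IsLocalization.mk'_spec]
      rw [h2, mul_assoc, mul_comm (q s), h1, mul_one]
  let pb := AdjoinRoot.powerBasis' hmonic
  have hdim : pb.dim = m + 1 := hdeg
  refine ⟨(pb.basis.map (LinearEquiv.ofBijective lift.toLinearMap hbij)).reindex
    (finCongr hdim), fun i => ?_⟩
  rw [Module.Basis.reindex_apply, Module.Basis.map_apply, PowerBasis.basis_eq_pow]
  change lift (AdjoinRoot.mk _ X ^ (i : ℕ)) = _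
  rw [map_pow, hlift]
  rfl

omit [P.IsPrime] [IsLocalization.AtPrime R P] in
lemma coordinate_pow_eq (hG : π ^ k = X ^ (m + 1) - Polynomial.C b)
    {J : Ideal R} (hJ : J = Ideal.span {algebraMap K[X] R (π ^ k)}) :
    (Ideal.Quotient.mk J (coordinate (K := K) R)) ^ (m + 1) = algebraMap K (R ⧸ J) b := by
  rw [← map_pow, coordinate, ← map_pow]
  change _ = Ideal.Quotient.mk J (algebraMap K R b)
  rw [IsScalarTower.algebraMap_apply K K[X] R, Ideal.Quotient.eq, ← map_sub, hJ,
    ← Polynomial.C_eq_algebraMap, ← hG]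
  exact Ideal.mem_span_singleton_self _

end PowerBasis

/-! ### The Scheja-Storch form and its independence of the coordinate. -/

section IndexForm

variable {K : Type u} [Field K]

section

variable {Q : Type u} [CommRing Q] [Algebra K Q] {m : ℕ} {B : Module.Basis (Fin (m + 1)) K Q}

lemma dualMap_smul_casimir (c : K) (μ : Module.Dual K Q) :
    dualMap Q (c • casimir B) μ = c • dualMap Q (casimir B) μ := by
  simp [dualMap]

lemma dualMap_smul_casimir_bijective (c : Kˣ) :
    Function.Bijective (dualMap Q ((c : K) • casimir B)) := by
  have h : ⇑(dualMap Q ((c : K) • casimir B)) =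
      (LinearEquiv.smulOfUnit c : Q ≃ₗ[K] Q) ∘ dualMap Q (casimir B) :=
    funext (dualMap_smul_casimir _)
  rw [h]
  exact (LinearEquiv.bijective _).comp (dualMap_casimir_bijective B)

lemma dualMap_smul_casimir_coord (hB : B 0 = 1) (c : Kˣ) :
    dualMap Q ((c : K) • casimir B) ((↑c⁻¹ : K) • B.coord (Fin.last m)) = 1 := by
  rw [dualMap_smul_casimir, map_smul, dualMap_casimir_coord B hB, smul_smul, Units.mul_inv,
    one_smul]

lemma antidiagonal_form_eq {y : Q} (he : ∀ i, B i = y ^ (i : ℕ)) {b : K}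
    (hb : y ^ (m + 1) = algebraMap K Q b) (c : Kˣ) (s t : Fin (m + 1) → K) :
    (antidiagonal (m + 1) c).form s t =
      ((c : K) • B.coord (Fin.last m)) (B.equivFun.symm s * B.equivFun.symm t) := by
  have h (s : Fin (m + 1) → K) (i) : B.repr (B.equivFun.symm s) i = s i := by
    rw [← B.equivFun_apply, LinearEquiv.apply_symm_apply]
  rw [LinearMap.smul_apply, coord_mul he hb]
  simp only [h]
  rfl

end

lemma diff_smul {R : Type u} [CommRing R] [Algebra K R] (c : K) (x : R) :
    diff (K := K) (c • x) = c • diff x := by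
  rw [diff, diff, smul_sub, TensorProduct.smul_tmul', TensorProduct.tmul_smul]

/-- A difference of two `(m + 1)`-st powers is factored by the geometric sum. Its cofactor becomes
`casimir` of the power basis in the quotient. -/
lemma diff_geom_sum {R : Type u} [CommRing R] [Algebra K R] (y : R) (m : ℕ) (b : K) :
    diff (K := K) (y ^ (m + 1) - algebraMap K R b) =
      (∑ i : Fin (m + 1), (y ^ (i : ℕ)) ⊗ₜ[K] (y ^ (i.rev : ℕ))) * diff y := by
  have h : diff (K := K) (y ^ (m + 1) - algebraMap K R b) =
      (y ⊗ₜ[K] (1 : R)) ^ (m + 1) - ((1 : R) ⊗ₜ[K] y) ^ (m + 1) := by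
    rw [sub_eq_add_neg, ← map_neg, diff_add, diff_algebraMap, add_zero]
    simp [diff, Algebra.TensorProduct.tmul_pow]
  rw [h, diff, ← Commute.geom_sum₂_mul (Commute.all _ _),
    ← Fin.sum_univ_eq_sum_range (fun i => (y ⊗ₜ[K] (1 : R)) ^ i * ((1 : R) ⊗ₜ[K] y) ^ (m + 1 - 1 - i))]
  congr 1
  refine Finset.sum_congr rfl fun i _ => ?_
  rw [Algebra.TensorProduct.tmul_pow, Algebra.TensorProduct.tmul_pow,
    Algebra.TensorProduct.tmul_mul_tmul, one_pow, one_pow, mul_one, one_mul, Fin.val_rev]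
  congr 2
  omega

variable {O : Type u} [CommRing O] [IsLocalRing O] [Algebra K O]
  [Algebra K[X] O] [IsScalarTower K K[X] O] {P : Ideal K[X]} [P.IsPrime]
  [IsLocalization.AtPrime O P] {π : K[X]} {m k : ℕ} {b : K}

include P in
/-- The form given by the Scheja-Storch functional does not depend on the choice of the
coordinate `x`, if the function is multiplied by the derivative `d` of `x`, and by a square. -/
theorem eq_antidiagonal_of_isIndexForm [IsDomain O] (hP : P = Ideal.span {π})
    (hG : π ^ k = X ^ (m + 1) - Polynomial.C b) {x f : O} {α : GW K} {c : Kˣ} {w : O} (hw : IsUnit w)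
    {d : O ⊗[K] O} (hd : diff x = d * diff (coordinate (K := K) O))
    (hd' : IsUnit (Algebra.TensorProduct.lmul' K d)) {e : O}
    (hf : f = algebraMap K O c * algebraMap K[X] O (π ^ k) *
      (1 + algebraMap K[X] O (π ^ k) * e) * Algebra.TensorProduct.lmul' K d * w ^ 2)
    (hm : (IsLocalRing.maximalIdeal (LineLocalRing K x)).map (linePullback K x) =
      IsLocalRing.maximalIdeal O)
    (hres : ∀ b, ∃ l, b - linePullback K x l ∈ IsLocalRing.maximalIdeal O)
    (h : IsIndexForm x f α) : α = GW.mk (antidiagonal (m + 1) c⁻¹) := by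
  obtain ⟨F, N, hN, hF, η, ⟨a, ha, -, hη⟩, β, E, hβ, rfl⟩ := h
  have hmonic : (π ^ k).Monic := hG ▸ monic_X_pow_sub_C b m.succ_ne_zero
  have hk : k ≠ 0 := by
    rintro rfl
    have := congrArg natDegree hG
    rw [natDegree_X_pow_sub_C] at this
    simp at this
  have hM : P.primeCompl ≤ nonZeroDivisors K[X] := P.primeCompl_le_nonZeroDivisors
  set G : O := algebraMap K[X] O (π ^ k) with hGdef
  have hG0 : G ≠ 0 := fun h0 => hmonic.ne_zero (IsLocalization.injective O hM (by rw [map_zero, ← h0]))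
  have hmax : IsLocalRing.maximalIdeal O = Ideal.span {algebraMap K[X] O π} := by
    rw [← IsLocalization.AtPrime.map_eq_maximalIdeal P O, hP, Ideal.map_span, Set.image_singleton]
  have hGmax : G ∈ IsLocalRing.maximalIdeal O := by
    rw [hmax, hGdef, map_pow]
    exact Ideal.pow_mem_of_mem _ (Ideal.mem_span_singleton_self _) _ (Nat.pos_of_ne_zero hk)
  set y : O := coordinate (K := K) O with hy
  have hGy : G = y ^ (m + 1) - algebraMap K O b := by
    rw [hGdef, hG, map_sub, map_pow, Polynomial.C_eq_algebraMap, ← IsScalarTower.algebraMap_apply]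
    rfl
  set x' : O := Algebra.TensorProduct.lmul' K d with hx'
  have hone (z : O) : IsUnit (1 + G * z) := by
    refine (IsLocalRing.notMem_maximalIdeal).1 fun h => ?_
    have h1 := sub_mem h (Ideal.mul_mem_right z _ hGmax)
    rw [add_sub_cancel_right] at h1
    exact (IsLocalRing.notMem_maximalIdeal.2 isUnit_one) h1
  -- the function `F` on the line is a multiple of `G` by a unit
  obtain ⟨e₂, he₂⟩ := Ideal.mem_span_singleton.1 (hN hF)
  set φ := linePullbackₐ (K := K) x
  have hφ (l) : φ l = linePullback K x l := rfl
  have hc : IsUnit (algebraMap K O c) := c.isUnit.map _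
  set v₀ : O := algebraMap K O c * w ^ 2 * x' with hv₀
  have hv₀u : IsUnit v₀ := (hc.mul (hw.pow 2)).mul hd'
  have hfG : f = G * (v₀ * (1 + G * e)) := by rw [hf, hv₀]; ring
  set v : O := v₀ * (1 + G * e) * (1 + G * (v₀ * (1 + G * e) * e₂)) with hv
  have hvu : IsUnit v := (hv₀u.mul (hone _)).mul (hone _)
  have hFv : φ F = G * v := by
    have h1 : φ F = f + f ^ 2 * e₂ := by rw [← he₂, hφ]; ring
    rw [h1, hfG, hv]; ring
  -- the quotient algebras
  let q : O →ₐ[K] O ⧸ Ideal.span {G} := Ideal.Quotient.mkₐ K _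
  have hqG : q G = 0 := Ideal.Quotient.eq_zero_iff_mem.2 (Ideal.mem_span_singleton_self _)
  -- The pullback of `F` agrees with `f` modulo `f ^ 2`, not only modulo `f`. This is what fixes the
  -- unit `v` modulo `G`.
  have hqv : q v = q v₀ := by
    simp only [hv, map_mul q, map_add q, map_one q, hqG, zero_mul, add_zero, mul_one]
  let ψ₀ : (LineLocalRing K x ⧸ Ideal.span {F}) →ₐ[K] O ⧸ Ideal.span {G} :=
    Ideal.Quotient.liftₐ _ (q.comp φ) fun l hl => by
      obtain ⟨l, rfl⟩ := Ideal.mem_span_singleton.1 hl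
      rw [AlgHom.comp_apply, map_mul, hFv, map_mul, map_mul, hqG, zero_mul, zero_mul]
  have hψ₀ (l) : ψ₀ (Ideal.Quotient.mk _ l) = q (φ l) := rfl
  have hbij : Function.Bijective ψ₀ := by
    refine quotient_lift_bijective (linePullback K x) hm hres hFv hvu hG0 (j := k) ?_
      ψ₀.toRingHom fun l => rfl
    rw [hmax, Ideal.span_singleton_pow, hGdef, map_pow]
  let ψ := AlgEquiv.ofBijective ψ₀ hbij
  have hψ (l) : ψ (Ideal.Quotient.mk _ l) = q (φ l) := rfl
  obtain ⟨B, hB⟩ := exists_basis_pow (R := O) hP hG (J := Ideal.span {G}) rfl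
  have hb := coordinate_pow_eq (R := O) hG (J := Ideal.span {G}) rfl
  have hB0 : B 0 = 1 := by rw [hB]; exact pow_zero _
  -- comparison of the diagonal classes
  let φφ := Algebra.TensorProduct.map φ φ
  let qq := Algebra.TensorProduct.map q q
  have h1 : diff (φ F) = φφ a * diff x := by
    have h2 : diff (K := K) F = a * diff (lineCoord x) := ha
    rw [← map_diff, h2, map_mul, map_diff, hφ, linePullback_lineCoord]
  have h3 := diff_geom_sum (K := K) y m b
  rw [← hGy] at h3
  set a₀ := ∑ i : Fin (m + 1), (y ^ (i : ℕ)) ⊗ₜ[K] (y ^ (i.rev : ℕ))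
  have ha₀ : qq a₀ = casimir B := by
    simp only [a₀, casimir, map_sum, qq, Algebra.TensorProduct.map_tmul, hB, map_pow]
    rfl
  obtain ⟨e', he'⟩ := diff_coordinate_dvd (K := K) P.primeCompl v
  -- Both sides become `diff (G * v)` after multiplication by `diff y`, which is not a zero divisor.
  have h4 : φφ a * d = a₀ * (v ⊗ₜ 1) + (1 ⊗ₜ G) * e' := by
    rw [← sub_eq_zero]
    refine diff_coordinate_mul_cancel P.primeCompl hM ?_
    have h5 : φφ a * d * diff y = diff (G * v) := by rw [mul_assoc, ← hd, ← h1, hFv]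
    rw [sub_mul, h5, diff_mul, h3, he']
    ring
  have h5 : qq (φφ a) * qq d = casimir B * (q v₀ ⊗ₜ 1) := by
    rw [← map_mul, h4, map_add, map_mul, map_mul, ha₀]
    simp [qq, hqG, hqv]
  -- The class of `y` lifts to some `l` in the local ring of the line, where `diff l` is a multiple
  -- of the difference of the coordinate. Multiplying the latter by `a` gives `diff F`, which dies
  -- in the quotient.
  have h6 : qq (φφ a) * diff (q y) = 0 := by
    obtain ⟨l, hl⟩ := hbij.2 (q y)
    obtain ⟨l, rfl⟩ := Ideal.Quotient.mk_surjective l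
    obtain ⟨z, hz⟩ := diff_coordinate_dvd (K := K) (imagePrime K x).primeCompl l
    rw [← hl, hψ₀, ← map_diff, ← map_diff, hz]
    change qq (φφ a) * qq (φφ (diff (lineCoord x) * z)) = 0
    have h7 : diff (K := K) F = a * diff (lineCoord x) := ha
    rw [← map_mul, ← map_mul, ← mul_assoc, ← h7, map_mul, map_mul, map_diff, map_diff]
    rw [hFv, map_mul, hqG, zero_mul]
    simp [diff]
  obtain ⟨z, hz⟩ := diff_coordinate_dvd_of_lmul'_eq_zero (K := K) P.primeCompl
    (d := d - x' ⊗ₜ 1) (by simp [hx'])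
  -- Since `d - x' ⊗ 1` is a multiple of `diff y`, `h6` allows `d` to be replaced by `x' ⊗ 1`.
  have h7 : qq (φφ a) * (q x' ⊗ₜ 1) = casimir B * (q v₀ ⊗ₜ 1) := by
    have h8 : qq d = q x' ⊗ₜ 1 + diff (q y) * qq z := by
      rw [← map_diff q y, ← sub_eq_iff_eq_add']
      change _ = qq _ * _
      rw [← map_mul, ← hz, map_sub]
      simp [qq]
    rw [← h5, h8, mul_add, ← mul_assoc, h6, zero_mul, add_zero]
  -- The derivative `x'` also occurs in `v₀`, and being a unit it cancels; only `c * w ^ 2` is left.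
  have h8 : qq (φφ a) = casimir B * (q (algebraMap K O c * w ^ 2) ⊗ₜ 1) := by
    obtain ⟨i, hi⟩ := (hd'.map q).exists_right_inv
    have h9 : (q x' ⊗ₜ[K] (1 : O ⧸ Ideal.span {G})) * (i ⊗ₜ 1) = 1 := by
      rw [Algebra.TensorProduct.tmul_mul_tmul, hi, one_mul]; rfl
    rw [← mul_one (qq _), ← h9, ← mul_assoc, h7, mul_assoc, hv₀, map_mul,
      Algebra.TensorProduct.tmul_mul_tmul, mul_assoc, hi, mul_one, mul_one]
  -- comparison of the functionals
  have hη' := dualMap_map (K := K) (Q := LineLocalRing K x ⧸ Ideal.span {F}) ψ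
    (Algebra.TensorProduct.map (Ideal.Quotient.mkₐ K (Ideal.span {F}))
      (Ideal.Quotient.mkₐ K (Ideal.span {F})) a) η
  rw [hη, map_one] at hη'
  have h9 : Algebra.TensorProduct.map (ψ : _ →ₐ[K] O ⧸ Ideal.span {G}) (ψ : _ →ₐ[K] _)
      (Algebra.TensorProduct.map (Ideal.Quotient.mkₐ K (Ideal.span {F}))
        (Ideal.Quotient.mkₐ K (Ideal.span {F})) a) = qq (φφ a) := by
    rw [← AlgHom.comp_apply, ← Algebra.TensorProduct.map_comp, ← AlgHom.comp_apply,
      ← Algebra.TensorProduct.map_comp]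
    rfl
  rw [h9, h8] at hη'
  have h10 := functional_eq_of_dualMap_eq_one hB0 _ _ hη'
  obtain ⟨w', hw'⟩ := hw.map q
  refine mk_eq_antidiagonal hB hb c⁻¹ w'⁻¹ β (E.trans ψ.toLinearEquiv) fun s t => ?_
  -- The factor `c * w ^ 2` is split off so that `h10` evaluates the functional. The inverse square
  -- is distributed over the two arguments.
  have h11 : η (E s * E t) = (η ∘ₗ ψ.symm.toLinearMap) (q (algebraMap K O c * w ^ 2) *
      (algebraMap K _ (c⁻¹ : Kˣ) * (↑w'⁻¹ * ψ (E s) * (↑w'⁻¹ * ψ (E t))))) := by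
    have h12 : q (algebraMap K O c * w ^ 2) *
      (algebraMap K _ (c⁻¹ : Kˣ) * (↑w'⁻¹ * ψ (E s) * (↑w'⁻¹ * ψ (E t)))) = ψ (E s * E t) := by
      have h13 : algebraMap K (O ⧸ Ideal.span {G}) c * algebraMap K _ (c⁻¹ : Kˣ) = 1 := by
        rw [← map_mul, Units.mul_inv, map_one]
      have h14 : (w' : O ⧸ Ideal.span {G}) * ↑w'⁻¹ = 1 := Units.mul_inv _
      rw [map_mul, AlgHom.commutes, map_pow, ← hw', map_mul]
      linear_combination (ψ (E s) * ψ (E t) * (w' : O ⧸ Ideal.span {G}) ^ 2 * ↑w'⁻¹ ^ 2) * h13 +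
        (ψ (E s) * ψ (E t)) * ((w' : O ⧸ Ideal.span {G}) * ↑w'⁻¹ + 1) * h14
    rw [h12]
    simp
  rw [hβ, h11, h10, ← Algebra.smul_def, map_smul]
  rfl

include P in
/-- The coordinate of the line can be used to compute an index form. -/
theorem isIndexForm_coordinate (hP : P = Ideal.span {π})
    (hG : π ^ k = X ^ (m + 1) - Polynomial.C b) {f : O} {c : Kˣ} {e : O}
    (hk : k ≠ 0)
    (hf : f = algebraMap K O c * algebraMap K[X] O (π ^ k) *
      (1 + algebraMap K[X] O (π ^ k) * e)) :
    IsIndexForm (coordinate (K := K) O) f (GW.mk (antidiagonal (m + 1) c⁻¹)) := by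
  have hmax : IsLocalRing.maximalIdeal O = Ideal.span {algebraMap K[X] O π} := by
    rw [← IsLocalization.AtPrime.map_eq_maximalIdeal P O, hP, Ideal.map_span, Set.image_singleton]
  set G : O := algebraMap K[X] O (π ^ k) with hGdef
  have hGmax : G ∈ IsLocalRing.maximalIdeal O := by
    rw [hmax, hGdef, map_pow]
    exact Ideal.pow_mem_of_mem _ (Ideal.mem_span_singleton_self _) _ (Nat.pos_of_ne_zero hk)
  have hone (z : O) : IsUnit (1 + G * z) := by
    refine (IsLocalRing.notMem_maximalIdeal).1 fun h => ?_
    have h1 := sub_mem h (Ideal.mul_mem_right z _ hGmax)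
    rw [add_sub_cancel_right] at h1
    exact (IsLocalRing.notMem_maximalIdeal.2 isUnit_one) h1
  set y : O := coordinate (K := K) O with hy
  have hc : IsUnit (algebraMap K O c) := c.isUnit.map _
  have haeval (h : K[X]) : aeval y h = algebraMap K[X] O h := by
    rw [hy, coordinate, aeval_algebraMap_apply, aeval_X_left_apply]
  -- For the coordinate itself, `LineLocalRing` is the localization of `K[X]` at `P`, that is, a
  -- second copy of `O`.
  have hP' : imagePrime K y = Ideal.span {π} := by
    rw [← hP, ← IsLocalization.AtPrime.under_maximalIdeal O P]
    ext h
    simp only [imagePrime, Ideal.mem_comap, haeval]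
  let L := LineLocalRing K y
  let F : L := algebraMap K L c * algebraMap K[X] L (π ^ k)
  have hJ : Ideal.span {F} = Ideal.span {algebraMap K[X] L (π ^ k)} :=
    Ideal.span_singleton_mul_left_unit (c.isUnit.map _) _
  obtain ⟨B, hB⟩ := exists_basis_pow (R := L) hP' hG hJ
  have hb := coordinate_pow_eq (R := L) hG hJ
  have hB0 : B 0 = 1 := by rw [hB]; exact pow_zero _
  have hFe : linePullback K y F = algebraMap K O c * G := by
    change linePullbackₐ (K := K) y F = _
    rw [map_mul, AlgHom.commutes]
    congr 1
    exact (linePullback_algebraMap _ _).trans (haeval _)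
  set a₀ := ∑ i : Fin (m + 1), (lineCoord (K := K) y ^ (i : ℕ)) ⊗ₜ[K] (lineCoord (K := K) y ^ (i.rev : ℕ))
  let qq := Algebra.TensorProduct.map (Ideal.Quotient.mkₐ K (Ideal.span {F}))
    (Ideal.Quotient.mkₐ K (Ideal.span {F}))
  have ha₀ : qq a₀ = casimir (Q := L ⧸ Ideal.span {F}) B := by
    simp only [a₀, casimir, map_sum, qq, Algebra.TensorProduct.map_tmul, hB, map_pow]
    rfl
  have ha₀' : qq ((c : K) • a₀) = (c : K) • casimir (Q := L ⧸ Ideal.span {F}) B := by rw [map_smul, ha₀]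
  -- The representative is `F = c G`. Both `G ^ 2` and `f ^ 2` generate `𝔪 ^ (2 * k)`, and the error
  -- `c G ^ 2 e` lies in it.
  refine ⟨F, 2 * k, ?_, ?_, (↑c⁻¹ : K) • B.coord (Fin.last m), ⟨(c : K) • a₀, ?_, ?_, ?_⟩,
    antidiagonal (m + 1) c⁻¹, B.equivFun.symm, fun s t => ?_, rfl⟩
  · rw [hmax, Ideal.span_singleton_pow, hf]
    rw [Ideal.span_singleton_le_span_singleton]
    obtain ⟨i, hi⟩ := ((hc.mul (hone e)).pow 2).exists_right_inv
    refine ⟨i, ?_⟩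
    have : algebraMap K[X] O π ^ (2 * k) = G ^ 2 := by rw [hGdef, map_pow]; ring
    rw [this]
    linear_combination (-G ^ 2) * hi
  · rw [hFe, hf, hmax, Ideal.span_singleton_pow, Ideal.mem_span_singleton]
    refine ⟨- algebraMap K O c * e, ?_⟩
    have : algebraMap K[X] O π ^ (2 * k) = G ^ 2 := by rw [hGdef, map_pow]; ring
    rw [this]
    ring
  · have h3 := diff_geom_sum (K := K) (lineCoord (K := K) y) m b
    have h4 : F = (c : K) • (lineCoord y ^ (m + 1) - algebraMap K L b) := by
      rw [Algebra.smul_def]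
      change _ * algebraMap K[X] L (π ^ k) = _
      congr 1
      rw [hG, map_sub, map_pow, Polynomial.C_eq_algebraMap, ← IsScalarTower.algebraMap_apply]
      rfl
    have h5 : diff (K := K) F = (c : K) • diff (lineCoord y ^ (m + 1) - algebraMap K L b) := by
      rw [h4, diff_smul]
    change diff (K := K) F = _ * diff _
    rw [h5, h3, smul_mul_assoc]
  · change Function.Bijective (dualMap (L ⧸ Ideal.span {F}) (qq ((c : K) • a₀)))
    rw [ha₀']
    exact dualMap_smul_casimir_bijective (Q := L ⧸ Ideal.span {F}) c
  · change dualMap (L ⧸ Ideal.span {F}) (qq ((c : K) • a₀)) _ = 1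
    rw [ha₀']
    exact dualMap_smul_casimir_coord (Q := L ⧸ Ideal.span {F}) hB0 c
  · exact antidiagonal_form_eq (Q := L ⧸ Ideal.span {F}) hB hb c⁻¹ s t

end IndexForm

/-! ### Local rings of spectra. -/

section SpecStalk

/-- The structure map of the local rings of `Spec R`. -/
def specStalkMap (R : CommRingCat.{u}) (x : Spec R) : R ⟶ (Spec R).presheaf.stalk x :=
  (Scheme.ΓSpecIso R).inv ≫ (Spec R).presheaf.germ ⊤ x (TopologicalSpace.Opens.mem_top _)

lemma isLocalization_specStalkMap (R : CommRingCat.{u}) (x : PrimeSpectrum R) :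
    letI := (specStalkMap R x).hom.toAlgebra
    IsLocalization.AtPrime ((Spec R).presheaf.stalk x) x.asIdeal :=
  StructureSheaf.IsLocalization.to_stalk R x

lemma specStalkMap_stalkMap {R : CommRingCat.{u}} {Z : Scheme.{u}} (φ : Z ⟶ Spec R) (z : Z) :
    specStalkMap R (φ z) ≫ φ.stalkMap z =
      (Scheme.ΓSpecIso R).inv ≫ φ.appTop ≫ Z.presheaf.germ ⊤ z (TopologicalSpace.Opens.mem_top _) := by
  rw [specStalkMap, Category.assoc, Scheme.Hom.germ_stalkMap]
  rfl

end SpecStalk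

/-! ### Étale coordinates and the maps they induce on local rings. -/

section NisnevichCoordinates

variable {K : Type u} [Field K] {Y : Scheme.{u}} [Y.Over (pt K)]

lemma toSections_map {U W : Y.Opens} (h : W ≤ U) (c : K) :
    Y.presheaf.map (homOfLE h).op (toSections K Y U c) = toSections K Y W c := by
  have : Y.presheaf.map (homOfLE (le_top : U ≤ ⊤)).op ≫ Y.presheaf.map (homOfLE h).op =
      Y.presheaf.map (homOfLE (le_top : W ≤ ⊤)).op := by
    rw [← Functor.map_comp]; rfl
  simp only [toSections, CommRingCat.hom_comp, RingHom.comp_apply, ← this]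

lemma germ_toSections {U : Y.Opens} {y : Y} (hy : y ∈ U) (c : K) :
    Y.presheaf.germ U y hy (toSections K Y U c) = algebraMap K (Y.presheaf.stalk y) c := by
  change (Y.presheaf.map (homOfLE (le_top : U ≤ ⊤)).op ≫ Y.presheaf.germ U y hy) _ = _
  rw [TopCat.Presheaf.germ_res]
  rfl

lemma homOfLE_coordMap {U W : Y.Opens} (h : W ≤ U) (g : Γ(Y, U)) :
    W.toSpecΓ ≫ Spec.map (CommRingCat.ofHom (eval₂RingHom (toSections K Y W)
      (Y.presheaf.map (homOfLE h).op g))) = Y.homOfLE h ≫ coordMap K U g := by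
  rw [coordMap, ← Scheme.Opens.toSpecΓ_SpecMap_presheaf_map_assoc, ← Spec.map_comp]
  congr 2
  ext
  · simp [toSections_map]
  · simp

lemma exists_etale {U : Y.Opens} {y : Y} (hy : y ∈ U) {g : Γ(Y, U)} (hg : Etale (coordMap K U g)) :
    ∃ (W : Y.Opens) (h : W ≤ U), IsAffineOpen W ∧ y ∈ W ∧
      (eval₂RingHom (toSections K Y W) (Y.presheaf.map (homOfLE h).op g)).Etale := by
  obtain ⟨W, hW, hyW, h⟩ : ∃ W : Y.Opens, IsAffineOpen W ∧ y ∈ W ∧ W ≤ U := by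
    obtain ⟨_, ⟨W, hW, rfl⟩, hyW, h⟩ :=
      Y.isBasis_affineOpens.exists_subset_of_mem_open hy U.isOpen
    exact ⟨W, hW, hyW, h⟩
  refine ⟨W, h, hW, hyW, ?_⟩
  have h1 := homOfLE_coordMap (K := K) h g
  have h2 : Etale (W.toSpecΓ ≫ Spec.map (CommRingCat.ofHom (eval₂RingHom (toSections K Y W)
      (Y.presheaf.map (homOfLE h).op g)))) := by
    rw [h1]; infer_instance
  have h3 := Etale.etale_comp hW.isoSpec.inv (W.toSpecΓ ≫ Spec.map (CommRingCat.ofHom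
    (eval₂RingHom (toSections K Y W) (Y.presheaf.map (homOfLE h).op g))))
  rw [← IsAffineOpen.isoSpec_hom hW, Iso.inv_hom_id_assoc,
    HasRingHomProperty.Spec_iff (P := @Etale)] at h3
  exact h3

/-- The homomorphism from `K[X]` to the local ring at `y` given by an étale coordinate is
formally unramified and essentially of finite type. -/
lemma formallyUnramified_stalk {U : Y.Opens} {y : Y} (hy : y ∈ U) {g : Γ(Y, U)}
    (hg : Etale (coordMap K U g)) :
    letI := (aeval (R := K) (Y.presheaf.germ U y hy g)).toRingHom.toAlgebra
    Algebra.FormallyUnramified K[X] (Y.presheaf.stalk y) ∧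
      Algebra.EssFiniteType K[X] (Y.presheaf.stalk y) := by
  obtain ⟨W, h, hW, hyW, hφ⟩ := exists_etale hy hg
  let := (aeval (R := K) (Y.presheaf.germ U y hy g)).toRingHom.toAlgebra
  let := (eval₂RingHom (toSections K Y W) (Y.presheaf.map (homOfLE h).op g)).toAlgebra
  let : Algebra Γ(Y, W) (Y.presheaf.stalk y) := (Y.presheaf.germ W y hyW).hom.toAlgebra
  have : IsLocalization.AtPrime (Y.presheaf.stalk y) (hW.primeIdealOf ⟨y, hyW⟩).asIdeal :=
    hW.isLocalization_stalk ⟨y, hyW⟩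
  have : IsScalarTower K[X] Γ(Y, W) (Y.presheaf.stalk y) := by
    refine .of_algebraMap_eq' ?_
    refine Polynomial.ringHom_ext' ?_ ?_
    · ext c
      change aeval _ (Polynomial.C c) = Y.presheaf.germ W y hyW (eval₂RingHom _ _ (Polynomial.C c))
      rw [aeval_C, coe_eval₂RingHom, Polynomial.eval₂_C, germ_toSections]
    · change aeval _ Polynomial.X = Y.presheaf.germ W y hyW (eval₂RingHom _ _ Polynomial.X)
      rw [aeval_X, coe_eval₂RingHom, eval₂_X, TopCat.Presheaf.germ_res_apply]
  have : Algebra.Etale K[X] Γ(Y, W) := hφ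
  have : Algebra.FormallyUnramified Γ(Y, W) (Y.presheaf.stalk y) :=
    .of_isLocalization (hW.primeIdealOf ⟨y, hyW⟩).asIdeal.primeCompl
  have : Algebra.EssFiniteType Γ(Y, W) (Y.presheaf.stalk y) :=
    .of_isLocalization _ (hW.primeIdealOf ⟨y, hyW⟩).asIdeal.primeCompl
  exact ⟨.comp K[X] Γ(Y, W) _, .comp K[X] Γ(Y, W) _⟩

/-- The maximal ideal at the image of `y` generates the maximal ideal at `y`. -/
lemma map_maximalIdeal_linePullback {U : Y.Opens} {y : Y} (hy : y ∈ U) {g : Γ(Y, U)}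
    (hg : Etale (coordMap K U g)) :
    (IsLocalRing.maximalIdeal (LineLocalRing K (Y.presheaf.germ U y hy g))).map
      (linePullback K (Y.presheaf.germ U y hy g)) =
      IsLocalRing.maximalIdeal (Y.presheaf.stalk y) := by
  obtain ⟨h1, h2⟩ := formallyUnramified_stalk hy hg
  set x := Y.presheaf.germ U y hy g
  let := (aeval (R := K) x).toRingHom.toAlgebra
  let := (linePullback K x).toAlgebra
  have : IsScalarTower K[X] (LineLocalRing K x) (Y.presheaf.stalk y) :=
    .of_algebraMap_eq fun h => (linePullback_algebraMap x h).symm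
  have : Algebra.FormallyUnramified (LineLocalRing K x) (Y.presheaf.stalk y) :=
    .of_restrictScalars K[X] _ _
  have : Algebra.EssFiniteType (LineLocalRing K x) (Y.presheaf.stalk y) := .of_comp K[X] _ _
  have : IsLocalHom (algebraMap (LineLocalRing K x) (Y.presheaf.stalk y)) :=
    inferInstanceAs (IsLocalHom (linePullback K x))
  exact Algebra.FormallyUnramified.map_maximalIdeal

/-- The differential of an étale coordinate generates the differentials. -/
lemma exists_derivation_eq_smul {U : Y.Opens} {y : Y} (hy : y ∈ U) {g : Γ(Y, U)}
    (hg : Etale (coordMap K U g)) {M : Type*} [AddCommGroup M] [Module (Y.presheaf.stalk y) M]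
    [Module K M] [IsScalarTower K (Y.presheaf.stalk y) M]
    (D : Derivation K (Y.presheaf.stalk y) M) (a : Y.presheaf.stalk y) :
    ∃ e : Y.presheaf.stalk y, D a = e • D (Y.presheaf.germ U y hy g) := by
  obtain ⟨h1, -⟩ := formallyUnramified_stalk hy hg
  set x := Y.presheaf.germ U y hy g
  let := (aeval (R := K) x).toRingHom.toAlgebra
  have : IsScalarTower K K[X] (Y.presheaf.stalk y) :=
    .of_algebraMap_eq fun c => (aeval_C x c).symm
  let N := Submodule.span (Y.presheaf.stalk y) {D x}
  have hxN : N.mkQ (D x) = 0 :=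
    (Submodule.Quotient.mk_eq_zero N).2 (Submodule.mem_span_singleton_self _)
  let : Module K[X] (M ⧸ N) := Module.compHom _ (algebraMap K[X] (Y.presheaf.stalk y))
  have hsmul (h : K[X]) (v : M ⧸ N) : h • v = aeval x h • v := rfl
  have : IsScalarTower K[X] (Y.presheaf.stalk y) (M ⧸ N) :=
    ⟨fun h b v => by rw [hsmul, smul_smul, Algebra.smul_def]; rfl⟩
  -- Modulo multiples of `D x` the derivation is linear over `K[X]`, where the variable acts as `x`.
  -- Such a derivation vanishes, because the local ring is formally unramified over `K[X]`.
  let D' : Derivation K[X] (Y.presheaf.stalk y) (M ⧸ N) := Derivation.mk'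
    { toFun := fun b => N.mkQ (D b)
      map_add' := by simp
      map_smul' := fun h b => by
        have h1 : h • b = aeval x h * b := Algebra.smul_def h b
        rw [h1, D.leibniz, D.map_aeval, map_add, map_smul, map_smul, map_smul, hxN, smul_zero,
          smul_zero, add_zero]
        rfl }
    fun b c => by simp
  have h2 : D' a = 0 := by
    rw [← D'.liftKaehlerDifferential_comp_D a, Subsingleton.elim (KaehlerDifferential.D _ _ a) 0,
      map_zero]
  obtain ⟨e, he⟩ := Submodule.mem_span_singleton.1 ((Submodule.Quotient.mk_eq_zero N).1 h2)
  exact ⟨e, he.symm⟩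

/-- On local rings the coordinate map is evaluation at the germ of `g`. This lets statements about
`coordMap` be transferred to `linePullback`. -/
lemma specStalkMap_coordMap_stalkMap {U : Y.Opens} (z : U.toScheme) (g : Γ(Y, U)) :
    specStalkMap (.of K[X]) (coordMap K U g z) ≫ (coordMap K U g).stalkMap z ≫
      (U.stalkIso z).hom = CommRingCat.ofHom (eval₂RingHom (toSections K Y U) g) ≫
        Y.presheaf.germ U z.1 z.2 := by
  have h1 : CommRingCat.ofHom (eval₂RingHom (toSections K Y U) g) ≫ U.topIso.inv =
      (Scheme.ΓSpecIso (.of K[X])).inv ≫ (coordMap K U g).appTop := by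
    rw [coordMap, Scheme.Hom.comp_appTop, ← Scheme.ΓSpecIso_inv_naturality_assoc,
      Scheme.Opens.toSpecΓ_appTop, Iso.inv_hom_id_assoc]
  rw [← Category.assoc, specStalkMap_stalkMap, Category.assoc, Category.assoc,
    show U.toScheme.presheaf.germ ⊤ z _ ≫ _ = _ from Scheme.Opens.germ_stalkIso_hom U z _]
  refine ((Category.assoc _ _ _).symm.trans (congrArg (· ≫ _) h1.symm)).trans
    ((Category.assoc _ _ _).trans ?_)
  congr 1
  exact TopCat.Presheaf.germ_res _ _ _ _

/-- A Nisnevich coordinate identifies the residue fields. -/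
lemma exists_sub_linePullback_mem {U : Y.Opens} {y : Y} (hy : y ∈ U) {g : Γ(Y, U)}
    (hg : Function.Surjective ((coordMap K U g).residueFieldMap ⟨y, hy⟩))
    (b : Y.presheaf.stalk y) :
    ∃ l, b - linePullback K (Y.presheaf.germ U y hy g) l ∈
      IsLocalRing.maximalIdeal (Y.presheaf.stalk y) := by
  set x := Y.presheaf.germ U y hy g with hx
  set φ := coordMap K U g with hφ
  let z : U.toScheme := ⟨y, hy⟩
  let κ : U.toScheme.presheaf.stalk z ⟶ Y.presheaf.stalk y := (U.stalkIso z).hom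
  have hφκ (h : K[X]) : κ (φ.stalkMap z (specStalkMap _ _ h)) = aeval x h := by
    refine Eq.trans congr($(specStalkMap_coordMap_stalkMap z g) h) ?_
    change Y.presheaf.germ U y hy (Polynomial.eval₂ (toSections K Y U) g h) = _
    have h1 : (Y.presheaf.germ U y hy).hom.comp (toSections K Y U) =
        algebraMap K (Y.presheaf.stalk y) := RingHom.ext fun c => germ_toSections hy c
    rw [aeval_def, ← h1]
    exact hom_eval₂ h (toSections K Y U) (Y.presheaf.germ U y hy).hom g
  obtain ⟨b, rfl⟩ : ∃ b', κ b' = b := ⟨(U.stalkIso z).inv b, by simp [κ]⟩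
  obtain ⟨a, ha⟩ := hg (U.toScheme.residue z b)
  obtain ⟨a, rfl⟩ := Scheme.residue_surjective _ _ a
  let q : PrimeSpectrum K[X] := φ z
  let := (specStalkMap (.of K[X]) q).hom.toAlgebra
  have := isLocalization_specStalkMap (.of K[X]) q
  have h1 : b - φ.stalkMap z a ∈ IsLocalRing.maximalIdeal (U.toScheme.presheaf.stalk z) := by
    rw [← IsLocalRing.residue_eq_zero_iff, map_sub, sub_eq_zero]
    exact ha.symm.trans congr($(Scheme.residue_residueFieldMap φ z) a)
  have h2 : κ b - κ (φ.stalkMap z a) ∈ IsLocalRing.maximalIdeal (Y.presheaf.stalk y) := by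
    rw [← map_sub]
    rw [IsLocalRing.mem_maximalIdeal, mem_nonunits_iff] at h1 ⊢
    exact fun hu => h1 ((isUnit_map_iff κ.hom _).1 hu)
  obtain ⟨⟨h, s⟩, hs⟩ := IsLocalization.surj q.asIdeal.primeCompl a
  have h3 : κ (φ.stalkMap z a) * aeval x (s : K[X]) = aeval x h := by
    rw [← hφκ, ← hφκ, ← map_mul, ← map_mul]
    exact congr(κ (φ.stalkMap z $hs))
  have h4 : IsUnit (aeval x (s : K[X])) := by
    rw [← hφκ]
    exact ((IsLocalization.map_units ((Spec (.of K[X])).presheaf.stalk q) s).map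
      (φ.stalkMap z).hom).map κ.hom
  -- The denominator pulls back to a unit, so the same fraction `h / s` also makes sense in
  -- `LineLocalRing`.
  have h5 : (s : K[X]) ∈ (imagePrime K x).primeCompl := fun h6 => h6 h4
  refine ⟨IsLocalization.mk' _ h ⟨s, h5⟩, ?_⟩
  have h6 : linePullback K x (IsLocalization.mk' _ h ⟨s, h5⟩) * aeval x (s : K[X]) =
      aeval x h := by
    rw [← linePullback_algebraMap, ← map_mul]
    exact (congrArg _ (IsLocalization.mk'_spec _ h ⟨(s : K[X]), h5⟩)).trans
      (linePullback_algebraMap x h)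
  rwa [h4.mul_right_cancel (h6.trans h3.symm)]

end NisnevichCoordinates

/-! ### Local indices on a curve, computed in one good coordinate. -/

section LocalIndexComputation

variable {K : Type u} [Field K] {Y : Scheme.{u}} [IsIntegral Y] [Y.Over (pt K)]

instance functionField_isScalarTower_stalk (z : Y) :
    IsScalarTower K (Y.presheaf.stalk z) Y.functionField :=
  .of_algebraMap_eq fun c => (stalkSpecializes_algebraMap K _ c).symm

lemma algebraMap_functionField_injective (z : Y) :
    Function.Injective (algebraMap (Y.presheaf.stalk z) Y.functionField) :=
  IsFractionRing.injective _ _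

lemma localRing_smul_def {z : Y} {M : Type*} [AddCommGroup M] [Module Y.functionField M]
    (r : localRing Y z) (v : M) : r • v = (r : Y.functionField) • v := rfl

lemma mem_span_localRing {z : Y} {M : Type*} [AddCommGroup M] [Module Y.functionField M]
    {v w : M} : v ∈ Submodule.span (localRing Y z) {w} ↔
      ∃ r : Y.presheaf.stalk z, v = algebraMap _ Y.functionField r • w := by
  rw [Submodule.mem_span_singleton]
  constructor
  · rintro ⟨⟨_, r, rfl⟩, rfl⟩
    exact ⟨r, rfl⟩
  · rintro ⟨r, rfl⟩
    exact ⟨⟨_, r, rfl⟩, rfl⟩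

/-- The restriction of the universal derivation of the function field to a local ring. -/
def stalkD (K : Type u) [Field K] {Y : Scheme.{u}} [IsIntegral Y] [Y.Over (pt K)] (z : Y) :
    Derivation K (Y.presheaf.stalk z) Ω[Y.functionField⁄K] :=
  (KaehlerDifferential.D K Y.functionField).compAlgebraMap (Y.presheaf.stalk z)

lemma stalkD_apply (z : Y) (a : Y.presheaf.stalk z) :
    stalkD K z a = KaehlerDifferential.D K Y.functionField (algebraMap _ _ a) := rfl

/-- The local index can be computed in any coordinate which identifies the local ring with a
local ring of the affine line. -/
theorem isLocalIndex_iff {V : StalkSheaf Y} (ρ : RelativeOrientation K V) {σ : V.generic} {z : Y}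
    {U : Y.Opens} (hz : z ∈ U) {g : Γ(Y, U)} (hg : IsNisnevichCoordinate K U z hz g)
    {P : Ideal K[X]} [P.IsPrime]
    (hloc : letI := (aeval (R := K) (Y.presheaf.germ U z hz g)).toRingHom.toAlgebra
      IsLocalization.AtPrime (Y.presheaf.stalk z) P)
    {π : K[X]} {m k : ℕ} {b : K} (hk : k ≠ 0)
    (hP : P = Ideal.span {π}) (hG : π ^ k = X ^ (m + 1) - Polynomial.C b)
    (hΩ : ∀ ω : Ω[Y.functionField⁄K], ∃ c : Y.functionField,
      ω = c • KaehlerDifferential.D K Y.functionField (algebraMap _ _ (Y.presheaf.germ U z hz g)))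
    {s : V.generic} (hs0 : s ≠ 0) (hs : V.stalk z = Submodule.span (localRing Y z) {s})
    {m₀ : ρ.M.generic} (hm₀ : ρ.M.stalk z = Submodule.span (localRing Y z) {m₀})
    {τ : Ω[Y.functionField⁄K] →ₗ[Y.functionField] Y.functionField}
    (hτ : τ (KaehlerDifferential.D K Y.functionField (algebraMap _ _ (Y.presheaf.germ U z hz g))) = 1)
    {E : (Ω[Y.functionField⁄K] →ₗ[Y.functionField] Y.functionField) →ₗ[Y.functionField] V.generic}
    (hE : E τ = s) (hE' : ρ.iso.toEquiv E = m₀ ⊗ₜ[Y.functionField] m₀)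
    {c : Kˣ} {e : Y.presheaf.stalk z}
    (hσ : σ = algebraMap (Y.presheaf.stalk z) Y.functionField
      (algebraMap K _ c * aeval (Y.presheaf.germ U z hz g) (π ^ k) *
        (1 + aeval (Y.presheaf.germ U z hz g) (π ^ k) * e)) • s) (α : GW K) :
    IsLocalIndex ρ σ z α ↔ α = GW.mk (antidiagonal (m + 1) c⁻¹) := by
  set t := Y.presheaf.germ U z hz g with ht
  let := (aeval (R := K) t).toRingHom.toAlgebra
  have : IsScalarTower K K[X] (Y.presheaf.stalk z) :=
    .of_algebraMap_eq fun c => (aeval_C t c).symm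
  have halg (h : K[X]) : algebraMap K[X] (Y.presheaf.stalk z) h = aeval t h := rfl
  have hcoord : coordinate (K := K) (Y.presheaf.stalk z) = t := aeval_X t
  have hinj := algebraMap_functionField_injective z
  constructor
  · rintro ⟨U', hz', g', s', f', hN, hV', ⟨τ', E', m', hm', h1, h2, h3⟩, hσ', hI⟩
    set x := Y.presheaf.germ U' z hz' g' with hx
    obtain ⟨d, hd⟩ := diff_coordinate_dvd (K := K) P.primeCompl x
    rw [mul_comm] at hd
    set x' := Algebra.TensorProduct.lmul' K d with hx'
    have hDx : stalkD K z x = x' • stalkD K z t := by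
      rw [← hcoord]
      exact derivation_eq_of_diff_eq _ hd
    obtain ⟨i, hi⟩ := exists_derivation_eq_smul hz' hN.1 (stalkD K z) t
    -- Here `x'` is the derivative of `x` with respect to `t`. As `x` is étale, `dt` is also a
    -- multiple of `dx`, and `τ` compares the coefficients.
    have hxi : i * x' = 1 := by
      apply hinj
      rw [hDx, smul_smul] at hi
      have h4 := congrArg τ hi
      rw [← algebraMap_smul Y.functionField, map_smul, stalkD_apply, hτ, smul_eq_mul, mul_one] at h4
      rw [← h4, map_one]
    have hu : IsUnit x' := IsUnit.of_mul_eq_one_right _ hxi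
    change (Ω[Y.functionField⁄K] →ₗ[Y.functionField] Y.functionField) at τ'
    change (Ω[Y.functionField⁄K] →ₗ[Y.functionField] Y.functionField) →ₗ[Y.functionField]
      V.generic at E'
    have hτ' : τ = algebraMap _ Y.functionField x' • τ' := by
      refine LinearMap.ext fun ω => ?_
      obtain ⟨c, rfl⟩ := hΩ ω
      have h4 : τ' (stalkD K z x) = 1 := h1
      rw [hDx, ← algebraMap_smul Y.functionField, map_smul, stalkD_apply] at h4
      rw [LinearMap.smul_apply, map_smul, map_smul, hτ, smul_comm, h4]
    rw [hm₀, mem_span_localRing] at hm'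
    obtain ⟨w, rfl⟩ := hm'
    -- The relative orientation sends `E'` to the square of `w • m₀`.
    have hEE' : E' = (algebraMap _ Y.functionField w) ^ 2 • E := by
      apply ρ.iso.toEquiv.injective
      refine h3.trans ?_
      rw [TensorProduct.smul_tmul_smul, ← hE', ← pow_two]
      exact (map_smul ρ.iso.toEquiv _ E).symm
    have hs' : algebraMap _ Y.functionField x' • s' = algebraMap _ Y.functionField (w ^ 2) • s := by
      have h4 : E' τ' = s' := h2
      rw [← hE, hτ', map_smul, ← h4, hEE', LinearMap.smul_apply, smul_comm, map_pow]
    have hs'0 : s' ≠ 0 := by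
      rintro rfl
      have h4 : s ∈ V.stalk z := hs ▸ Submodule.mem_span_singleton_self _
      rw [hV', mem_span_localRing] at h4
      obtain ⟨r, hr⟩ := h4
      exact hs0 (by rw [hr, smul_zero])
    -- Since `s'` generates the stalk, `s = r • s'` for some `r`, and then `x' = w ^ 2 * r` with
    -- `x'` a unit.
    have hw : IsUnit w := by
      have h4 : s ∈ V.stalk z := hs ▸ Submodule.mem_span_singleton_self _
      rw [hV', mem_span_localRing] at h4
      obtain ⟨r, rfl⟩ := h4
      rw [smul_smul, ← map_mul] at hs'
      have h5 : x' = w ^ 2 * r := hinj (smul_left_injective _ hs'0 hs')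
      rw [h5] at hu
      exact (isUnit_pow_iff two_ne_zero).1 (isUnit_of_mul_isUnit_left hu)
    obtain ⟨w', hw'⟩ := hw.exists_right_inv
    set f := algebraMap K (Y.presheaf.stalk z) c * aeval t (π ^ k) * (1 + aeval t (π ^ k) * e)
    -- Expressing `σ` by both generators and using `x' s' = w ^ 2 s` gives the transformation rule:
    -- the derivative times an inverse square.
    have hf' : f' * w ^ 2 = f * x' := by
      apply hinj
      refine smul_left_injective _ hs0 ?_
      change algebraMap _ Y.functionField _ • s = algebraMap _ Y.functionField _ • s
      rw [map_mul, mul_smul, ← hs', smul_comm, ← hσ', hσ, smul_smul, ← map_mul, mul_comm]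
    have hf : f' = f * x' * w' ^ 2 := by
      rw [← hf', mul_assoc, ← mul_pow, hw', one_pow, mul_one]
    exact eq_antidiagonal_of_isIndexForm hP hG (IsUnit.of_mul_eq_one_right _ hw') hd hu hf
      (map_maximalIdeal_linePullback hz' hN.1) (exists_sub_linePullback_mem hz' hN.2.2) hI
  · rintro rfl
    refine ⟨U, hz, g, s, _, hg, hs, ⟨τ, E, m₀, hm₀ ▸ Submodule.mem_span_singleton_self _, hτ, hE,
      hE'⟩, hσ, ?_⟩
    have h := isIndexForm_coordinate (O := Y.presheaf.stalk z) hP hG (c := c) (e := e) hk rfl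
    rwa [hcoord] at h

lemma localIndex_eq {V : StalkSheaf Y} {ρ : RelativeOrientation K V} {σ : V.generic} {z : Y}
    {β : GW K} (h : ∀ α, IsLocalIndex ρ σ z α ↔ α = β) : localIndex ρ σ z = β := by
  have h1 : ∃ α, IsLocalIndex ρ σ z α := ⟨β, (h β).2 rfl⟩
  rw [localIndex, dif_pos h1]
  exact (h _).1 h1.choose_spec

end LocalIndexComputation

/-! ### Rescaling the arguments of a homogeneous polynomial. -/

section Homogeneous

lemma eval₂_mul_of_isHomogeneous {σ R S : Type*} [CommSemiring R] [CommSemiring S]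
    (φ : R →+* S) (v : σ → S) (w : S) {n : ℕ} {h : MvPolynomial σ R} (hh : h.IsHomogeneous n) :
    MvPolynomial.eval₂ φ (fun l => v l * w) h = MvPolynomial.eval₂ φ v h * w ^ n := by
  rw [MvPolynomial.eval₂_eq, MvPolynomial.eval₂_eq, Finset.sum_mul]
  refine Finset.sum_congr rfl fun d hd => ?_
  have hn : ∑ i ∈ d.support, d i = n := by
    rw [← hh (MvPolynomial.mem_support_iff.1 hd), Finsupp.weight_apply, Finsupp.sum]
    simp
  simp only [mul_pow, Finset.prod_mul_distrib]
  rw [Finset.prod_pow_eq_pow_sum, hn, mul_assoc]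

end Homogeneous

/-! ### The two standard charts of the projective line. -/

section ProjectiveLine

variable (K : Type u) [Field K]

lemma evalLine_X_self (i : Fin 2) : evalLine K i (MvPolynomial.X i) = 1 := by simp [evalLine]

lemma mem_grading_X (i : Fin 2) : (MvPolynomial.X i : MvPolynomial (Fin 2) K) ∈ grading K 1 :=
  MvPolynomial.isHomogeneous_X K i

lemma dehomogenize_mk (i : Fin 2) (n : ℕ) (h : MvPolynomial (Fin 2) K) (hh : h ∈ grading K (n • 1)) :
    dehomogenize K i (HomogeneousLocalization.Away.mk (grading K) (mem_grading_X K i) n h hh) =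
      evalLine K i h := by
  have h1 : IsUnit (evalLine K i (MvPolynomial.X i)) := by simp [evalLine_X_self]
  change IsLocalization.Away.lift (S := Localization.Away (MvPolynomial.X i :
    MvPolynomial (Fin 2) K)) (MvPolynomial.X i) h1 (HomogeneousLocalization.val
      (HomogeneousLocalization.Away.mk (grading K) (mem_grading_X K i) n h hh)) = _
  rw [HomogeneousLocalization.Away.val_mk, Localization.mk_eq_mk', IsLocalization.Away.lift]
  refine (IsLocalization.lift_mk'_spec _ _ _ _).2 ?_
  simp [evalLine_X_self]

/-- Injectivity comes from the left inverse `X ↦ X_{1-i} / X_i`, where `1 - i` is the other index: a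
homogeneous `h` of degree `n` evaluated at the `X_l / X_i` is `h / X_i ^ n`. Constants and `X_{1-i}
/ X_i` give surjectivity. -/
lemma dehomogenize_bijective (i : Fin 2) : Function.Bijective (dehomogenize K i) := by
  constructor
  · let L := Localization.Away (MvPolynomial.X i : MvPolynomial (Fin 2) K)
    let w : L := IsLocalization.Away.invSelf (MvPolynomial.X i : MvPolynomial (Fin 2) K)
    have hw : algebraMap _ L (MvPolynomial.X i) * w = 1 := IsLocalization.Away.mul_invSelf _
    let v (l : Fin 2) : L := algebraMap (MvPolynomial (Fin 2) K) L (MvPolynomial.X l)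
    let c : K →+* L := (algebraMap (MvPolynomial (Fin 2) K) L).comp MvPolynomial.C
    let ψ : K[X] →+* L := eval₂RingHom c (v (1 - i) * w)
    have h1 : ψ.comp (evalLine K i) = MvPolynomial.eval₂Hom c (fun l => v l * w) := by
      refine MvPolynomial.ringHom_ext (fun a => ?_) fun l => ?_
      · simp [evalLine, ψ]
      · by_cases hl : l = i
        · subst hl
          simp [evalLine, v, hw]
        · obtain rfl : l = 1 - i := by
            fin_cases i <;> fin_cases l <;> simp_all
          simp [evalLine, ψ, hl]
    have h2 (z) : ψ (dehomogenize K i z) = z.val := by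
      obtain ⟨n, h, hh, rfl⟩ := HomogeneousLocalization.Away.mk_surjective _ (mem_grading_X K i) z
      have hh' : h.IsHomogeneous n := by simpa using hh
      rw [dehomogenize_mk, HomogeneousLocalization.Away.val_mk, Localization.mk_eq_mk',
        IsLocalization.eq_mk'_iff_mul_eq]
      change (ψ.comp (evalLine K i)) h * _ = _
      rw [h1, MvPolynomial.coe_eval₂Hom, eval₂_mul_of_isHomogeneous _ _ _ hh', mul_assoc, map_pow,
        ← mul_pow, mul_comm w, hw, one_pow, mul_one]
      have h3 : MvPolynomial.eval₂Hom c v = algebraMap (MvPolynomial (Fin 2) K) L :=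
        MvPolynomial.ringHom_ext (fun a => by simp [c]) fun l => by simp [v]
      exact congr($h3 h)
    refine fun a b hab => HomogeneousLocalization.val_injective _ ?_
    rw [← h2, ← h2, hab]
  · intro h
    induction h using Polynomial.induction_on with
    | C a =>
      refine ⟨.mk (grading K) (mem_grading_X K i) 0 (MvPolynomial.C a)
        (by rw [zero_smul]; exact MvPolynomial.isHomogeneous_C _ a), ?_⟩
      rw [dehomogenize_mk]; simp [evalLine]
    | add a b ha hb =>
      obtain ⟨a, rfl⟩ := ha
      obtain ⟨b, rfl⟩ := hb
      exact ⟨a + b, map_add _ _ _⟩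
    | monomial n a ha =>
      obtain ⟨b, hb⟩ := ha
      refine ⟨b * .mk (grading K) (mem_grading_X K i) 1 (MvPolynomial.X (1 - i))
        (by simpa only [one_smul] using mem_grading_X K (1 - i)), ?_⟩
      have : 1 - i ≠ i := by fin_cases i <;> simp
      rw [map_mul, dehomogenize_mk, hb]
      simp [evalLine, pow_succ, this, mul_assoc]

lemma isIso_map_dehomogenize (i : Fin 2) :
    IsIso (Spec.map (CommRingCat.ofHom (dehomogenize K i))) := by
  have : IsIso (CommRingCat.ofHom (dehomogenize K i)) :=
    (RingEquiv.ofBijective _ (dehomogenize_bijective K i)).toCommRingCatIso.isIso_hom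
  infer_instance

instance (i : Fin 2) : IsOpenImmersion (chart K i) := by
  have := isIso_map_dehomogenize K i
  have h : IsOpenImmersion (Spec.map (CommRingCat.ofHom (dehomogenize K i)) ≫
      Proj.awayι (grading K) (MvPolynomial.X i) (mem_grading_X K i) one_pos) := inferInstance
  exact h

lemma opensRange_chart (i : Fin 2) :
    (chart K i).opensRange = Proj.basicOpen (grading K) (MvPolynomial.X i) := by
  have := isIso_map_dehomogenize K i
  have h : (Spec.map (CommRingCat.ofHom (dehomogenize K i)) ≫ Proj.awayι (grading K)
      (MvPolynomial.X i) (mem_grading_X K i) one_pos).opensRange =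
      Proj.basicOpen (grading K) (MvPolynomial.X i) := by
    rw [Scheme.Hom.opensRange_comp_of_isIso, Proj.opensRange_awayι]
  exact h

/-- A homogeneous prime containing both variables contains all forms of positive degree, that is,
the irrelevant ideal. -/
lemma exists_chart (z : P1 K) : ∃ i q, chart K i q = z := by
  have h : ∃ i, z ∈ Proj.basicOpen (grading K) (MvPolynomial.X i) := by
    by_contra! h
    let z' : ProjectiveSpectrum (grading K) := z
    have h' (i : Fin 2) : MvPolynomial.X i ∈ z'.asHomogeneousIdeal.toIdeal := by
      by_contra h1
      exact h i h1
    refine z'.not_irrelevant_le ((HomogeneousIdeal.toIdeal_irrelevant_le _).2 fun n hn x hx => ?_)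
    have h2 : x ∈ Ideal.span (MvPolynomial.X '' (Set.univ : Set (Fin 2))) := by
      rw [MvPolynomial.mem_ideal_span_X_image]
      intro m hm
      by_contra! h3
      have hx' : MvPolynomial.IsHomogeneous x n := hx
      have h4 : m = 0 := Finsupp.ext fun i => by simpa using h3 i
      have h5 := hx' (MvPolynomial.mem_support_iff.1 hm)
      rw [h4, map_zero] at h5
      exact hn.ne h5
    refine (Ideal.span_le.2 ?_ : _ ≤ z'.asHomogeneousIdeal.toIdeal) h2
    rintro _ ⟨i, -, rfl⟩
    exact h' i
  obtain ⟨i, hi⟩ := h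
  rw [← opensRange_chart] at hi
  exact ⟨i, hi⟩

lemma chart_over (i : Fin 2) : chart K i ≫ (P1 K ↘ pt K) =
    Spec.map (CommRingCat.ofHom (algebraMap K K[X])) := by
  have h : (Spec.map (CommRingCat.ofHom (dehomogenize K i)) ≫
      Proj.awayι (grading K) (MvPolynomial.X i) (mem_grading_X K i) one_pos) ≫
      Proj.toSpecZero (grading K) ≫
      Spec.map (CommRingCat.ofHom (algebraMap K (grading K 0))) =
      Spec.map (CommRingCat.ofHom (algebraMap K K[X])) := by
    rw [Category.assoc, Proj.awayι_toSpecZero_assoc, ← Spec.map_comp, ← Spec.map_comp]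
    congr 1
    have h1 (a : grading K 0) : HomogeneousLocalization.fromZeroRingHom (grading K)
        (Submonoid.powers (MvPolynomial.X i)) a = HomogeneousLocalization.Away.mk (grading K)
          (mem_grading_X K i) 0 a.1 (by simpa only [zero_smul] using a.2) := by
      refine HomogeneousLocalization.val_injective _ ?_
      rw [HomogeneousLocalization.Away.val_mk]
      refine (HomogeneousLocalization.val_mk _).trans ?_
      congr 1
    ext a : 2
    refine (congrArg (dehomogenize K i) (h1 _)).trans ?_
    rw [dehomogenize_mk]
    change evalLine K i (MvPolynomial.C a) = Polynomial.C a
    simp [evalLine]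
  exact h

/-- The evaluation of fractions on the complement of the two coordinate points. -/
def dehomogenizeTorus :
    HomogeneousLocalization.Away (grading K) (MvPolynomial.X 0 * MvPolynomial.X 1) →+* K[T;T⁻¹] :=
  (IsLocalization.Away.lift (S := Localization.Away
    (MvPolynomial.X 0 * MvPolynomial.X 1 : MvPolynomial (Fin 2) K))
    (MvPolynomial.X 0 * MvPolynomial.X 1)
    (g := (MvPolynomial.aeval (R := K) ![(1 : K[T;T⁻¹]), T 1]).toRingHom)
    (by simpa using isUnit_T 1)).comp
  (algebraMap (HomogeneousLocalization.Away (grading K) (MvPolynomial.X 0 * MvPolynomial.X 1))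
    (Localization.Away (MvPolynomial.X 0 * MvPolynomial.X 1 : MvPolynomial (Fin 2) K)))

lemma mem_grading_mul : (MvPolynomial.X 0 * MvPolynomial.X 1 : MvPolynomial (Fin 2) K) ∈
    grading K (1 + 1) := SetLike.mul_mem_graded (mem_grading_X K 0) (mem_grading_X K 1)

lemma dehomogenizeTorus_mk (n : ℕ) (h : MvPolynomial (Fin 2) K) (hh : h ∈ grading K (n • (1 + 1))) :
    dehomogenizeTorus K (HomogeneousLocalization.Away.mk (grading K) (mem_grading_mul K) n h hh) =
      MvPolynomial.aeval ![(1 : K[T;T⁻¹]), T 1] h * T (-n) := by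
  have h1 : IsUnit ((MvPolynomial.aeval (R := K) ![(1 : K[T;T⁻¹]), T 1]).toRingHom
      (MvPolynomial.X 0 * MvPolynomial.X 1 : MvPolynomial (Fin 2) K)) := by simpa using isUnit_T 1
  change IsLocalization.Away.lift (S := Localization.Away (MvPolynomial.X 0 * MvPolynomial.X 1 :
    MvPolynomial (Fin 2) K)) (MvPolynomial.X 0 * MvPolynomial.X 1) h1 (HomogeneousLocalization.val
      (HomogeneousLocalization.Away.mk (grading K) (mem_grading_mul K) n h hh)) = _
  rw [HomogeneousLocalization.Away.val_mk, Localization.mk_eq_mk', IsLocalization.Away.lift]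
  refine (IsLocalization.lift_mk'_spec _ _ _ _).2 ?_
  simp only [AlgHom.toRingHom_eq_coe, RingHom.coe_coe, map_pow, map_mul, MvPolynomial.aeval_X]
  simp only [Matrix.cons_val_zero, Matrix.cons_val_one, one_mul, T_pow, mul_one]
  rw [mul_left_comm, ← T_add]
  simp

/-- The change of coordinates between the two charts. -/
lemma toLaurent_chart_zero :
    Spec.map (CommRingCat.ofHom (Polynomial.toLaurentAlg (R := K)).toRingHom) ≫ chart K 0 =
      Spec.map (CommRingCat.ofHom (Polynomial.aeval (R := K) (T (-1) : K[T;T⁻¹])).toRingHom) ≫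
        chart K 1 := by
  have h0 := Proj.SpecMap_awayMap_awayι (grading K) (mem_grading_X K 0) one_pos
    (mem_grading_X K 1) rfl
  have h1 := Proj.SpecMap_awayMap_awayι (grading K) (mem_grading_X K 1) one_pos
    (mem_grading_X K 0) (mul_comm (MvPolynomial.X 0) (MvPolynomial.X 1))
  have e0 : (dehomogenizeTorus K).comp (HomogeneousLocalization.awayMap (grading K)
      (mem_grading_X K 1) rfl) =
      (Polynomial.toLaurentAlg (R := K)).toRingHom.comp (dehomogenize K 0) := by
    refine RingHom.ext fun z => ?_
    obtain ⟨n, h, hh, rfl⟩ := HomogeneousLocalization.Away.mk_surjective _ (mem_grading_X K 0) z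
    rw [RingHom.comp_apply, RingHom.comp_apply, dehomogenize_mk,
      HomogeneousLocalization.awayMap_mk]
    refine (dehomogenizeTorus_mk K _ _ _).trans ?_
    have e1 : (MvPolynomial.aeval (R := K) ![(1 : K[T;T⁻¹]), T 1]).toRingHom =
      (Polynomial.toLaurentAlg (R := K)).toRingHom.comp (evalLine K 0) := by
      refine MvPolynomial.ringHom_ext (fun a => by simp [evalLine]) fun l => ?_
      fin_cases l <;> simp [evalLine]
    rw [← RingHom.comp_apply, ← e1]
    rw [map_mul, map_pow, MvPolynomial.aeval_X]
    change _ * T 1 ^ n * T (-(n : ℤ)) = _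
    rw [mul_assoc, T_pow, ← T_add]
    simp
  -- To land on the line `X₁ = 1`, the vector `(1, T)` is rescaled by `T⁻¹`; homogeneity of degree
  -- `n` produces the factor `T ^ (-n)`.
  have e1 : (dehomogenizeTorus K).comp (HomogeneousLocalization.awayMap (grading K)
      (mem_grading_X K 0) (mul_comm (MvPolynomial.X 0) (MvPolynomial.X 1))) =
      (Polynomial.aeval (R := K) (T (-1) : K[T;T⁻¹])).toRingHom.comp (dehomogenize K 1) := by
    refine RingHom.ext fun z => ?_
    obtain ⟨n, h, hh, rfl⟩ := HomogeneousLocalization.Away.mk_surjective _ (mem_grading_X K 1) z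
    rw [RingHom.comp_apply, RingHom.comp_apply, dehomogenize_mk,
      HomogeneousLocalization.awayMap_mk]
    refine (dehomogenizeTorus_mk K _ _ _).trans ?_
    have hh' : h.IsHomogeneous n := by simpa using hh
    have e1 := eval₂_mul_of_isHomogeneous (algebraMap K K[T;T⁻¹]) ![(1 : K[T;T⁻¹]), T 1] (T (-1)) hh'
    have e2 : (Polynomial.aeval (R := K) (T (-1) : K[T;T⁻¹])).toRingHom.comp (evalLine K 1) =
        MvPolynomial.eval₂Hom (algebraMap K K[T;T⁻¹])
          (fun l => ![(1 : K[T;T⁻¹]), T 1] l * T (-1)) := by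
      refine MvPolynomial.ringHom_ext (fun a => by simp [evalLine]) fun l => ?_
      fin_cases l
      · simp [evalLine]
      · refine Eq.trans ?_ (MvPolynomial.eval₂_X _ _ _).symm
        change _ = (T 1 : K[T;T⁻¹]) * T (-1)
        simp [evalLine, ← T_add (R := K)]
    rw [← RingHom.comp_apply, e2, MvPolynomial.coe_eval₂Hom, e1, map_mul, map_pow,
      MvPolynomial.aeval_X, T_pow, MvPolynomial.aeval_def]
    change _ * 1 ^ n * _ = _
    rw [one_pow, mul_one, mul_neg_one]
  have a0 : Spec.map (CommRingCat.ofHom (Polynomial.toLaurentAlg (R := K)).toRingHom) ≫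
      Spec.map (CommRingCat.ofHom (dehomogenize K 0)) =
      Spec.map (CommRingCat.ofHom (dehomogenizeTorus K)) ≫ Spec.map (CommRingCat.ofHom
        (HomogeneousLocalization.awayMap (grading K) (mem_grading_X K 1) rfl)) := by
    rw [← Spec.map_comp, ← Spec.map_comp, ← CommRingCat.ofHom_comp, ← CommRingCat.ofHom_comp, e0]
  have a1 : Spec.map (CommRingCat.ofHom
      (Polynomial.aeval (R := K) (T (-1) : K[T;T⁻¹])).toRingHom) ≫
      Spec.map (CommRingCat.ofHom (dehomogenize K 1)) =
      Spec.map (CommRingCat.ofHom (dehomogenizeTorus K)) ≫ Spec.map (CommRingCat.ofHom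
        (HomogeneousLocalization.awayMap (grading K) (mem_grading_X K 0)
          (mul_comm (MvPolynomial.X 0) (MvPolynomial.X 1)))) := by
    rw [← Spec.map_comp, ← Spec.map_comp, ← CommRingCat.ofHom_comp, ← CommRingCat.ofHom_comp, e1]
  have h2 : Spec.map (CommRingCat.ofHom (Polynomial.toLaurentAlg (R := K)).toRingHom) ≫
      Spec.map (CommRingCat.ofHom (dehomogenize K 0)) ≫
        Proj.awayι (grading K) (MvPolynomial.X 0) (mem_grading_X K 0) one_pos =
      Spec.map (CommRingCat.ofHom (Polynomial.aeval (R := K) (T (-1) : K[T;T⁻¹])).toRingHom) ≫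
        Spec.map (CommRingCat.ofHom (dehomogenize K 1)) ≫
          Proj.awayι (grading K) (MvPolynomial.X 1) (mem_grading_X K 1) one_pos := by
    rw [← Category.assoc, a0, ← Category.assoc, a1, Category.assoc, Category.assoc, h0, h1]
  exact h2

end ProjectiveLine

/-! ### The coordinate function on an embedded affine line. -/

section OpenCharts

variable {K : Type u} [Field K] {Y : Scheme.{u}}

lemma specStalkMap_stalkMap_specMap {R S : CommRingCat.{u}} (φ : R ⟶ S) (w : Spec S) :
    specStalkMap R (Spec.map φ w) ≫ (Spec.map φ).stalkMap w = φ ≫ specStalkMap S w := by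
  rw [specStalkMap_stalkMap, specStalkMap, ← Scheme.ΓSpecIso_inv_naturality_assoc]

lemma stalkMap_germ_congr {X Z : Scheme.{u}} {φ φ' : Z ⟶ X} (h : φ = φ') {W : X.Opens}
    (g : Γ(X, W)) {z : Z} (hz : φ z ∈ W) (hz' : φ' z ∈ W) :
    φ.stalkMap z (X.presheaf.germ W (φ z) hz g) = φ'.stalkMap z (X.presheaf.germ W (φ' z) hz' g) := by
  subst h
  rfl

lemma bijective_residueFieldMap {X Z : Scheme.{u}} (φ : Z ⟶ X) [IsIso φ] (z : Z) :
    Function.Bijective (φ.residueFieldMap z) :=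
  ConcreteCategory.bijective_of_isIso _

/-- An open immersion induces isomorphisms of local rings. -/
def stalkEquiv {X Z : Scheme.{u}} (φ : Z ⟶ X) [IsOpenImmersion φ] (z : Z) :
    X.presheaf.stalk (φ z) ≃+* Z.presheaf.stalk z :=
  (asIso (φ.stalkMap z)).commRingCatIsoToRingEquiv

variable (j : Spec (.of K[X]) ⟶ Y) [IsOpenImmersion j]

/-- The coordinate function on the image of an open immersion of the affine line. -/
def chartSection : Γ(Y, j ''ᵁ ⊤) :=
  (j.appIso ⊤).inv ((Scheme.ΓSpecIso (.of K[X])).inv (X : K[X]))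

lemma germ_stalkMap_appIso_inv {q : Spec (.of K[X])} (hq : j q ∈ j ''ᵁ ⊤) :
    (j.appIso ⊤).inv ≫ Y.presheaf.germ (j ''ᵁ ⊤) (j q) hq ≫ j.stalkMap q =
      (Spec (.of K[X])).presheaf.germ ⊤ q trivial := by
  rw [Scheme.Hom.germ_stalkMap, Scheme.Hom.appIso_inv_app_assoc]
  exact TopCat.Presheaf.germ_res _ _ _ _

lemma stalkMap_chartSection {q : Spec (.of K[X])} (hq : j q ∈ j ''ᵁ ⊤) :
    j.stalkMap q (Y.presheaf.germ (j ''ᵁ ⊤) (j q) hq (chartSection j)) =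
      specStalkMap (.of K[X]) q (X : K[X]) :=
  congr($(germ_stalkMap_appIso_inv j hq) ((Scheme.ΓSpecIso (.of K[X])).inv (X : K[X])))

variable [Y.Over (pt K)]

lemma eval₂_chartSection
    (hj : j ≫ (Y ↘ pt K) = Spec.map (CommRingCat.ofHom (algebraMap K K[X]))) :
    CommRingCat.ofHom (eval₂RingHom (toSections K Y (j ''ᵁ ⊤)) (chartSection j)) =
      (Scheme.ΓSpecIso (.of K[X])).inv ≫ (j.appIso ⊤).inv := by
  ext : 1
  refine Polynomial.ringHom_ext (fun a => ?_) ?_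
  · simp only [CommRingCat.hom_ofHom, coe_eval₂RingHom, Polynomial.eval₂_C]
    have h : CommRingCat.ofHom (toSections K Y (j ''ᵁ ⊤)) ≫ (j.appIso ⊤).hom =
        CommRingCat.ofHom (algebraMap K K[X]) ≫ (Scheme.ΓSpecIso (.of K[X])).inv := by
      have h1 : (Y ↘ pt K).appTop ≫ j.appTop =
          (Spec.map (CommRingCat.ofHom (algebraMap K K[X]))).appTop := by
        rw [← Scheme.Hom.comp_appTop, hj]
      rw [Scheme.ΓSpecIso_inv_naturality, ← h1, Scheme.Hom.appIso_hom]
      change ((Scheme.ΓSpecIso (.of K)).inv ≫ (Y ↘ pt K).appTop ≫ Y.presheaf.map _) ≫ _ = _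
      simp only [Category.assoc]
      rw [Scheme.Hom.naturality_assoc, ← Functor.map_comp]
      congr 2
    rw [← Iso.eq_comp_inv] at h
    exact congr($h a)
  · simp [chartSection]

/-- The coordinate map is an isomorphism here, inverse to the chart. -/
lemma isNisnevichCoordinate_chartSection
    (hj : j ≫ (Y ↘ pt K) = Spec.map (CommRingCat.ofHom (algebraMap K K[X])))
    {z : Y} (hz : z ∈ j ''ᵁ ⊤) : IsNisnevichCoordinate K (j ''ᵁ ⊤) z hz (chartSection j) := by
  have hW : IsAffineOpen (j ''ᵁ ⊤) := (isAffineOpen_top _).image_of_isOpenImmersion j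
  have h : IsIso (coordMap K (j ''ᵁ ⊤) (chartSection j)) := by
    rw [coordMap, eval₂_chartSection j hj, ← IsAffineOpen.isoSpec_hom hW]
    infer_instance
  exact ⟨inferInstance, bijective_residueFieldMap _ _⟩

lemma stalkMap_aeval_chartSection
    (hj : j ≫ (Y ↘ pt K) = Spec.map (CommRingCat.ofHom (algebraMap K K[X])))
    {q : Spec (.of K[X])} (hq : j q ∈ j ''ᵁ ⊤) (h : K[X]) :
    j.stalkMap q (aeval (Y.presheaf.germ (j ''ᵁ ⊤) (j q) hq (chartSection j)) h) =
      specStalkMap (.of K[X]) q h := by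
  have h1 : (aeval (R := K) (Y.presheaf.germ (j ''ᵁ ⊤) (j q) hq (chartSection j))).toRingHom =
      (Y.presheaf.germ (j ''ᵁ ⊤) (j q) hq).hom.comp
        (eval₂RingHom (toSections K Y (j ''ᵁ ⊤)) (chartSection j)) := by
    refine Polynomial.ringHom_ext (fun a => ?_) ?_
    · simp [germ_toSections]
    · simp
  have h2 := congr($(eval₂_chartSection j hj) ≫ Y.presheaf.germ (j ''ᵁ ⊤) (j q) hq ≫ j.stalkMap q)
  rw [Category.assoc, germ_stalkMap_appIso_inv] at h2
  exact Eq.trans congr(j.stalkMap q ($h1 h)) congr($h2 h)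

/-- The local rings of the image of the affine line. -/
lemma isLocalization_chartSection
    (hj : j ≫ (Y ↘ pt K) = Spec.map (CommRingCat.ofHom (algebraMap K K[X])))
    {z : Y} (hz : z ∈ j ''ᵁ ⊤) (q : PrimeSpectrum K[X]) (hq : j q = z) :
    letI := (aeval (R := K) (Y.presheaf.germ (j ''ᵁ ⊤) z hz (chartSection j))).toRingHom.toAlgebra
    IsLocalization.AtPrime (Y.presheaf.stalk z) q.asIdeal := by
  subst hq
  let := (specStalkMap (.of K[X]) q).hom.toAlgebra
  let := (aeval (R := K)
    (Y.presheaf.germ (j ''ᵁ ⊤) (j q) hz (chartSection j))).toRingHom.toAlgebra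
  have := isLocalization_specStalkMap (.of K[X]) q
  let e : (Spec (.of K[X])).presheaf.stalk q ≃ₐ[K[X]] Y.presheaf.stalk (j q) :=
    { (stalkEquiv j q).symm with
      commutes' := fun h => (RingEquiv.symm_apply_eq _).2
        (stalkMap_aeval_chartSection j hj hz h).symm }
  exact IsLocalization.isLocalization_of_algEquiv q.asIdeal.primeCompl e

/-- The function field is the field of rational functions in a coordinate. -/
lemma isFractionRing_chartSection [IsIntegral Y]
    (hj : j ≫ (Y ↘ pt K) = Spec.map (CommRingCat.ofHom (algebraMap K K[X])))
    {z : Y} (hz : z ∈ j ''ᵁ ⊤) :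
    letI := (aeval (R := K) (algebraMap _ Y.functionField
      (Y.presheaf.germ (j ''ᵁ ⊤) z hz (chartSection j)))).toRingHom.toAlgebra
    IsFractionRing K[X] Y.functionField := by
  obtain ⟨q, -, hq⟩ := id hz
  set x := Y.presheaf.germ (j ''ᵁ ⊤) z hz (chartSection j)
  let := (aeval (R := K) x).toRingHom.toAlgebra
  let := (aeval (R := K) (algebraMap _ Y.functionField x)).toRingHom.toAlgebra
  have : IsScalarTower K[X] (Y.presheaf.stalk z) Y.functionField :=
    .of_algebraMap_eq fun h => aeval_algebraMap_apply _ _ _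
  let q' : PrimeSpectrum K[X] := q
  have : IsLocalization.AtPrime (Y.presheaf.stalk z) q'.asIdeal :=
    isLocalization_chartSection j hj hz q' hq
  have h1 : FaithfulSMul K[X] Y.functionField := by
    rw [faithfulSMul_iff_algebraMap_injective,
      IsScalarTower.algebraMap_eq K[X] (Y.presheaf.stalk z) Y.functionField]
    exact (algebraMap_functionField_injective z).comp
      (IsLocalization.injective _ q'.asIdeal.primeCompl_le_nonZeroDivisors)
  refine IsFractionRing.of_field _ _ fun v => ?_
  obtain ⟨a, b, hb, rfl⟩ := IsFractionRing.div_surjective (A := Y.presheaf.stalk z) v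
  obtain ⟨⟨h, s⟩, hs⟩ := IsLocalization.surj q'.asIdeal.primeCompl a
  obtain ⟨⟨h', s'⟩, hs'⟩ := IsLocalization.surj q'.asIdeal.primeCompl b
  refine ⟨h * s', h' * s, ?_⟩
  have hs0 := (map_ne_zero_iff _ (FaithfulSMul.algebraMap_injective K[X] Y.functionField)).2
    (nonZeroDivisors.ne_zero (q'.asIdeal.primeCompl_le_nonZeroDivisors s.2))
  have hs0' := (map_ne_zero_iff _ (FaithfulSMul.algebraMap_injective K[X] Y.functionField)).2
    (nonZeroDivisors.ne_zero (q'.asIdeal.primeCompl_le_nonZeroDivisors s'.2))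
  have hb0 : algebraMap _ Y.functionField b ≠ 0 :=
    (map_ne_zero_iff _ (algebraMap_functionField_injective z)).2 (nonZeroDivisors.ne_zero hb)
  have hs1 := congrArg (algebraMap _ Y.functionField) hs
  have hs1' := congrArg (algebraMap _ Y.functionField) hs'
  rw [map_mul, ← IsScalarTower.algebraMap_apply, ← IsScalarTower.algebraMap_apply] at hs1 hs1'
  rw [map_mul, map_mul, ← hs1, ← hs1']
  field_simp

end OpenCharts

/-! ### Differentials of localizations of `K[X]`. -/

section Kaehler

variable {K : Type u} [Field K] {R : Type u} [CommRing R] [Algebra K R] [Algebra K[X] R]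
  [IsScalarTower K K[X] R]

/-- The differentials of a localization of `K[X]` are free on the differential of the
coordinate. -/
lemma exists_kaehlerEquiv (M : Submonoid K[X]) [IsLocalization M R] :
    ∃ e : Ω[R⁄K] ≃ₗ[R] R, e (KaehlerDifferential.D K R (coordinate (K := K) R)) = 1 := by
  have : Algebra.FormallyEtale K[X] R := .of_isLocalization M
  let e : Ω[R⁄K] ≃ₗ[R] R :=
    (KaehlerDifferential.tensorKaehlerEquivOfFormallyEtale K K[X] R).symm ≪≫ₗ
      ((KaehlerDifferential.polynomialEquiv K).baseChange K[X] R _ _) ≪≫ₗ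
      AlgebraTensorModule.rid K[X] R R
  refine ⟨e, ?_⟩
  simp [e, coordinate, KaehlerDifferential.tensorKaehlerEquivOfFormallyEtale_symm_D_algebraMap]

lemma exists_derivation_eq_smul_coordinate (M : Submonoid K[X]) [IsLocalization M R] {N : Type*}
    [AddCommGroup N] [Module R N] [Module K N] [IsScalarTower K R N] (D : Derivation K R N) (a : R) :
    ∃ e : R, D a = e • D (coordinate (K := K) R) := by
  obtain ⟨d, hd⟩ := diff_coordinate_dvd (K := K) M a
  exact ⟨_, derivation_eq_of_diff_eq D (hd.trans (mul_comm _ _))⟩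

end Kaehler

/-! ### Sheaves described by local generators in the function field. -/

section Generators

variable {Y : Scheme.{u}} [IsIntegral Y]

namespace StalkSheaf

/-- In terms of a trivialization of the generic stalk, the stalk at `z` is generated by `α`. -/
def HasGenerator (A : StalkSheaf Y) (e : A.generic ≃ₗ[Y.functionField] Y.functionField) (z : Y)
    (α : Y.functionField) : Prop :=
  ∀ v, v ∈ A.stalk z ↔ ∃ r : Y.presheaf.stalk z, e v = algebraMap _ Y.functionField r * α

variable {A B : StalkSheaf Y} {eA : A.generic ≃ₗ[Y.functionField] Y.functionField}
  {eB : B.generic ≃ₗ[Y.functionField] Y.functionField} {z : Y} {α β : Y.functionField}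

lemma hasGenerator_iff : A.HasGenerator eA z α ↔
    A.stalk z = Submodule.span (localRing Y z) {eA.symm α} := by
  rw [SetLike.ext_iff]
  refine forall_congr' fun v => iff_congr Iff.rfl ?_
  rw [mem_span_localRing]
  refine exists_congr fun r => ?_
  rw [← map_smul, LinearEquiv.eq_symm_apply, smul_eq_mul]

lemma hasGenerator_of_stalk_eq {w : A.generic} (h : A.stalk z = Submodule.span (localRing Y z) {w}) :
    A.HasGenerator eA z (eA w) :=
  hasGenerator_iff.2 (by rw [h, LinearEquiv.symm_apply_apply])

lemma HasGenerator.mem (h : A.HasGenerator eA z α) : eA.symm α ∈ A.stalk z :=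
  (h _).2 ⟨1, by simp⟩

/-- Generators can be changed by units. -/
lemma HasGenerator.unit_mul (h : A.HasGenerator eA z α) (v : (Y.presheaf.stalk z)ˣ) :
    A.HasGenerator eA z (algebraMap _ Y.functionField (v : Y.presheaf.stalk z) * α) := by
  refine fun a => (h a).trans ⟨fun ⟨r, hr⟩ => ⟨r * (v⁻¹ : (Y.presheaf.stalk z)ˣ), ?_⟩,
    fun ⟨r, hr⟩ => ⟨r * v, ?_⟩⟩
  · rw [hr, ← mul_assoc, ← map_mul, mul_assoc, Units.inv_mul, mul_one]
  · rw [hr, map_mul, mul_assoc]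

/-- The trivialization of the sheaf of homomorphisms. -/
def homEquiv (eA : A.generic ≃ₗ[Y.functionField] Y.functionField)
    (eB : B.generic ≃ₗ[Y.functionField] Y.functionField) :
    (A.hom B).generic ≃ₗ[Y.functionField] Y.functionField :=
  (eA.arrowCongr eB : (A.generic →ₗ[Y.functionField] B.generic) ≃ₗ[Y.functionField] _) ≪≫ₗ
    LinearMap.ringLmapEquivSelf Y.functionField Y.functionField Y.functionField

lemma homEquiv_apply (φ : A.generic →ₗ[Y.functionField] B.generic) :
    homEquiv eA eB φ = eB (φ (eA.symm 1)) := rfl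

lemma homEquiv_symm_apply (c : Y.functionField) (a : A.generic) :
    (show A.generic →ₗ[Y.functionField] B.generic from (homEquiv eA eB).symm c) a =
      eB.symm (c * eA a) := by
  set φ : A.generic →ₗ[Y.functionField] B.generic := (homEquiv eA eB).symm c with hφ
  have h : eB (φ (eA.symm 1)) = c := (homEquiv eA eB).apply_symm_apply c
  change φ a = _
  rw [LinearEquiv.eq_symm_apply, ← h, mul_comm, ← smul_eq_mul, ← map_smul, ← map_smul, ← map_smul,
    smul_eq_mul, mul_one, eA.symm_apply_apply]

/-- In the trivializations a homomorphism is multiplication by a scalar. It preserves the stalks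
exactly when it sends `α` to a regular multiple of `β`. -/
lemma HasGenerator.hom (hA : A.HasGenerator eA z α) (hB : B.HasGenerator eB z β) (hα : α ≠ 0) :
    (A.hom B).HasGenerator (homEquiv eA eB) z (β / α) := by
  intro φ
  change (A.generic →ₗ[Y.functionField] B.generic) at φ
  have h1 (a : A.generic) : eB (φ a) = eA a * eB (φ (eA.symm 1)) := by
    rw [← smul_eq_mul, ← map_smul, ← map_smul, ← map_smul, smul_eq_mul, mul_one,
      eA.symm_apply_apply]
  rw [homEquiv_apply]
  constructor
  · intro h
    obtain ⟨r, hr⟩ := (hB _).1 (h _ hA.mem)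
    refine ⟨r, ?_⟩
    rw [h1, eA.apply_symm_apply] at hr
    rw [← mul_div_assoc, ← hr, mul_div_cancel_left₀ _ hα]
  · rintro ⟨r, hr⟩ a ha
    obtain ⟨r', hr'⟩ := (hA _).1 ha
    refine (hB _).2 ⟨r' * r, ?_⟩
    rw [h1, hr, hr', map_mul]
    field_simp

/-- The trivialization of the tensor product. -/
def tensorEquiv (eA : A.generic ≃ₗ[Y.functionField] Y.functionField)
    (eB : B.generic ≃ₗ[Y.functionField] Y.functionField) :
    (A.tensor B).generic ≃ₗ[Y.functionField] Y.functionField :=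
  (TensorProduct.congr eA eB : A.generic ⊗[Y.functionField] B.generic ≃ₗ[Y.functionField] _) ≪≫ₗ
    TensorProduct.lid Y.functionField Y.functionField

lemma tensorEquiv_tmul (a : A.generic) (b : B.generic) :
    tensorEquiv eA eB (a ⊗ₜ[Y.functionField] b) = eA a * eB b := rfl

lemma HasGenerator.tensor (hA : A.HasGenerator eA z α) (hB : B.HasGenerator eB z β) :
    (A.tensor B).HasGenerator (tensorEquiv eA eB) z (α * β) := by
  have h : (tensorEquiv eA eB).symm (α * β) = eA.symm α ⊗ₜ[Y.functionField] eB.symm β :=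
    (LinearEquiv.symm_apply_eq (tensorEquiv eA eB)).2 ((tensorEquiv_tmul _ _).trans (by simp)).symm
  refine hasGenerator_iff.2 (le_antisymm (Submodule.span_le.2 ?_)
    (Submodule.span_mono (Set.singleton_subset_iff.2 ⟨_, hA.mem, _, hB.mem, h⟩)))
  rintro _ ⟨a, ha, b, hb, rfl⟩
  obtain ⟨r, hr⟩ := (hA _).1 ha
  obtain ⟨r', hr'⟩ := (hB _).1 hb
  refine mem_span_localRing.2 ⟨r * r', (tensorEquiv eA eB).injective ?_⟩
  refine (tensorEquiv_tmul _ _).trans (Eq.trans ?_ (map_smul (tensorEquiv eA eB) _ _).symm)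
  rw [LinearEquiv.apply_symm_apply, hr, hr', map_mul, smul_eq_mul]
  ring

lemma hasGenerator_structureSheaf :
    (structureSheaf Y).HasGenerator (LinearEquiv.refl Y.functionField Y.functionField) z 1 :=
  hasGenerator_iff.2 rfl

/-- Sheaves with the same generators in some trivializations are isomorphic. -/
def isoOfHasGenerator (eA : A.generic ≃ₗ[Y.functionField] Y.functionField)
    (eB : B.generic ≃ₗ[Y.functionField] Y.functionField)
    (h : ∀ z, ∃ α, A.HasGenerator eA z α ∧ B.HasGenerator eB z α) : A.Iso B where
  toEquiv := eA ≪≫ₗ eB.symm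
  mem_stalk_iff z a := by
    obtain ⟨α, h1, h2⟩ := h z
    rw [h1, h2]
    simp

lemma HasGenerator.vanishesAt_iff (hA : A.HasGenerator eA z α) (σ : A.generic) :
    A.VanishesAt σ z ↔ ∃ r ∈ IsLocalRing.maximalIdeal (Y.presheaf.stalk z),
      eA σ = algebraMap _ Y.functionField r * α := by
  constructor
  · intro h
    refine Submodule.span_induction (p := fun v _ => ∃ r ∈ IsLocalRing.maximalIdeal
      (Y.presheaf.stalk z), eA v = algebraMap _ Y.functionField r * α) ?_ ?_ ?_ ?_ h
    · rintro _ ⟨a, ha, w, hw, rfl⟩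
      obtain ⟨r, hr⟩ := (hA _).1 hw
      refine ⟨a * r, Ideal.mul_mem_right _ _ ha, ?_⟩
      rw [map_smul, hr, map_mul, smul_eq_mul, mul_assoc]
    · exact ⟨0, zero_mem _, by simp⟩
    · rintro _ _ _ _ ⟨a, ha, ha'⟩ ⟨b, hb, hb'⟩
      exact ⟨a + b, add_mem ha hb, by rw [map_add, ha', hb', map_add, add_mul]⟩
    · rintro ⟨_, c, rfl⟩ v _ ⟨a, ha, ha'⟩
      refine ⟨c * a, Ideal.mul_mem_left _ _ ha, ?_⟩
      rw [localRing_smul_def, map_smul, ha', map_mul, smul_eq_mul, mul_assoc]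
  · rintro ⟨r, hr, hr'⟩
    refine Submodule.subset_span ⟨r, hr, _, hA.mem, ?_⟩
    rw [← map_smul, LinearEquiv.eq_symm_apply, hr', smul_eq_mul]

end StalkSheaf

end Generators

/-! ### Generators of the cotangent bundle and of its pullback. -/

section CotangentStalks

variable {K : Type u} [Field K] {X Y : Scheme.{u}} [X.Over (pt K)] [Y.Over (pt K)] [IsIntegral Y]

lemma hasGenerator_cotangent (j : Spec (.of K[X]) ⟶ Y) [IsOpenImmersion j]
    (hj : j ≫ (Y ↘ pt K) = Spec.map (CommRingCat.ofHom (algebraMap K K[X])))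
    {z : Y} (hz : z ∈ j ''ᵁ ⊤) (e : Ω[Y.functionField⁄K] ≃ₗ[Y.functionField] Y.functionField) :
    (cotangent K Y).HasGenerator e z (e (KaehlerDifferential.D K Y.functionField
      (algebraMap _ Y.functionField (Y.presheaf.germ (j ''ᵁ ⊤) z hz (chartSection j))))) := by
  obtain ⟨q, hq⟩ : ∃ q : PrimeSpectrum K[X], j q = _ := ⟨hz.choose, hz.choose_spec.2⟩
  have h1 := isLocalization_chartSection j hj hz q hq
  set x := Y.presheaf.germ (j ''ᵁ ⊤) z hz (chartSection j)
  let := (aeval (R := K) x).toRingHom.toAlgebra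
  have : IsScalarTower K K[X] (Y.presheaf.stalk z) :=
    .of_algebraMap_eq fun c => (aeval_C x c).symm
  have hx : coordinate (K := K) (Y.presheaf.stalk z) = x := aeval_X x
  refine StalkSheaf.hasGenerator_of_stalk_eq (le_antisymm (Submodule.span_le.2 ?_)
    (Submodule.span_mono (Set.singleton_subset_iff.2 ⟨_, ⟨x, rfl⟩, rfl⟩)))
  rintro _ ⟨_, ⟨a, rfl⟩, rfl⟩
  obtain ⟨r, hr⟩ := exists_derivation_eq_smul_coordinate (K := K)
    q.asIdeal.primeCompl (stalkD K z) a
  rw [hx] at hr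
  exact mem_span_localRing.2 ⟨r, hr.trans (algebraMap_smul _ _ _).symm⟩

/-- The image of the generic point lies in every open which contains some `f z`. -/
lemma image_genericPoint_mem (f : Y ⟶ X) {W : X.Opens} {z : Y} (hz : f z ∈ W) :
    f (genericPoint Y) ∈ W :=
  (((genericPoint_spec Y).specializes trivial).map f.continuous).mem_open W.isOpen hz

/-- At `f z` every differential is a multiple of that of the coordinate, and the multiplier pulls
back to a regular function at `z`. -/
lemma hasGenerator_pullbackCotangent (f : Y ⟶ X) [f.IsOver (pt K)]
    (j : Spec (.of K[X]) ⟶ X) [IsOpenImmersion j]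
    (hj : j ≫ (X ↘ pt K) = Spec.map (CommRingCat.ofHom (algebraMap K K[X])))
    {z : Y} (hz : f z ∈ j ''ᵁ ⊤)
    (e : (pullbackCotangent K f).generic ≃ₗ[Y.functionField] Y.functionField) :
    letI := imageAlgebra f
    (pullbackCotangent K f).HasGenerator e z (e ((1 : Y.functionField) ⊗ₜ[ImageStalk f]
      KaehlerDifferential.D K (ImageStalk f) (X.presheaf.germ (j ''ᵁ ⊤) (f (genericPoint Y))
        (image_genericPoint_mem f hz) (chartSection j)))) := by
  obtain ⟨q, hq⟩ : ∃ q : PrimeSpectrum K[X], j q = _ := ⟨hz.choose, hz.choose_spec.2⟩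
  have h1 := isLocalization_chartSection j hj hz q hq
  set x := X.presheaf.germ (j ''ᵁ ⊤) (f z) hz (chartSection j) with hx'
  let := (aeval (R := K) x).toRingHom.toAlgebra
  have : IsScalarTower K K[X] (X.presheaf.stalk (f z)) :=
    .of_algebraMap_eq fun c => (aeval_C x c).symm
  have hx : coordinate (K := K) (X.presheaf.stalk (f z)) = x := aeval_X x
  let := imageAlgebra f
  have hspec : f (genericPoint Y) ⤳ f z :=
    ((genericPoint_spec Y).specializes trivial).map f.continuous
  let : Algebra (X.presheaf.stalk (f z)) (ImageStalk f) :=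
    (X.presheaf.stalkSpecializes hspec).hom.toAlgebra
  have : IsScalarTower K (X.presheaf.stalk (f z)) (ImageStalk f) :=
    .of_algebraMap_eq fun c => (stalkSpecializes_algebraMap K hspec c).symm
  let D := (KaehlerDifferential.D K (ImageStalk f)).compAlgebraMap (X.presheaf.stalk (f z))
  have hxx : X.presheaf.stalkSpecializes hspec x = X.presheaf.germ (j ''ᵁ ⊤)
      (f (genericPoint Y)) (image_genericPoint_mem f hz) (chartSection j) :=
    TopCat.Presheaf.germ_stalkSpecializes_apply _ _ _ _
  rw [← hxx]
  refine StalkSheaf.hasGenerator_of_stalk_eq (le_antisymm (Submodule.span_le.2 ?_)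
    (Submodule.span_mono (Set.singleton_subset_iff.2 ⟨x, rfl⟩)))
  rintro _ ⟨a, rfl⟩
  obtain ⟨r, hr⟩ := exists_derivation_eq_smul_coordinate (K := K)
    q.asIdeal.primeCompl D a
  rw [hx] at hr
  refine mem_span_localRing.2 ⟨f.stalkMap z r, ?_⟩
  have h2 : algebraMap _ Y.functionField (f.stalkMap z r) =
      f.stalkMap (genericPoint Y) (X.presheaf.stalkSpecializes hspec r) :=
    (Scheme.Hom.stalkSpecializes_stalkMap_apply f _ _ ((genericPoint_spec Y).specializes trivial) r).symm
  have h3 : D a = X.presheaf.stalkSpecializes hspec r • D x := hr.trans (algebraMap_smul _ _ _).symm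
  change (1 : Y.functionField) ⊗ₜ[ImageStalk f] D a =
    (algebraMap _ Y.functionField (f.stalkMap z r) * 1) ⊗ₜ[ImageStalk f] D x
  rw [h2, h3, TensorProduct.tmul_smul, TensorProduct.smul_tmul', Algebra.smul_def]
  rfl

/-- If `f` is a dominant map from a curve to a curve, then the generic stalk of the pullback of the
cotangent bundle is one-dimensional. -/
lemma exists_pullbackCotangent_equiv (f : Y ⟶ X) [f.IsOver (pt K)]
    (j : Spec (.of K[X]) ⟶ X) [IsOpenImmersion j]
    (hj : j ≫ (X ↘ pt K) = Spec.map (CommRingCat.ofHom (algebraMap K K[X])))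
    (hη : f (genericPoint Y) ∈ j ''ᵁ ⊤) :
    letI := imageAlgebra f
    ∃ e : (pullbackCotangent K f).generic ≃ₗ[Y.functionField] Y.functionField,
      e ((1 : Y.functionField) ⊗ₜ[ImageStalk f] KaehlerDifferential.D K (ImageStalk f)
        (X.presheaf.germ (j ''ᵁ ⊤) (f (genericPoint Y)) hη (chartSection j))) = 1 := by
  obtain ⟨q, hq⟩ : ∃ q : PrimeSpectrum K[X], j q = _ := ⟨hη.choose, hη.choose_spec.2⟩
  have h1 := isLocalization_chartSection j hj hη q hq
  set x := X.presheaf.germ (j ''ᵁ ⊤) (f (genericPoint Y)) hη (chartSection j) with hx'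
  let := (aeval (R := K) x).toRingHom.toAlgebra
  have : IsScalarTower K K[X] (X.presheaf.stalk (f (genericPoint Y))) :=
    .of_algebraMap_eq fun c => (aeval_C x c).symm
  have hx : coordinate (K := K) (X.presheaf.stalk (f (genericPoint Y))) = x := aeval_X x
  let := imageAlgebra f
  obtain ⟨e, he⟩ := exists_kaehlerEquiv (K := K) (R := X.presheaf.stalk (f (genericPoint Y)))
    q.asIdeal.primeCompl
  rw [hx] at he
  refine ⟨e.baseChange (ImageStalk f) Y.functionField _ _ ≪≫ₗ
    AlgebraTensorModule.rid (ImageStalk f) Y.functionField Y.functionField, ?_⟩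
  change e (KaehlerDifferential.D K _ x) • (1 : Y.functionField) = 1
  rw [he, one_smul]

lemma exists_cotangent_equiv (j : Spec (.of K[X]) ⟶ Y) [IsOpenImmersion j]
    (hj : j ≫ (Y ↘ pt K) = Spec.map (CommRingCat.ofHom (algebraMap K K[X])))
    {z : Y} (hz : z ∈ j ''ᵁ ⊤) :
    ∃ e : Ω[Y.functionField⁄K] ≃ₗ[Y.functionField] Y.functionField,
      e (KaehlerDifferential.D K Y.functionField (algebraMap _ Y.functionField
        (Y.presheaf.germ (j ''ᵁ ⊤) z hz (chartSection j)))) = 1 := by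
  have h := isFractionRing_chartSection j hj hz
  set x := algebraMap _ Y.functionField (Y.presheaf.germ (j ''ᵁ ⊤) z hz (chartSection j))
  let := (aeval (R := K) x).toRingHom.toAlgebra
  have : IsScalarTower K K[X] Y.functionField := .of_algebraMap_eq fun c => (aeval_C x c).symm
  have hx : coordinate (K := K) Y.functionField = x := aeval_X x
  obtain ⟨e, he⟩ := exists_kaehlerEquiv (K := K) (R := Y.functionField) (nonZeroDivisors K[X])
  exact ⟨e, hx ▸ he⟩

end CotangentStalks

/-! ### The coordinates `y` and `y⁻¹`, and the point at infinity. -/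

section Coordinates

variable (K : Type u) [Field K]

/-- The complement of the two coordinate points. -/
def torus : Spec (.of K[T;T⁻¹]) ⟶ P1 K :=
  Spec.map (CommRingCat.ofHom (Polynomial.toLaurentAlg (R := K)).toRingHom) ≫ chart K 0

lemma torus_eq : torus K = Spec.map (CommRingCat.ofHom
    (Polynomial.aeval (R := K) (T (-1) : K[T;T⁻¹])).toRingHom) ≫ chart K 1 :=
  toLaurent_chart_zero K

instance : IsOpenImmersion (torus K) := by
  have h : IsOpenImmersion (Spec.map (CommRingCat.ofHom (algebraMap K[X] K[T;T⁻¹]))) :=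
    .of_isLocalization (X : K[X])
  have h' : IsOpenImmersion (Spec.map (CommRingCat.ofHom
    (Polynomial.toLaurentAlg (R := K)).toRingHom)) := h
  unfold torus; infer_instance

lemma torus_stalkMap_injective (w : Spec (.of K[T;T⁻¹])) :
    Function.Injective ((torus K).stalkMap w) :=
  (stalkEquiv (torus K) w).injective

/-- The open subset `X_i ≠ 0`. -/
abbrev chartOpen (i : Fin 2) : (P1 K).Opens := chart K i ''ᵁ ⊤

variable {K} in
lemma mem_chartOpen {i : Fin 2} {z : P1 K} :
    z ∈ chartOpen K i ↔ ∃ q : PrimeSpectrum K[X], chart K i q = z :=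
  ⟨fun ⟨q, _, h⟩ => ⟨q, h⟩, fun ⟨q, h⟩ => ⟨q, trivial, h⟩⟩

lemma genericPoint_mem_chartOpen (i : Fin 2) : genericPoint (P1 K) ∈ chartOpen K i :=
  ((genericPoint_spec (P1 K)).mem_open_set_iff (chartOpen K i).isOpen).2
    ⟨chart K i (⊥ : PrimeSpectrum K[X]), trivial, mem_chartOpen.2 ⟨_, rfl⟩⟩

/-- The coordinate of the chart `i`, as an element of the local ring at `z`. -/
def germCoord (i : Fin 2) {z : P1 K} (hz : z ∈ chartOpen K i) : (P1 K).presheaf.stalk z :=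
  (P1 K).presheaf.germ (chartOpen K i) z hz (chartSection (chart K i))

/-- The coordinate of the chart `i`, as a rational function. -/
def affineCoord (i : Fin 2) : (P1 K).functionField :=
  germCoord K i (genericPoint_mem_chartOpen K i)

lemma algebraMap_germCoord (i : Fin 2) {z : P1 K} (hz : z ∈ chartOpen K i) :
    algebraMap _ (P1 K).functionField (germCoord K i hz) = affineCoord K i :=
  congr($(TopCat.Presheaf.germ_stalkSpecializes (P1 K).presheaf hz
    ((genericPoint_spec (P1 K)).specializes trivial)) (chartSection (chart K i)))

lemma algebraMap_aeval_germCoord (i : Fin 2) {z : P1 K} (hz : z ∈ chartOpen K i) (h : K[X]) :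
    algebraMap _ (P1 K).functionField (aeval (germCoord K i hz) h) = aeval (affineCoord K i) h := by
  rw [← algebraMap_germCoord K i hz, aeval_algebraMap_apply]

lemma isLocalization_germCoord {i : Fin 2} {z : P1 K} (hz : z ∈ chartOpen K i)
    {q : PrimeSpectrum K[X]} (hq : chart K i q = z) :
    letI := (aeval (R := K) (germCoord K i hz)).toRingHom.toAlgebra
    IsLocalization.AtPrime ((P1 K).presheaf.stalk z) q.asIdeal :=
  isLocalization_chartSection (chart K i) (chart_over K i) hz q hq

lemma isFractionRing_affineCoord (i : Fin 2) :
    letI := (aeval (R := K) (affineCoord K i)).toRingHom.toAlgebra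
    IsFractionRing K[X] (P1 K).functionField := by
  rw [← algebraMap_germCoord K i (genericPoint_mem_chartOpen K i)]
  exact isFractionRing_chartSection (chart K i) (chart_over K i) (genericPoint_mem_chartOpen K i)

variable {K}

lemma aeval_germCoord_mem_iff {i : Fin 2} {z : P1 K} (hz : z ∈ chartOpen K i)
    {q : PrimeSpectrum K[X]} (hq : chart K i q = z) (h : K[X]) :
    aeval (germCoord K i hz) h ∈ IsLocalRing.maximalIdeal ((P1 K).presheaf.stalk z) ↔
      h ∈ q.asIdeal := by
  let := (aeval (R := K) (germCoord K i hz)).toRingHom.toAlgebra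
  have := isLocalization_germCoord K hz hq
  exact IsLocalization.AtPrime.to_map_mem_maximal_iff ((P1 K).presheaf.stalk z) q.asIdeal h

lemma isUnit_aeval_germCoord {i : Fin 2} {z : P1 K} (hz : z ∈ chartOpen K i)
    {q : PrimeSpectrum K[X]} (hq : chart K i q = z) {h : K[X]} (hh : h ∉ q.asIdeal) :
    IsUnit (aeval (germCoord K i hz) h) := by
  rwa [← aeval_germCoord_mem_iff hz hq, IsLocalRing.mem_maximalIdeal, mem_nonunits_iff, not_not]
    at hh

lemma torus_mem (i : Fin 2) (w : Spec (.of K[T;T⁻¹])) : torus K w ∈ chartOpen K i := by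
  fin_cases i
  · exact ⟨_, trivial, rfl⟩
  · rw [torus_eq]
    exact ⟨_, trivial, rfl⟩

lemma stalkMap_germ_comp {R : CommRingCat.{u}} (φ : CommRingCat.of K[X] ⟶ R) (i : Fin 2)
    {w : Spec R} (hw : (Spec.map φ ≫ chart K i) w ∈ chartOpen K i) :
    (Spec.map φ ≫ chart K i).stalkMap w ((P1 K).presheaf.germ (chartOpen K i) _ hw
      (chartSection (chart K i))) = specStalkMap R w (φ (X : K[X])) := by
  rw [Scheme.Hom.stalkMap_comp]
  refine (congrArg ((Spec.map φ).stalkMap w)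
    (stalkMap_chartSection (chart K i) (q := Spec.map φ w) hw)).trans ?_
  exact congr($(specStalkMap_stalkMap_specMap φ w) (X : K[X]))

lemma torus_stalkMap_germCoord_zero (w : Spec (.of K[T;T⁻¹])) :
    (torus K).stalkMap w (germCoord K 0 (torus_mem 0 w)) =
      specStalkMap (.of K[T;T⁻¹]) w (T 1 : K[T;T⁻¹]) := by
  refine (stalkMap_germ_comp _ 0 _).trans ?_
  congr 1
  exact Polynomial.toLaurent_X

lemma torus_stalkMap_germCoord_one (w : Spec (.of K[T;T⁻¹])) :
    (torus K).stalkMap w (germCoord K 1 (torus_mem 1 w)) =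
      specStalkMap (.of K[T;T⁻¹]) w (T (-1) : K[T;T⁻¹]) := by
  refine (stalkMap_germ_congr (torus_eq K) _ _ (by rw [← torus_eq]; exact torus_mem 1 w)).trans ?_
  refine (stalkMap_germ_comp _ 1 _).trans ?_
  congr 1
  exact aeval_X _

/-- On the torus the two coordinates are `T` and `T⁻¹`. The identity at a single point of the torus
passes to the function field. -/
lemma affineCoord_mul : affineCoord K 0 * affineCoord K 1 = 1 := by
  let w : Spec (.of K[T;T⁻¹]) := Nonempty.some (inferInstanceAs (Nonempty (PrimeSpectrum K[T;T⁻¹])))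
  have h : germCoord K 0 (torus_mem 0 w) * germCoord K 1 (torus_mem 1 w) = 1 := by
    apply torus_stalkMap_injective
    rw [map_mul, torus_stalkMap_germCoord_zero, torus_stalkMap_germCoord_one, ← map_mul, map_one]
    have : (T 1 * T (-1) : K[T;T⁻¹]) = 1 := by rw [← T_add]; simp
    exact (congrArg _ this).trans (map_one _)
  have h' := congrArg (algebraMap _ (P1 K).functionField) h
  rwa [map_mul, algebraMap_germCoord, algebraMap_germCoord, map_one] at h'

variable (K) in
lemma affineCoord_ne_zero (i : Fin 2) : affineCoord K i ≠ 0 := by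
  have h : affineCoord K 0 * affineCoord K 1 ≠ 0 := by rw [affineCoord_mul]; exact one_ne_zero
  fin_cases i
  · exact left_ne_zero_of_mul h
  · exact right_ne_zero_of_mul h

variable (K) in
lemma affineCoord_one : affineCoord K 1 = (affineCoord K 0)⁻¹ :=
  eq_inv_of_mul_eq_one_right affineCoord_mul

variable (K) in
lemma infinity_mem : infinity K ∈ chartOpen K 1 := mem_chartOpen.2 ⟨_, rfl⟩

variable (K) in
-- Otherwise the coordinate of the chart `1`, which vanishes at infinity, would be a unit there.
lemma infinity_notMem : infinity K ∉ chartOpen K 0 := by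
  intro h
  have h1 : germCoord K 0 h * germCoord K 1 (infinity_mem K) = 1 := by
    apply algebraMap_functionField_injective
    rw [map_mul, algebraMap_germCoord, algebraMap_germCoord, map_one, affineCoord_mul]
  have h2 := (aeval_germCoord_mem_iff (infinity_mem K) rfl X).2 (Ideal.mem_span_singleton_self X)
  rw [aeval_X, IsLocalRing.mem_maximalIdeal, mem_nonunits_iff] at h2
  exact h2 (IsUnit.of_mul_eq_one_right _ h1)

lemma eq_infinity {z : P1 K} (hz : z ∉ chartOpen K 0) : z = infinity K := by
  obtain ⟨i, q, hq⟩ := exists_chart K z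
  obtain rfl : i = 1 := by
    by_contra h
    obtain rfl : i = 0 := by fin_cases i <;> simp_all
    exact hz (mem_chartOpen.2 ⟨q, hq⟩)
  let q' : PrimeSpectrum K[X] := q
  have hX : X ∈ q'.asIdeal := by
    by_contra hX
    apply hz
    -- The torus lies in the chart `1` through `X ↦ T⁻¹`, so the usual description of the points
    -- with `X ≠ 0` is composed with the inversion of `T`.
    let ι : K[T;T⁻¹] →+* K[T;T⁻¹] := (LaurentPolynomial.invert (R := K)).toRingEquiv.toRingHom
    have h1 : q' ∈ Set.range (PrimeSpectrum.comap (algebraMap K[X] K[T;T⁻¹])) := by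
      rw [PrimeSpectrum.localization_away_comap_range K[T;T⁻¹] (X : K[X])]
      exact hX
    obtain ⟨w₀, hw₀⟩ := h1
    have hι : (Polynomial.aeval (R := K) (T (-1) : K[T;T⁻¹])).toRingHom =
        ι.comp (algebraMap K[X] K[T;T⁻¹]) := by
      refine Polynomial.ringHom_ext (fun a => ?_) ?_
      · simp [ι, algebraMap_eq_toLaurent]
      · simp [ι, algebraMap_eq_toLaurent]
    have hι' : ι.comp ι = RingHom.id _ := RingHom.ext fun a => LaurentPolynomial.invert.left_inv a
    let w : PrimeSpectrum K[T;T⁻¹] := PrimeSpectrum.comap ι w₀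
    have hw : PrimeSpectrum.comap (Polynomial.aeval (R := K) (T (-1) : K[T;T⁻¹])).toRingHom w =
        q' := by
      rw [← hw₀, hι, PrimeSpectrum.comap_comp_apply, ← PrimeSpectrum.comap_comp_apply ι ι, hι']
      rfl
    have h2 : torus K w = z := by
      rw [torus_eq, ← hq]
      exact congrArg (chart K 1) hw
    exact h2 ▸ torus_mem 0 w
  rw [← hq]
  refine congrArg (chart K 1) (PrimeSpectrum.ext (x := q') ?_)
  have hmax : (Ideal.span {(X : K[X])}).IsMaximal :=
    PrincipalIdealRing.isMaximal_of_irreducible irreducible_X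
  exact (hmax.eq_of_le q'.isPrime.ne_top ((Ideal.span_singleton_le_iff_mem _).2 hX)).symm

end Coordinates

/-! ### Changing generators by units. -/

section UnitMultiples

variable {Y : Scheme.{u}} [IsIntegral Y] {A : StalkSheaf Y}
  {e : A.generic ≃ₗ[Y.functionField] Y.functionField} {z : Y}

lemma StalkSheaf.HasGenerator.of_eq {α β : Y.functionField} (h : A.HasGenerator e z α)
    (hβ : α = β) : A.HasGenerator e z β :=
  hβ ▸ h

lemma StalkSheaf.HasGenerator.of_isUnit {α β : Y.functionField} (h : A.HasGenerator e z α)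
    {v : Y.presheaf.stalk z} (hv : IsUnit v) (hβ : β = algebraMap _ Y.functionField v * α) :
    A.HasGenerator e z β := by
  obtain ⟨v, rfl⟩ := hv
  exact hβ ▸ h.unit_mul v

end UnitMultiples

/-! ### The pullback `ρ` of the coordinate under `f`. -/

section RationalMap

variable {K : Type u} [Field K] {f : P1 K ⟶ P1 K} {a : K} {p : ℕ}

lemma germCoord_mul {z : P1 K} (h0 : z ∈ chartOpen K 0) (h1 : z ∈ chartOpen K 1) :
    germCoord K 0 h0 * germCoord K 1 h1 = 1 := by
  apply algebraMap_functionField_injective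
  rw [map_mul, algebraMap_germCoord, algebraMap_germCoord, map_one, affineCoord_mul]

lemma torus_stalkMap_aeval (w : Spec (.of K[T;T⁻¹])) (h : K[X]) :
    (torus K).stalkMap w (aeval (germCoord K 0 (torus_mem 0 w)) h) =
      specStalkMap (.of K[T;T⁻¹]) w (Polynomial.toLaurent h) := by
  unfold torus
  rw [Scheme.Hom.stalkMap_comp]
  refine (congrArg ((Spec.map _).stalkMap w)
    (stalkMap_aeval_chartSection (chart K 0) (chart_over K 0) (q := Spec.map _ w)
      (torus_mem 0 w) h)).trans ?_
  exact congr($(specStalkMap_stalkMap_specMap (CommRingCat.ofHom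
    (Polynomial.toLaurentAlg (R := K)).toRingHom) w) h)

lemma torus_comp {r : K[T;T⁻¹]} (hf : IsGivenBy f r) : torus K ≫ f =
    Spec.map (CommRingCat.ofHom (Polynomial.aeval (R := K) r).toRingHom) ≫ chart K 0 :=
  (Category.assoc _ _ _).trans hf

lemma apply_torus_mem {r : K[T;T⁻¹]} (hf : IsGivenBy f r) (w : Spec (.of K[T;T⁻¹])) :
    f (torus K w) ∈ chartOpen K 0 := by
  change (torus K ≫ f) w ∈ _
  rw [torus_comp hf]
  exact ⟨_, trivial, rfl⟩

lemma apply_genericPoint_mem {r : K[T;T⁻¹]} (hf : IsGivenBy f r) :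
    f (genericPoint (P1 K)) ∈ chartOpen K 0 :=
  image_genericPoint_mem f (apply_torus_mem hf
    (Nonempty.some (inferInstanceAs (Nonempty (PrimeSpectrum K[T;T⁻¹])))))

lemma torus_stalkMap_stalkMap {r : K[T;T⁻¹]} (hf : IsGivenBy f r) (w : Spec (.of K[T;T⁻¹])) :
    (torus K).stalkMap w (f.stalkMap (torus K w) (germCoord K 0 (apply_torus_mem hf w))) =
      specStalkMap (.of K[T;T⁻¹]) w r := by
  have h : (torus K ≫ f).stalkMap w = f.stalkMap (torus K w) ≫ (torus K).stalkMap w :=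
    Scheme.Hom.stalkMap_comp _ _ _
  refine (congr($h (germCoord K 0 (apply_torus_mem hf w)))).symm.trans ?_
  refine (stalkMap_germ_congr (torus_comp hf) _ _ (by
    rw [← torus_comp hf]; exact apply_torus_mem hf w)).trans ?_
  refine (stalkMap_germ_comp _ 0 _).trans ?_
  congr 1
  exact aeval_X _

/-- The pullback of the coordinate of the target. -/
def pulledCoord (h : f (genericPoint (P1 K)) ∈ chartOpen K 0) : (P1 K).functionField :=
  f.stalkMap (genericPoint (P1 K)) (germCoord K 0 h)

lemma algebraMap_stalkMap {i : Fin 2} {z : P1 K} (hz : f z ∈ chartOpen K i)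
    (hη : f (genericPoint (P1 K)) ∈ chartOpen K i) :
    algebraMap _ (P1 K).functionField (f.stalkMap z (germCoord K i hz)) =
      f.stalkMap (genericPoint (P1 K)) (germCoord K i hη) := by
  refine (Scheme.Hom.stalkSpecializes_stalkMap_apply f _ _
    ((genericPoint_spec (P1 K)).specializes trivial) _).symm.trans ?_
  congr 1
  exact congr($(TopCat.Presheaf.germ_stalkSpecializes (P1 K).presheaf hz
    (((genericPoint_spec (P1 K)).specializes trivial).map f.continuous))
    (chartSection (chart K i)))

/-- The equation `y ρ = a - y ^ p` is read off on the torus. The local generators, the section `df`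
and the degree are all computed from it. -/
lemma affineCoord_mul_pulledCoord
    (hf : IsGivenBy f (LaurentPolynomial.C a * T (-1) - T ((p : ℤ) - 1))) :
    affineCoord K 0 * pulledCoord (apply_genericPoint_mem hf) =
      algebraMap K _ a - affineCoord K 0 ^ p := by
  let w : Spec (.of K[T;T⁻¹]) := Nonempty.some (inferInstanceAs (Nonempty (PrimeSpectrum K[T;T⁻¹])))
  have h : germCoord K 0 (torus_mem 0 w) *
      f.stalkMap (torus K w) (germCoord K 0 (apply_torus_mem hf w)) =
      aeval (germCoord K 0 (torus_mem 0 w)) (Polynomial.C a - X ^ p) := by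
    apply torus_stalkMap_injective
    rw [map_mul, torus_stalkMap_germCoord_zero, torus_stalkMap_stalkMap hf, torus_stalkMap_aeval,
      ← map_mul]
    congr 1
    simp only [map_sub, map_pow, Polynomial.toLaurent_C, Polynomial.toLaurent_X, T_pow, mul_sub]
    rw [mul_left_comm, ← T_add, ← T_add]
    simp
  have h' := congrArg (algebraMap _ (P1 K).functionField) h
  rw [map_mul, algebraMap_germCoord, algebraMap_aeval_germCoord,
    algebraMap_stalkMap _ (apply_genericPoint_mem hf)] at h'
  exact h'.trans (by simp)

lemma pulledCoord_mul (h0 : f (genericPoint (P1 K)) ∈ chartOpen K 0)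
    (h1 : f (genericPoint (P1 K)) ∈ chartOpen K 1) :
    pulledCoord h0 * f.stalkMap (genericPoint (P1 K)) (germCoord K 1 h1) = 1 := by
  rw [pulledCoord, ← map_mul, germCoord_mul, map_one]

variable [f.IsOver (pt K)]

variable (f) in
/-- A trivialization of the pullback of the cotangent bundle at the generic point. -/
def IsPullbackFrame (h0 : f (genericPoint (P1 K)) ∈ chartOpen K 0)
    (e : (pullbackCotangent K f).generic ≃ₗ[(P1 K).functionField] (P1 K).functionField) : Prop :=
  letI := imageAlgebra f
  e ((1 : (P1 K).functionField) ⊗ₜ[ImageStalk f]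
    KaehlerDifferential.D K (ImageStalk f) (germCoord K 0 h0)) = 1

variable {e : (pullbackCotangent K f).generic ≃ₗ[(P1 K).functionField] (P1 K).functionField}

lemma hasGenerator_pullbackCotangent_zero (h0 : f (genericPoint (P1 K)) ∈ chartOpen K 0)
    (he : IsPullbackFrame f h0 e) {z : P1 K} (hz : f z ∈ chartOpen K 0) :
    (pullbackCotangent K f).HasGenerator e z 1 :=
  (hasGenerator_pullbackCotangent f (chart K 0) (chart_over K 0) hz e).of_eq he

/-- The coordinates of the target satisfy `x₁ = x₀⁻¹`, so `dx₁ = -x₁ ^ 2 dx₀`. The sign is a unit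
and can be dropped. -/
lemma hasGenerator_pullbackCotangent_one (h0 : f (genericPoint (P1 K)) ∈ chartOpen K 0)
    (he : IsPullbackFrame f h0 e) {z : P1 K} (hz : f z ∈ chartOpen K 1) :
    (pullbackCotangent K f).HasGenerator e z ((pulledCoord h0)⁻¹ ^ 2) := by
  let := imageAlgebra f
  have h := hasGenerator_pullbackCotangent f (chart K 1) (chart_over K 1) hz e
  have h1 := image_genericPoint_mem f hz
  set x0 : ImageStalk f := germCoord K 0 h0 with hx0
  set x1 : ImageStalk f := germCoord K 1 h1 with hx1
  have hmul : x0 * x1 = 1 := germCoord_mul h0 h1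
  have hD : KaehlerDifferential.D K (ImageStalk f) x1 =
      (-x1 ^ 2) • KaehlerDifferential.D K (ImageStalk f) x0 :=
    Derivation.leibniz_of_mul_eq_one _ (by rw [mul_comm, hmul])
  have hρ : f.stalkMap (genericPoint (P1 K)) x1 = (pulledCoord h0)⁻¹ :=
    eq_inv_of_mul_eq_one_right (pulledCoord_mul h0 h1)
  have he1 : e ((1 : (P1 K).functionField) ⊗ₜ[ImageStalk f]
      KaehlerDifferential.D K (ImageStalk f) x1) = -((pulledCoord h0)⁻¹ ^ 2) := by
    have h3 : (1 : (P1 K).functionField) ⊗ₜ[ImageStalk f]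
        KaehlerDifferential.D K (ImageStalk f) x1 = (-((pulledCoord h0)⁻¹ ^ 2)) •
        ((1 : (P1 K).functionField) ⊗ₜ[ImageStalk f] KaehlerDifferential.D K (ImageStalk f) x0) := by
      rw [hD, TensorProduct.tmul_smul, TensorProduct.smul_tmul', Algebra.smul_def,
        TensorProduct.smul_tmul', smul_eq_mul, ← hρ]
      congr 2
      change f.stalkMap _ (-x1 ^ 2) = _
      rw [map_neg, map_pow]
    refine (congrArg e h3).trans ((map_smul e _ _).trans ?_)
    rw [show e _ = 1 from he, smul_eq_mul, mul_one]
  exact (h.of_eq he1).of_isUnit (v := -1) isUnit_one.neg (by simp)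

end RationalMap

/-! ### Line bundles generated by powers of `y`. -/

section Twists

variable (K : Type u) [Field K]

lemma exists_isUnit_zpow {Y : Scheme.{u}} [IsIntegral Y] {z : Y} {v : Y.presheaf.stalk z}
    (hv : IsUnit v) (n : ℤ) : ∃ v' : Y.presheaf.stalk z, IsUnit v' ∧
      algebraMap _ Y.functionField v' = algebraMap _ Y.functionField v ^ n := by
  obtain ⟨v, rfl⟩ := hv
  refine ⟨(v ^ n : (Y.presheaf.stalk z)ˣ), (v ^ n).isUnit, ?_⟩
  have h := congrArg Units.val
    (map_zpow (Units.map (algebraMap (Y.presheaf.stalk z) Y.functionField).toMonoidHom) v n)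
  rw [Units.val_zpow_eq_zpow_val] at h
  exact h

lemma span_singleton_mul_of_isUnit {Y : Scheme.{u}} [IsIntegral Y] {z : Y}
    {v : Y.presheaf.stalk z} (hv : IsUnit v) {α β : Y.functionField}
    (h : β = algebraMap _ Y.functionField v * α) :
    Submodule.span (localRing Y z) {β} = Submodule.span (localRing Y z) {α} := by
  obtain ⟨i, hi⟩ := hv.exists_right_inv
  have hi' := congrArg (algebraMap _ Y.functionField) hi
  rw [map_mul, map_one] at hi'
  refine le_antisymm ?_ ?_ <;> rw [Submodule.span_singleton_le_iff_mem, mem_span_localRing]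
  · exact ⟨v, h⟩
  · refine ⟨i, ?_⟩
    rw [smul_eq_mul, h]
    linear_combination -α * hi'

open Classical in
/-- The function which is `y ^ a` on the chart `0` and `y ^ b` at infinity. -/
def twist (a b : ℤ) (z : P1 K) : (P1 K).functionField :=
  if z ∈ chartOpen K 0 then affineCoord K 0 ^ a else affineCoord K 0 ^ b

variable {K}

lemma twist_of_mem (a b : ℤ) {z : P1 K} (hz : z ∈ chartOpen K 0) :
    twist K a b z = affineCoord K 0 ^ a := if_pos hz

lemma twist_infinity (a b : ℤ) : twist K a b (infinity K) = affineCoord K 0 ^ b :=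
  if_neg (infinity_notMem K)

lemma twist_mul (a b a' b' : ℤ) (z : P1 K) :
    twist K a b z * twist K a' b' z = twist K (a + a') (b + b') z := by
  have h := affineCoord_ne_zero K 0
  unfold twist
  split_ifs <;> rw [zpow_add₀ h]

lemma twist_div (a b a' b' : ℤ) (z : P1 K) :
    twist K a b z / twist K a' b' z = twist K (a - a') (b - b') z := by
  have h := affineCoord_ne_zero K 0
  unfold twist
  split_ifs <;> rw [zpow_sub₀ h]

lemma twist_zero (z : P1 K) : twist K 0 0 z = 1 := by
  unfold twist
  split_ifs <;> exact zpow_zero _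

lemma twist_ne_zero (a b : ℤ) (z : P1 K) : twist K a b z ≠ 0 := by
  unfold twist
  split_ifs <;> exact zpow_ne_zero _ (affineCoord_ne_zero K 0)

variable (K) in
/-- The line bundle with the generators `twist a b`. -/
def twistSheaf (a b : ℤ) : StalkSheaf (P1 K) where
  generic := (P1 K).functionField
  stalk z := Submodule.span (localRing (P1 K) z) {twist K a b z}

lemma hasGenerator_twistSheaf (a b : ℤ) (z : P1 K) : (twistSheaf K a b).HasGenerator
    (LinearEquiv.refl (P1 K).functionField (P1 K).functionField) z (twist K a b z) :=
  StalkSheaf.hasGenerator_iff.2 rfl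

/-- Near infinity the single function `y ^ b` generates on the whole chart `1`: on the overlap with
the chart `0` the function `y` is a unit, so `y ^ a` and `y ^ b` generate the same stalk. -/
lemma isLineBundle_twistSheaf (a b : ℤ) : (twistSheaf K a b).IsLineBundle := by
  refine ⟨Module.finrank_self _, fun z => ?_⟩
  by_cases hz : z ∈ chartOpen K 0
  · refine ⟨chartOpen K 0, hz, affineCoord K 0 ^ a, zpow_ne_zero _ (affineCoord_ne_zero K 0),
      fun w hw => ?_⟩
    change Submodule.span _ {twist K a b w} = _
    rw [twist_of_mem a b hw]
    rfl
  · obtain rfl := eq_infinity hz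
    refine ⟨chartOpen K 1, infinity_mem K, affineCoord K 0 ^ b,
      zpow_ne_zero _ (affineCoord_ne_zero K 0), fun w hw => ?_⟩
    by_cases hw' : w ∈ chartOpen K 0
    · obtain ⟨v, hv, hv'⟩ := exists_isUnit_zpow (IsUnit.of_mul_eq_one _ (germCoord_mul hw' hw)) (b - a)
      rw [algebraMap_germCoord] at hv'
      have h1 : affineCoord K 0 ^ b = algebraMap _ (P1 K).functionField v * affineCoord K 0 ^ a := by
        rw [hv', ← zpow_add₀ (affineCoord_ne_zero K 0), sub_add_cancel]
      refine (congrArg (fun α : (P1 K).functionField => Submodule.span (localRing (P1 K) w) {α})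
        (twist_of_mem a b hw')).trans ?_
      exact (span_singleton_mul_of_isUnit hv h1).symm
    · obtain rfl := eq_infinity hw'
      change Submodule.span _ {twist K a b _} = _
      rw [twist_infinity]
      rfl

end Twists

/-! ### Generators of the cotangent bundles in terms of powers of `y`. -/

section Generators

variable {K : Type u} [Field K] {f : P1 K ⟶ P1 K} [f.IsOver (pt K)] {a : K} {p : ℕ}

lemma hasGenerator_cotangent_twist
    {e : Ω[(P1 K).functionField⁄K] ≃ₗ[(P1 K).functionField] (P1 K).functionField}
    (he : e (KaehlerDifferential.D K (P1 K).functionField (affineCoord K 0)) = 1) (z : P1 K) :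
    (cotangent K (P1 K)).HasGenerator e z (twist K 0 (-2) z) := by
  by_cases hz : z ∈ chartOpen K 0
  · refine (hasGenerator_cotangent (chart K 0) (chart_over K 0) hz e).of_eq ?_
    rw [twist_of_mem _ _ hz, zpow_zero, ← he]
    exact congrArg (fun x => e (KaehlerDifferential.D K _ x)) (algebraMap_germCoord K 0 hz)
  · obtain rfl := eq_infinity hz
    refine (hasGenerator_cotangent (chart K 1) (chart_over K 1) (infinity_mem K) e).of_isUnit
      (v := -1) isUnit_one.neg ?_
    have h1 : e (KaehlerDifferential.D K _ (algebraMap _ (P1 K).functionField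
        (germCoord K 1 (infinity_mem K)))) = - affineCoord K 1 ^ 2 := by
      rw [algebraMap_germCoord, Derivation.leibniz_of_mul_eq_one _
        ((mul_comm _ _).trans (affineCoord_mul (K := K))), map_smul, he, smul_eq_mul, mul_one]
    refine Eq.trans ?_ (congrArg (algebraMap _ _ (-1) * ·) h1.symm)
    rw [twist_infinity, affineCoord_one]
    simp [zpow_neg]

/-- The generator is `1` where `ρ` is regular and `ρ⁻²` where `ρ⁻¹` is regular. At `y = 0` the
product `y ρ` is a unit, so `ρ⁻²` may be replaced by `y ^ 2`; at other points of the chart `0` the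
function `y` itself is a unit. At infinity `u ^ (p - 1) ρ = a u ^ p - 1` is a unit, so `ρ` has a
pole of order `p - 1`. -/
lemma hasGenerator_pullbackCotangent_twist (ha : a ≠ 0) (hp : 2 ≤ p)
    (hf : IsGivenBy f (LaurentPolynomial.C a * T (-1) - T ((p : ℤ) - 1)))
    {e : (pullbackCotangent K f).generic ≃ₗ[(P1 K).functionField] (P1 K).functionField}
    (he : IsPullbackFrame f (apply_genericPoint_mem hf) e) (z : P1 K) :
    (pullbackCotangent K f).HasGenerator e z (twist K 2 (-2 * p + 2) z) := by
  set y := affineCoord K 0 with hy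
  have hy0 : y ≠ 0 := affineCoord_ne_zero K 0
  set ρ := pulledCoord (apply_genericPoint_mem hf) with hρ
  have hyρ : y * ρ = algebraMap K _ a - y ^ p := affineCoord_mul_pulledCoord hf
  have hreg0 (h : f z ∈ chartOpen K 0) : ∃ s : (P1 K).presheaf.stalk z,
      algebraMap _ (P1 K).functionField s = ρ := ⟨_, algebraMap_stalkMap h (apply_genericPoint_mem hf)⟩
  have hreg1 (h : f z ∈ chartOpen K 1) : ∃ s : (P1 K).presheaf.stalk z,
      algebraMap _ (P1 K).functionField s * ρ = 1 := by
    refine ⟨f.stalkMap z (germCoord K 1 h), ?_⟩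
    rw [algebraMap_stalkMap h (image_genericPoint_mem f h), mul_comm]
    exact pulledCoord_mul _ _
  have hgen0 (h : f z ∈ chartOpen K 0) := hasGenerator_pullbackCotangent_zero _ he h
  have hgen1 (h : f z ∈ chartOpen K 1) := hasGenerator_pullbackCotangent_one _ he h
  have hcases : f z ∈ chartOpen K 0 ∨ f z ∈ chartOpen K 1 := by
    by_cases h : f z ∈ chartOpen K 0
    · exact .inl h
    · exact .inr (eq_infinity h ▸ infinity_mem K)
  have hinj := algebraMap_functionField_injective z
  by_cases hz : z ∈ chartOpen K 0
  · obtain ⟨q, hq⟩ := mem_chartOpen.1 hz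
    rw [twist_of_mem _ _ hz, show (2 : ℤ) = ((2 : ℕ) : ℤ) from rfl, zpow_natCast]
    by_cases hX : X ∈ q.asIdeal
    · have hv : IsUnit (aeval (germCoord K 0 hz) (Polynomial.C a - X ^ p)) := by
        refine isUnit_aeval_germCoord hz hq fun h => ?_
        have h1 : Polynomial.C a ∈ q.asIdeal := by
          have := add_mem h (Ideal.pow_mem_of_mem _ hX p (by omega))
          rwa [sub_add_cancel] at this
        exact q.isPrime.ne_top (Ideal.eq_top_of_isUnit_mem _ h1 (Polynomial.isUnit_C.2 ha.isUnit))
      have hv' : algebraMap _ (P1 K).functionField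
          (aeval (germCoord K 0 hz) (Polynomial.C a - X ^ p)) = y * ρ := by
        rw [algebraMap_aeval_germCoord, hyρ]
        simp [y]
      -- If `ρ` were regular at `y = 0`, then `y` would divide the unit `a - y ^ p`.
      have h1 : f z ∈ chartOpen K 1 := by
        refine hcases.resolve_left fun h => ?_
        obtain ⟨s, hs⟩ := hreg0 h
        have h2 : germCoord K 0 hz * s = aeval (germCoord K 0 hz) (Polynomial.C a - X ^ p) := by
          apply hinj
          rw [hv', map_mul, algebraMap_germCoord, hs]
        have h3 := (aeval_germCoord_mem_iff hz hq X).2 hX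
        rw [aeval_X, IsLocalRing.mem_maximalIdeal, mem_nonunits_iff] at h3
        exact h3 (isUnit_of_mul_isUnit_left (h2 ▸ hv))
      obtain ⟨s, hs⟩ := hreg1 h1
      have hρ0 : ρ ≠ 0 := right_ne_zero_of_mul (hs.trans_ne one_ne_zero)
      refine (hgen1 h1).of_isUnit (hv.pow 2) ?_
      rw [map_pow, hv', mul_pow, mul_assoc, ← mul_pow, mul_inv_cancel₀ hρ0, one_pow, mul_one]
    · have hy1 : IsUnit (germCoord K 0 hz) := by
        have := isUnit_aeval_germCoord hz hq hX
        rwa [aeval_X] at this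
      obtain h1 | h1 := hcases
      · refine (hgen0 h1).of_isUnit (hy1.pow 2) ?_
        rw [map_pow, algebraMap_germCoord, mul_one]
      · obtain ⟨s, hs⟩ := hreg1 h1
        have hρ0 : ρ ≠ 0 := right_ne_zero_of_mul (hs.trans_ne one_ne_zero)
        -- With `y` a unit, `ρ = (a - y ^ p) / y` is regular as well, so its regular inverse `s` is
        -- a unit.
        have hs' : IsUnit s := by
          obtain ⟨i, hi⟩ := hy1.exists_right_inv
          refine IsUnit.of_mul_eq_one (i * aeval (germCoord K 0 hz) (Polynomial.C a - X ^ p)) ?_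
          apply hinj
          have hi' := congrArg (algebraMap _ (P1 K).functionField) hi
          rw [map_mul, algebraMap_germCoord, map_one] at hi'
          rw [map_mul, map_mul, algebraMap_aeval_germCoord, map_one]
          have h4 : aeval (affineCoord K 0) (Polynomial.C a - X ^ p) = y * ρ := by
            rw [hyρ]; simp [y]
          rw [h4]
          linear_combination hs + algebraMap _ (P1 K).functionField s * ρ * hi'
        obtain ⟨i, hi⟩ := hs'.exists_right_inv
        have hi1 : algebraMap _ (P1 K).functionField i = ρ := by
          have hi' := congrArg (algebraMap _ (P1 K).functionField) hi
          rw [map_mul, map_one] at hi'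
          linear_combination ρ * hi' - algebraMap _ (P1 K).functionField i * hs
        refine (hgen1 h1).of_isUnit ((hy1.mul (IsUnit.of_mul_eq_one_right _ hi)).pow 2) ?_
        rw [map_pow, map_mul, algebraMap_germCoord, hi1, mul_pow, mul_assoc, ← mul_pow,
          mul_inv_cancel₀ hρ0, one_pow, mul_one]
  · obtain rfl := eq_infinity hz
    set u := affineCoord K 1 with hu
    have hyu : y * u = 1 := affineCoord_mul
    obtain ⟨n, rfl⟩ : ∃ n, p = n + 1 := ⟨p - 1, by omega⟩
    have hv : IsUnit (aeval (germCoord K 1 (infinity_mem K)) (Polynomial.C a * X ^ (n + 1) - 1)) := by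
      refine isUnit_aeval_germCoord (infinity_mem K) rfl fun h => ?_
      have h1 : (1 : K[X]) ∈ Ideal.span {(X : K[X])} := by
        have h2 : Polynomial.C a * X ^ (n + 1) ∈ Ideal.span {(X : K[X])} :=
          Ideal.mul_mem_left _ _ (Ideal.pow_mem_of_mem _ (Ideal.mem_span_singleton_self _) _
            n.succ_pos)
        have := sub_mem h2 h
        rwa [sub_sub_cancel] at this
      exact prime_X.not_isUnit (Ideal.span_singleton_eq_top.1 ((Ideal.eq_top_iff_one _).2 h1))
    have hv' : algebraMap _ (P1 K).functionField
        (aeval (germCoord K 1 (infinity_mem K)) (Polynomial.C a * X ^ (n + 1) - 1)) = u ^ n * ρ := by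
      rw [algebraMap_aeval_germCoord]
      simp only [map_sub, map_mul, map_pow, aeval_C, aeval_X, map_one]
      have h1 : y ^ (n + 1) * u ^ (n + 1) = 1 := by rw [← mul_pow, hyu, one_pow]
      linear_combination u ^ n * ρ * (hyu) - u ^ (n + 1) * hyρ + h1
    have h1 : f (infinity K) ∈ chartOpen K 1 := by
      refine hcases.resolve_left fun h => ?_
      obtain ⟨s, hs⟩ := hreg0 h
      have h2 : germCoord K 1 (infinity_mem K) ^ n * s =
          aeval (germCoord K 1 (infinity_mem K)) (Polynomial.C a * X ^ (n + 1) - 1) := by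
        apply hinj
        rw [hv', map_mul, map_pow, algebraMap_germCoord, hs]
      have h3 := (aeval_germCoord_mem_iff (infinity_mem K) rfl X).2 (Ideal.mem_span_singleton_self X)
      rw [aeval_X, IsLocalRing.mem_maximalIdeal, mem_nonunits_iff] at h3
      exact h3 ((isUnit_pow_iff (by omega)).1 (isUnit_of_mul_isUnit_left (h2 ▸ hv)))
    obtain ⟨s, hs⟩ := hreg1 h1
    have hρ0 : ρ ≠ 0 := right_ne_zero_of_mul (hs.trans_ne one_ne_zero)
    refine (hgen1 h1).of_isUnit (hv.pow 2) ?_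
    rw [map_pow, hv', mul_pow, mul_assoc, ← mul_pow, mul_inv_cancel₀ hρ0, one_pow, mul_one,
      twist_infinity, hu, affineCoord_one, ← pow_mul, inv_pow, ← zpow_natCast, ← zpow_neg]
    congr 1
    push_cast
    ring

end Generators

/-! ### The relative orientation and the zeros of `df`. -/

section Orientation

variable {K : Type u} [Field K] {f : P1 K ⟶ P1 K} [f.IsOver (pt K)] {a : K} {p : ℕ}
  {eΩ : Ω[(P1 K).functionField⁄K] ≃ₗ[(P1 K).functionField] (P1 K).functionField}
  {eP : (pullbackCotangent K f).generic ≃ₗ[(P1 K).functionField] (P1 K).functionField}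

/-- The trivialization of the tangent bundle at the generic point. -/
def tangentEquiv (eΩ : Ω[(P1 K).functionField⁄K] ≃ₗ[(P1 K).functionField] (P1 K).functionField) :
    (tangent K (P1 K)).generic ≃ₗ[(P1 K).functionField] (P1 K).functionField :=
  StalkSheaf.homEquiv (A := cotangent K (P1 K)) (B := StalkSheaf.structureSheaf (P1 K)) eΩ
    (LinearEquiv.refl (P1 K).functionField (P1 K).functionField)

/-- The trivialization of `Hom (f^* T^∨ X, T^∨ Y)` at the generic point. -/
def diffEquiv (eΩ : Ω[(P1 K).functionField⁄K] ≃ₗ[(P1 K).functionField] (P1 K).functionField)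
    (eP : (pullbackCotangent K f).generic ≃ₗ[(P1 K).functionField] (P1 K).functionField) :
    (diffBundle K f).generic ≃ₗ[(P1 K).functionField] (P1 K).functionField :=
  StalkSheaf.homEquiv (A := pullbackCotangent K f) (B := cotangent K (P1 K)) eP eΩ

lemma hasGenerator_tangent
    (he : eΩ (KaehlerDifferential.D K (P1 K).functionField (affineCoord K 0)) = 1) (z : P1 K) :
    (tangent K (P1 K)).HasGenerator (tangentEquiv eΩ) z (twist K 0 2 z) := by
  have h := (hasGenerator_cotangent_twist he z).hom
    (StalkSheaf.hasGenerator_structureSheaf (z := z)) (twist_ne_zero _ _ _)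
  refine StalkSheaf.HasGenerator.of_eq h ?_
  rw [← twist_zero z, twist_div]
  norm_num

lemma hasGenerator_diffBundle (ha : a ≠ 0) (hp : 2 ≤ p)
    (hf : IsGivenBy f (LaurentPolynomial.C a * T (-1) - T ((p : ℤ) - 1)))
    (he : eΩ (KaehlerDifferential.D K (P1 K).functionField (affineCoord K 0)) = 1)
    (he' : IsPullbackFrame f (apply_genericPoint_mem hf) eP) (z : P1 K) :
    (diffBundle K f).HasGenerator (diffEquiv eΩ eP) z (twist K (-2) (2 * p - 4) z) := by
  have h := (hasGenerator_pullbackCotangent_twist ha hp hf he' z).hom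
    (hasGenerator_cotangent_twist he z) (twist_ne_zero _ _ _)
  refine StalkSheaf.HasGenerator.of_eq h ?_
  rw [twist_div]
  congr 1
  ring

/-- The relative orientation given by the line bundle with generator `y⁻¹` on the chart `0` and
`y ^ (p - 3)` at infinity. -/
def orientation (ha : a ≠ 0) (hp : 2 ≤ p)
    (hf : IsGivenBy f (LaurentPolynomial.C a * T (-1) - T ((p : ℤ) - 1)))
    (he : eΩ (KaehlerDifferential.D K (P1 K).functionField (affineCoord K 0)) = 1)
    (he' : IsPullbackFrame f (apply_genericPoint_mem hf) eP) :
    RelativeOrientation K (diffBundle K f) where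
  M := twistSheaf K (-1) (p - 3)
  isLineBundle := isLineBundle_twistSheaf _ _
  iso := StalkSheaf.isoOfHasGenerator
    (StalkSheaf.homEquiv (A := tangent K (P1 K)) (B := diffBundle K f) (tangentEquiv eΩ)
      (diffEquiv eΩ eP))
    (StalkSheaf.tensorEquiv (A := twistSheaf K (-1) (p - 3)) (B := twistSheaf K (-1) (p - 3))
      (LinearEquiv.refl (P1 K).functionField (P1 K).functionField)
      (LinearEquiv.refl (P1 K).functionField (P1 K).functionField)) fun z => by
    refine ⟨_, (hasGenerator_tangent he z).hom (hasGenerator_diffBundle ha hp hf he he' z)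
      (twist_ne_zero _ _ _), ?_⟩
    refine ((hasGenerator_twistSheaf (-1) (p - 3) z).tensor
      (hasGenerator_twistSheaf (-1) (p - 3) z)).of_eq ?_
    rw [twist_div, twist_mul]
    congr 1
    ring

lemma diffEquiv_differential [CharP K p]
    (hf : IsGivenBy f (LaurentPolynomial.C a * T (-1) - T ((p : ℤ) - 1)))
    (he : eΩ (KaehlerDifferential.D K (P1 K).functionField (affineCoord K 0)) = 1)
    (he' : IsPullbackFrame f (apply_genericPoint_mem hf) eP) :
    diffEquiv eΩ eP (differential K f) =
      (affineCoord K 0 ^ p - algebraMap K _ a) * affineCoord K 0 ^ (-2 : ℤ) := by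
  set y := affineCoord K 0 with hy
  have hy0 : y ≠ 0 := affineCoord_ne_zero K 0
  set ρ := pulledCoord (apply_genericPoint_mem hf) with hρ
  have hyρ : y * ρ = algebraMap K _ a - y ^ p := affineCoord_mul_pulledCoord hf
  have h1 : diffEquiv eΩ eP (differential K f) =
      eΩ (KaehlerDifferential.D K (P1 K).functionField ρ) := by
    let := imageAlgebra f
    have : IsScalarTower K (ImageStalk f) (P1 K).functionField :=
      .of_algebraMap_eq fun c => (stalkMap_algebraMap K f _ c).symm
    have h2 : eP.symm 1 = (1 : (P1 K).functionField) ⊗ₜ[ImageStalk f]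
        KaehlerDifferential.D K (ImageStalk f) (germCoord K 0 (apply_genericPoint_mem hf)) :=
      (LinearEquiv.symm_apply_eq eP).2 (Eq.symm he')
    change eΩ (KaehlerDifferential.mapBaseChange K (ImageStalk f) (P1 K).functionField
      (eP.symm 1)) = _
    rw [h2, KaehlerDifferential.mapBaseChange_tmul, one_smul, KaehlerDifferential.map_D]
    rfl
  have : CharP (P1 K).functionField p := charP_of_injective_algebraMap' K p
  have h3 := congrArg (fun x => eΩ (KaehlerDifferential.D K (P1 K).functionField x)) hyρ
  simp only [Derivation.leibniz, map_add, map_smul, map_sub, Derivation.map_algebraMap, he,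
    Derivation.leibniz_pow, smul_eq_mul, mul_one] at h3
  -- The term `p y ^ (p - 1) dy` vanishes in characteristic `p`, leaving `y dρ + ρ dy = 0`.
  rw [← Nat.cast_smul_eq_nsmul (P1 K).functionField, CharP.cast_eq_zero, zero_smul, map_zero,
    sub_zero] at h3
  rw [h1, zpow_neg, ← div_eq_mul_inv, eq_div_iff (zpow_ne_zero _ hy0),
    show (2 : ℤ) = ((2 : ℕ) : ℤ) from rfl, zpow_natCast]
  linear_combination y * h3 - hyρ

lemma vanishesAt_chart_zero_iff [CharP K p] (ha : a ≠ 0) (hp : 2 ≤ p)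
    (hf : IsGivenBy f (LaurentPolynomial.C a * T (-1) - T ((p : ℤ) - 1)))
    (he : eΩ (KaehlerDifferential.D K (P1 K).functionField (affineCoord K 0)) = 1)
    (he' : IsPullbackFrame f (apply_genericPoint_mem hf) eP) (q : PrimeSpectrum K[X]) :
    (diffBundle K f).VanishesAt (differential K f) (chart K 0 q) ↔
      X ^ p - Polynomial.C a ∈ q.asIdeal := by
  have hz : chart K 0 q ∈ chartOpen K 0 := mem_chartOpen.2 ⟨q, rfl⟩
  rw [(hasGenerator_diffBundle ha hp hf he he' _).vanishesAt_iff,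
    diffEquiv_differential hf he he', twist_of_mem _ _ hz, ← aeval_germCoord_mem_iff hz rfl]
  have h0 : affineCoord K 0 ^ (-2 : ℤ) ≠ 0 := zpow_ne_zero _ (affineCoord_ne_zero K 0)
  have h1 : algebraMap _ (P1 K).functionField (aeval (germCoord K 0 hz) (X ^ p - Polynomial.C a)) =
      affineCoord K 0 ^ p - algebraMap K _ a := by
    rw [algebraMap_aeval_germCoord]
    simp
  rw [← h1]
  constructor
  · rintro ⟨r, hr, h⟩
    rwa [algebraMap_functionField_injective _ (mul_right_cancel₀ h0 h)]
  · exact fun h => ⟨_, h, rfl⟩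

/-- The section `df` in terms of the coordinate at infinity. -/
lemma differential_infinity {m : ℕ} (hp : p = m + 2) :
    (affineCoord K 0 ^ p - algebraMap K _ a) * affineCoord K 0 ^ (-2 : ℤ) =
      algebraMap _ (P1 K).functionField (germCoord K 1 (infinity_mem K) ^ m *
        (1 - algebraMap K _ a * germCoord K 1 (infinity_mem K) ^ p)) *
        affineCoord K 0 ^ (2 * p - 4 : ℤ) := by
  have hy0 : affineCoord K 0 ≠ 0 := affineCoord_ne_zero K 0
  rw [map_mul, map_sub, map_mul, map_pow, map_pow, algebraMap_germCoord, map_one, affineCoord_one,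
    ← IsScalarTower.algebraMap_apply]
  have h1 : affineCoord K 0 ^ (2 * p - 4 : ℤ) = affineCoord K 0 ^ m * affineCoord K 0 ^ p *
      affineCoord K 0 ^ (-2 : ℤ) := by
    rw [← zpow_natCast, ← zpow_natCast, ← zpow_add₀ hy0, ← zpow_add₀ hy0]
    congr 1
    subst hp
    push_cast
    ring
  rw [h1, inv_pow, inv_pow]
  field_simp

/-- The exponent `p - 2` of the coordinate at infinity is positive because `p ≥ 3`. -/
lemma vanishesAt_infinity [CharP K p] (ha : a ≠ 0) (hp : 3 ≤ p)
    (hf : IsGivenBy f (LaurentPolynomial.C a * T (-1) - T ((p : ℤ) - 1)))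
    (he : eΩ (KaehlerDifferential.D K (P1 K).functionField (affineCoord K 0)) = 1)
    (he' : IsPullbackFrame f (apply_genericPoint_mem hf) eP) :
    (diffBundle K f).VanishesAt (differential K f) (infinity K) := by
  rw [(hasGenerator_diffBundle ha (by omega) hf he he' _).vanishesAt_iff,
    diffEquiv_differential hf he he', twist_infinity]
  refine ⟨_, ?_, differential_infinity (m := p - 2) (by omega)⟩
  have h := (aeval_germCoord_mem_iff (infinity_mem K) rfl X).2 (Ideal.mem_span_singleton_self X)
  rw [aeval_X] at h
  exact Ideal.mul_mem_right _ _ (Ideal.pow_mem_of_mem _ h _ (by omega))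

/-- The zeros of `df`. -/
lemma setOf_vanishesAt [CharP K p] (ha : a ≠ 0) (hp : 3 ≤ p)
    (hf : IsGivenBy f (LaurentPolynomial.C a * T (-1) - T ((p : ℤ) - 1)))
    (he : eΩ (KaehlerDifferential.D K (P1 K).functionField (affineCoord K 0)) = 1)
    (he' : IsPullbackFrame f (apply_genericPoint_mem hf) eP)
    (hirr : Irreducible (X ^ p - Polynomial.C a : K[X])) {q : PrimeSpectrum K[X]}
    (hq : q.asIdeal = Ideal.span {X ^ p - Polynomial.C a}) :
    {z | (diffBundle K f).VanishesAt (differential K f) z} = {chart K 0 q, infinity K} := by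
  ext z
  rw [Set.mem_ofPred_eq, Set.mem_insert_iff, Set.mem_singleton_iff]
  by_cases hz : z ∈ chartOpen K 0
  · obtain ⟨q', rfl⟩ := mem_chartOpen.1 hz
    have h1 : chart K 0 q' ≠ infinity K := fun h => infinity_notMem K (h ▸ hz)
    rw [vanishesAt_chart_zero_iff ha (by omega) hf he he', or_iff_left h1]
    constructor
    · intro h
      congr 1
      refine PrimeSpectrum.ext (x := q') ?_
      have hmax := PrincipalIdealRing.isMaximal_of_irreducible hirr
      rw [hq]
      exact (hmax.eq_of_le q'.isPrime.ne_top ((Ideal.span_singleton_le_iff_mem _).2 h)).symm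
    · intro h
      rw [(chart K 0).injective h, hq]
      exact Ideal.mem_span_singleton_self _
  · obtain rfl := eq_infinity hz
    exact iff_of_true (vanishesAt_infinity ha hp hf he he') (.inr rfl)

/-- The local indices with respect to the orientation. -/
lemma isLocalIndex_orientation [CharP K p] (ha : a ≠ 0) (hp : 2 ≤ p)
    (hf : IsGivenBy f (LaurentPolynomial.C a * T (-1) - T ((p : ℤ) - 1)))
    (he : eΩ (KaehlerDifferential.D K (P1 K).functionField (affineCoord K 0)) = 1)
    (he' : IsPullbackFrame f (apply_genericPoint_mem hf) eP)
    {i : Fin 2} {z : P1 K} (hz : z ∈ chartOpen K i) {q : PrimeSpectrum K[X]}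
    (hq : chart K i q = z) {π : K[X]} {m k : ℕ} {b : K} (hk : k ≠ 0)
    (hP : q.asIdeal = Ideal.span {π}) (hG : π ^ k = X ^ (m + 1) - Polynomial.C b)
    {w m₀ : (P1 K).functionField}
    (hw : w * eΩ (KaehlerDifferential.D K (P1 K).functionField (affineCoord K i)) = 1)
    (hm₀ : twist K (-1) (p - 3) z = m₀)
    (hs : (diffBundle K f).HasGenerator (diffEquiv eΩ eP) z (m₀ * m₀ * w))
    {c : Kˣ} {e : (P1 K).presheaf.stalk z}
    (hσ : (affineCoord K 0 ^ p - algebraMap K _ a) * affineCoord K 0 ^ (-2 : ℤ) =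
      algebraMap _ (P1 K).functionField (algebraMap K _ c * aeval (germCoord K i hz) (π ^ k) *
        (1 + aeval (germCoord K i hz) (π ^ k) * e)) * (m₀ * m₀ * w)) (α : GW K) :
    IsLocalIndex (orientation ha hp hf he he') (differential K f) z α ↔
      α = GW.mk (antidiagonal (m + 1) c⁻¹) := by
  have hw0 : w ≠ 0 := left_ne_zero_of_mul (hw.trans_ne one_ne_zero)
  have hm₀0 : m₀ ≠ 0 := hm₀ ▸ twist_ne_zero _ _ _
  have hD0 := right_ne_zero_of_mul (hw.trans_ne one_ne_zero)
  -- In the generic trivializations the dual basis of `dx` is `w` and the homomorphism corresponding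
  -- to `m₀ ⊗ m₀` is `m₀ ^ 2`. So the compatible generator is `m₀ ^ 2 w`.
  refine isLocalIndex_iff (orientation ha hp hf he he') hz
    (isNisnevichCoordinate_chartSection (chart K i) (chart_over K i) hz)
    (isLocalization_germCoord K hz hq) hk hP hG (s := (diffEquiv eΩ eP).symm (m₀ * m₀ * w))
    (m₀ := m₀) (τ := w • eΩ.toLinearMap)
    (E := (StalkSheaf.homEquiv (A := tangent K (P1 K)) (B := diffBundle K f) (tangentEquiv eΩ)
      (diffEquiv eΩ eP)).symm (m₀ * m₀)) (c := c) (e := e) ?_ ?_ ?_ ?_ ?_ ?_ ?_ ?_ α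
  · intro ω
    refine ⟨eΩ ω * w, eΩ.injective ?_⟩
    change _ = eΩ (_ • KaehlerDifferential.D K _ (algebraMap _ _ (germCoord K i hz)))
    rw [map_smul, algebraMap_germCoord, smul_eq_mul, mul_assoc, hw, mul_one]
  · rw [Ne, LinearEquiv.map_eq_zero_iff]
    exact mul_ne_zero (mul_ne_zero hm₀0 hm₀0) hw0
  · exact StalkSheaf.hasGenerator_iff.1 hs
  · exact hm₀ ▸ rfl
  · change w * eΩ (KaehlerDifferential.D K _ (algebraMap _ _ (germCoord K i hz))) = 1
    rw [algebraMap_germCoord, hw]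
  · refine (StalkSheaf.homEquiv_symm_apply (A := tangent K (P1 K)) (B := diffBundle K f) _ _).trans ?_
    congr 2
    change w * eΩ (eΩ.symm 1) = w
    rw [LinearEquiv.apply_symm_apply, mul_one]
  · refine (congrArg (StalkSheaf.tensorEquiv (A := twistSheaf K (-1) (p - 3))
      (B := twistSheaf K (-1) (p - 3))
      (LinearEquiv.refl (P1 K).functionField (P1 K).functionField)
      (LinearEquiv.refl (P1 K).functionField (P1 K).functionField)).symm
        (LinearEquiv.apply_symm_apply _ _)).trans ?_
    refine (LinearEquiv.symm_apply_eq _).2 ?_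
    exact (StalkSheaf.tensorEquiv_tmul (A := twistSheaf K (-1) (p - 3))
      (B := twistSheaf K (-1) (p - 3))
      (eA := LinearEquiv.refl (P1 K).functionField (P1 K).functionField)
      (eB := LinearEquiv.refl (P1 K).functionField (P1 K).functionField) m₀ m₀).symm
  · refine (diffEquiv eΩ eP).injective (Eq.trans ?_ (map_smul (diffEquiv eΩ eP) _ _).symm)
    rw [diffEquiv_differential hf he he', hσ, LinearEquiv.apply_symm_apply]
    rfl

end Orientation

/-! ### The genus of the projective line. -/

section Genus

variable {K : Type u} [Field K]

/-- A rational function which is regular on the affine line is a polynomial. -/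
lemma exists_polynomial_of_regular (g : (P1 K).functionField)
    (hg : ∀ z ∈ chartOpen K 0, ∃ r : (P1 K).presheaf.stalk z, g = algebraMap _ _ r) :
    ∃ h : K[X], g = aeval (affineCoord K 0) h := by
  -- This is the ideal of denominators of `g`. If it were proper, regularity at the point of a
  -- maximal ideal above it would give a denominator outside that ideal.
  let I : Ideal K[X] :=
    { carrier := {s | ∃ h : K[X], g * aeval (affineCoord K 0) s = aeval (affineCoord K 0) h}
      add_mem' := fun ⟨h, hh⟩ ⟨h', hh'⟩ => ⟨h + h', by rw [map_add, mul_add, hh, hh', map_add]⟩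
      zero_mem' := ⟨0, by simp⟩
      smul_mem' := fun c s ⟨h, hh⟩ => ⟨c * h, by
        rw [smul_eq_mul, map_mul, mul_left_comm, hh, map_mul]⟩ }
  by_cases hI : I = ⊤
  · obtain ⟨h, hh⟩ := (Ideal.eq_top_iff_one I).1 hI
    exact ⟨h, by simpa using hh⟩
  · obtain ⟨𝔪, hm, hIm⟩ := Ideal.exists_le_maximal I hI
    let q : PrimeSpectrum K[X] := ⟨𝔪, hm.isPrime⟩
    have hz : chart K 0 q ∈ chartOpen K 0 := mem_chartOpen.2 ⟨q, rfl⟩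
    obtain ⟨r, rfl⟩ := hg _ hz
    let := (aeval (R := K) (germCoord K 0 hz)).toRingHom.toAlgebra
    have := isLocalization_germCoord K hz rfl
    obtain ⟨⟨h, s⟩, hs⟩ := IsLocalization.surj q.asIdeal.primeCompl r
    have hs' : r * aeval (germCoord K 0 hz) (s : K[X]) = aeval (germCoord K 0 hz) h := hs
    refine absurd (hIm (?_ : (s : K[X]) ∈ I)) s.2
    refine ⟨h, ?_⟩
    rw [← algebraMap_aeval_germCoord K 0 hz, ← algebraMap_aeval_germCoord K 0 hz, ← map_mul, hs']

lemma aeval_affineCoord_zero (h : K[X]) : aeval (affineCoord K 0) h =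
    aeval (affineCoord K 1) (reverse h) * affineCoord K 0 ^ h.natDegree := by
  let : Invertible (affineCoord K 0) := invertibleOfNonzero (affineCoord_ne_zero K 0)
  rw [affineCoord_one, ← invOf_eq_inv]
  exact (eval₂_reverse_mul_pow (algebraMap K _) (affineCoord K 0) h).symm

/-- A global differential is `h(y) dy` with `h` a polynomial. Regularity at infinity forces the
reversed polynomial of `h` to vanish at `u = 0`, but its value there is the leading coefficient of
`h`. -/
lemma globalDifferentials_eq_bot : globalDifferentials K (P1 K) = ⊥ := by
  obtain ⟨e, he⟩ := exists_cotangent_equiv (chart K 0) (chart_over K 0)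
    (genericPoint_mem_chartOpen K 0)
  have he : e (KaehlerDifferential.D K (P1 K).functionField (affineCoord K 0)) = 1 := by
    rw [← algebraMap_germCoord K 0 (genericPoint_mem_chartOpen K 0)]
    exact he
  rw [eq_bot_iff]
  intro ω hω
  obtain ⟨g, hg⟩ : ∃ g : (P1 K).functionField, e ω = g := ⟨_, rfl⟩
  have hω' (z : P1 K) : ∃ r : (P1 K).presheaf.stalk z,
      g = algebraMap _ (P1 K).functionField r * twist K 0 (-2) z :=
    hg ▸ (hasGenerator_cotangent_twist he z ω).1 (hω z)
  obtain ⟨h, hh⟩ := exists_polynomial_of_regular g fun z hz => by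
    obtain ⟨r, hr⟩ := hω' z
    exact ⟨r, by rw [hr, twist_of_mem _ _ hz, zpow_zero, mul_one]⟩
  obtain ⟨r, hr⟩ := hω' (infinity K)
  rw [twist_infinity, hh, aeval_affineCoord_zero] at hr
  have hu : affineCoord K 0 ^ h.natDegree * affineCoord K 1 ^ h.natDegree = 1 := by
    rw [← mul_pow, affineCoord_mul, one_pow]
  have h1 : aeval (germCoord K 1 (infinity_mem K)) (reverse h) =
      r * germCoord K 1 (infinity_mem K) ^ (h.natDegree + 2) := by
    apply algebraMap_functionField_injective
    rw [map_mul, map_pow, algebraMap_aeval_germCoord, algebraMap_germCoord, pow_add]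
    have h2 : affineCoord K 0 ^ (-2 : ℤ) = affineCoord K 1 ^ 2 := by
      rw [affineCoord_one, zpow_neg, zpow_ofNat, inv_pow]
    rw [h2] at hr
    linear_combination affineCoord K 1 ^ h.natDegree * hr -
      aeval (affineCoord K 1) (reverse h) * hu
  have h2 : reverse h ∈ Ideal.span {(X : K[X])} := by
    refine (aeval_germCoord_mem_iff (infinity_mem K) rfl (reverse h)).1 ?_
    rw [h1]
    have h := (aeval_germCoord_mem_iff (infinity_mem K) rfl X).2 (Ideal.mem_span_singleton_self X)
    rw [aeval_X] at h
    exact Ideal.mul_mem_left _ _ (Ideal.pow_mem_of_mem _ h _ (by omega))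
  rw [Ideal.mem_span_singleton, X_dvd_iff, coeff_zero_reverse, leadingCoeff_eq_zero] at h2
  rw [h2, map_zero] at hh
  exact (LinearEquiv.map_eq_zero_iff e).1 (hg.trans hh)

lemma genus_P1 : genus K (P1 K) = 0 := by
  rw [genus, globalDifferentials_eq_bot]
  exact finrank_bot K _

end Genus

/-! ### The degree of `f`. -/

section Degree

variable {K : Type u} [Field K] {f : P1 K ⟶ P1 K} {a : K} {p : ℕ}

/-- As `a ≠ 0`, the fraction `(a - X ^ p) / X` is already reduced. -/
lemma natDegree_num_denom (ha : a ≠ 0) (hp : 1 ≤ p) {g : RatFunc K}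
    (hg : RatFunc.X * g = RatFunc.C a - RatFunc.X ^ p) :
    g.num.natDegree = p ∧ g.denom.natDegree = 1 := by
  have h1 : g.num * X = (Polynomial.C a - X ^ p) * g.denom := by
    rw [RatFunc.num_mul_eq_mul_denom_iff X_ne_zero, eq_div_iff (RatFunc.algebraMap_ne_zero X_ne_zero)]
    simp [RatFunc.algebraMap_X, RatFunc.algebraMap_C, mul_comm g, hg]
  have hdeg : (Polynomial.C a - X ^ p).natDegree = p := by
    rw [← neg_sub, natDegree_neg, natDegree_X_pow_sub_C]
  have h2 : g.denom ∣ X := by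
    refine g.isCoprime_num_denom.symm.dvd_of_dvd_mul_left ?_
    exact ⟨_, h1.trans (mul_comm _ _)⟩
  have h3 : X ∣ g.denom := by
    refine (prime_X.dvd_mul.1 ⟨g.num, h1.symm.trans (mul_comm _ _)⟩).resolve_left fun h => ha ?_
    rw [X_dvd_iff] at h
    simpa [show p ≠ 0 by omega, coeff_X_pow, show 0 ≠ p by omega] using h
  have h4 : g.denom.natDegree = 1 := by
    rw [← natDegree_X (R := K)]
    exact natDegree_eq_of_degree_eq (degree_eq_degree_of_associated (associated_of_dvd_dvd h2 h3))
  have hg0 : g.num ≠ 0 := by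
    intro h
    rw [h, zero_mul, eq_comm, mul_eq_zero, or_iff_left g.denom_ne_zero] at h1
    rw [h1, natDegree_zero] at hdeg
    omega
  have h5 := congrArg natDegree h1
  rw [natDegree_mul hg0 X_ne_zero, natDegree_X, natDegree_mul (fun h => by simp [h] at hdeg; omega)
    g.denom_ne_zero, hdeg, h4] at h5
  exact ⟨by omega, h4⟩

/-- The local ring at the image of the generic point is identified with the subfield `K(g)` of the
field of rational functions, whose index is the maximum of the degrees of the numerator and the
denominator of `g`. -/
lemma degree_eq [f.IsOver (pt K)] (ha : a ≠ 0) (hp : 1 ≤ p)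
    (hf : IsGivenBy f (LaurentPolynomial.C a * T (-1) - T ((p : ℤ) - 1))) : degree f = p := by
  let := (aeval (R := K) (affineCoord K 0)).toRingHom.toAlgebra
  have := isFractionRing_affineCoord K 0
  have : IsScalarTower K K[X] (P1 K).functionField :=
    .of_algebraMap_eq fun c => (aeval_C (affineCoord K 0) c).symm
  let σ : (P1 K).functionField ≃ₐ[K] RatFunc K :=
    (IsLocalization.algEquiv (nonZeroDivisors K[X]) (P1 K).functionField
      (RatFunc K)).restrictScalars K
  have hσ : σ (affineCoord K 0) = RatFunc.X := by
    have h := (IsLocalization.algEquiv (nonZeroDivisors K[X]) (P1 K).functionField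
      (RatFunc K)).commutes X
    rw [RatFunc.algebraMap_X] at h
    exact (congrArg σ (aeval_X (R := K) (affineCoord K 0)).symm).trans h
  set hη := apply_genericPoint_mem hf
  set ρ := pulledCoord hη with hρ
  set g := σ ρ with hg
  have hg1 : RatFunc.X * g = RatFunc.C a - RatFunc.X ^ p := by
    rw [hg, ← hσ, ← map_mul, affineCoord_mul_pulledCoord hf, map_sub, map_pow, AlgEquiv.commutes]
    rfl
  obtain ⟨hnum, hdenom⟩ := natDegree_num_denom ha hp hg1
  have hconst : ¬ ∃ c, g = RatFunc.C c := by
    rintro ⟨c, hc⟩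
    rw [hc, RatFunc.num_C, natDegree_C] at hnum
    omega
  have htr : Function.Injective (aeval (R := K) g) :=
    transcendental_iff_injective.1 (RatFunc.transcendental_of_ne_C g hconst)
  let φ : ImageStalk f →+* RatFunc K :=
    σ.toRingEquiv.toRingHom.comp (f.stalkMap (genericPoint (P1 K))).hom
  set x0 : ImageStalk f := germCoord K 0 hη with hx0
  have hφ (h : K[X]) : φ (aeval x0 h) = aeval g h := by
    have h1 : φ.comp (aeval (R := K) x0).toRingHom = (aeval (R := K) g).toRingHom := by
      refine Polynomial.ringHom_ext (fun c => ?_) ?_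
      · change φ (aeval x0 (Polynomial.C c)) = aeval g (Polynomial.C c)
        rw [aeval_C, aeval_C]
        exact (congrArg σ (stalkMap_algebraMap K f _ c)).trans (σ.commutes c)
      · change φ (aeval x0 X) = aeval g X
        rw [aeval_X, aeval_X]
        rfl
    exact congr($h1 h)
  -- As `g` is transcendental, nonzero polynomials in `x0` have nonzero image in the function field;
  -- the map on local rings reflects units.
  have hunit {h : K[X]} (hh : h ≠ 0) : IsUnit (aeval x0 h) := by
    refine (isUnit_map_iff (f.stalkMap (genericPoint (P1 K))).hom _).1 ?_
    rw [isUnit_iff_ne_zero]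
    intro h0
    have h1 : φ (aeval x0 h) = 0 := (congrArg σ h0).trans (map_zero σ)
    rw [hφ] at h1
    exact hh (htr (h1.trans (map_zero _).symm))
  obtain ⟨q, hq⟩ := mem_chartOpen.1 hη
  have hsurj (e : ImageStalk f) : ∃ h s : K[X], s ≠ 0 ∧ e * aeval x0 s = aeval x0 h := by
    let := (aeval (R := K) (germCoord K 0 hη)).toRingHom.toAlgebra
    have := isLocalization_germCoord K hη hq
    obtain ⟨⟨h, s⟩, hs⟩ := IsLocalization.surj q.asIdeal.primeCompl e
    exact ⟨h, s, fun h0 => s.2 (h0 ▸ zero_mem _), hs⟩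
  have hmem (e : ImageStalk f) : φ e ∈ IntermediateField.adjoin K {g} := by
    obtain ⟨h, s, hs, hh⟩ := hsurj e
    have h1 := congrArg φ hh
    rw [map_mul, hφ, hφ] at h1
    rw [IntermediateField.mem_adjoin_simple_iff]
    exact ⟨h, s, (eq_div_iff ((map_ne_zero_iff _ htr).2 hs)).2 h1⟩
  let ψ : ImageStalk f →+* IntermediateField.adjoin K {g} :=
    φ.codRestrict (IntermediateField.adjoin K {g}) hmem
  have hψ : Function.Bijective ψ := by
    constructor
    · rw [injective_iff_map_eq_zero]
      intro e he
      obtain ⟨h, s, hs, hh⟩ := hsurj e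
      have h1 := congrArg φ hh
      rw [map_mul, show φ e = 0 from congrArg Subtype.val he, zero_mul, hφ] at h1
      obtain rfl : h = 0 := htr (h1.symm.trans (map_zero _).symm)
      rw [map_zero] at hh
      exact (hunit hs).mul_left_eq_zero.1 hh
    · rintro ⟨v, hv⟩
      obtain ⟨h, s, rfl⟩ := (IntermediateField.mem_adjoin_simple_iff K v).1 hv
      by_cases hs : s = 0
      · exact ⟨0, Subtype.ext (by simp [hs])⟩
      · obtain ⟨i, hi⟩ := (hunit hs).exists_right_inv
        refine ⟨aeval x0 h * i, Subtype.ext ?_⟩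
        change φ (aeval x0 h * i) = _
        have h1 := congrArg φ hi
        rw [map_mul, hφ, map_one] at h1
        rw [map_mul, hφ, eq_div_iff ((map_ne_zero_iff _ htr).2 hs), mul_assoc, mul_comm (φ i), h1,
          mul_one]
  let := imageAlgebra f
  have hfin := Algebra.finrank_eq_of_equiv_equiv (RingEquiv.ofBijective ψ hψ) σ.toRingEquiv rfl
  refine hfin.trans ((RatFunc.finrank_eq_max_natDegree g).trans ?_)
  rw [hnum, hdenom, max_eq_left hp]

end Degree

/-! ### The two local indices. -/

section Indices

variable {K : Type u} [Field K] {f : P1 K ⟶ P1 K} [f.IsOver (pt K)] {a : K} {p : ℕ}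
  {eΩ : Ω[(P1 K).functionField⁄K] ≃ₗ[(P1 K).functionField] (P1 K).functionField}
  {eP : (pullbackCotangent K f).generic ≃ₗ[(P1 K).functionField] (P1 K).functionField}

lemma isLocalIndex_chart_zero [CharP K p] (ha : a ≠ 0) (hp : 2 ≤ p)
    (hf : IsGivenBy f (LaurentPolynomial.C a * T (-1) - T ((p : ℤ) - 1)))
    (he : eΩ (KaehlerDifferential.D K (P1 K).functionField (affineCoord K 0)) = 1)
    (he' : IsPullbackFrame f (apply_genericPoint_mem hf) eP) {q : PrimeSpectrum K[X]}
    (hq : q.asIdeal = Ideal.span {X ^ p - Polynomial.C a}) {m : ℕ} (hm : p = m + 1) (α : GW K) :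
    IsLocalIndex (orientation ha hp hf he he') (differential K f) (chart K 0 q) α ↔
      α = GW.mk (antidiagonal (m + 1) 1) := by
  have hz : chart K 0 q ∈ chartOpen K 0 := mem_chartOpen.2 ⟨q, rfl⟩
  have hy0 : affineCoord K 0 ≠ 0 := affineCoord_ne_zero K 0
  have h1 : affineCoord K 0 ^ (-1 : ℤ) * affineCoord K 0 ^ (-1 : ℤ) * 1 =
      affineCoord K 0 ^ (-2 : ℤ) := by
    rw [mul_one, ← zpow_add₀ hy0]
    rfl
  have key := isLocalIndex_orientation ha hp hf he he' hz rfl one_ne_zero hq (m := m) (b := a)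
    (by rw [pow_one, hm]) (w := 1) (by rw [one_mul, he]) (twist_of_mem _ _ hz)
    ((hasGenerator_diffBundle ha hp hf he he' _).of_eq
      ((twist_of_mem _ _ hz).trans h1.symm)) (c := 1) (e := 0) (by
        rw [h1, mul_zero, add_zero, mul_one, pow_one, Units.val_one, map_one, one_mul,
          algebraMap_aeval_germCoord]
        simp) α
  rwa [inv_one] at key

lemma kaehler_affineCoord_one
    (he : eΩ (KaehlerDifferential.D K (P1 K).functionField (affineCoord K 0)) = 1) :
    -affineCoord K 0 ^ 2 *
      eΩ (KaehlerDifferential.D K (P1 K).functionField (affineCoord K 1)) = 1 := by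
  have h := congrArg (fun x => eΩ (KaehlerDifferential.D K (P1 K).functionField x))
    (affineCoord_mul (K := K))
  simp only [Derivation.leibniz, map_add, map_smul, he, Derivation.map_one_eq_zero, map_zero,
    smul_eq_mul, mul_one] at h
  linear_combination -affineCoord K 0 * h + affineCoord_mul (K := K)

/-- The dual basis of `du` is `-y ^ 2` times that of `dy`, so the compatible generator is `-y ^ (2p
- 4)`. This is the origin of the unit `-1`. -/
lemma isLocalIndex_infinity [CharP K p] (ha : a ≠ 0) {m : ℕ} (hm : p = m + 3) (hp : 2 ≤ p)
    (hf : IsGivenBy f (LaurentPolynomial.C a * T (-1) - T ((p : ℤ) - 1)))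
    (he : eΩ (KaehlerDifferential.D K (P1 K).functionField (affineCoord K 0)) = 1)
    (he' : IsPullbackFrame f (apply_genericPoint_mem hf) eP) (α : GW K) :
    IsLocalIndex (orientation ha hp hf he he') (differential K f) (infinity K) α ↔
      α = GW.mk (antidiagonal (m + 1) (-1)) := by
  have hy0 : affineCoord K 0 ≠ 0 := affineCoord_ne_zero K 0
  have h1 : affineCoord K 0 ^ ((p : ℤ) - 3) * affineCoord K 0 ^ ((p : ℤ) - 3) *
      -affineCoord K 0 ^ 2 = -(affineCoord K 0 ^ (2 * p - 4 : ℤ)) := by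
    rw [mul_neg, ← zpow_natCast, ← zpow_add₀ hy0, ← zpow_add₀ hy0]
    congr 2
    push_cast
    ring
  have key := isLocalIndex_orientation ha hp hf he he' (infinity_mem K) rfl
    (k := m + 1) (π := X) (by omega) rfl (m := m) (b := 0) (by rw [map_zero, sub_zero])
    (w := -affineCoord K 0 ^ 2) (kaehler_affineCoord_one he) (twist_infinity _ _)
    ((hasGenerator_diffBundle ha hp hf he he' _).of_isUnit isUnit_one.neg (by
      rw [h1, twist_infinity, map_neg, map_one, neg_one_mul])) (c := -1)
    -- With this `e`, the factor `1 + u ^ (p - 2) e` is `1 - a u ^ p`.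
    (e := -algebraMap K _ a * germCoord K 1 (infinity_mem K) ^ 2) (by
      rw [h1, differential_infinity (m := m + 1) hm, Units.val_neg, Units.val_one, map_neg, map_one,
        map_pow, aeval_X, mul_neg, neg_one_mul, ← neg_mul,
        ← map_neg]
      congr 2
      rw [hm]
      ring) α
  rwa [inv_neg_one] at key

end Indices

/-- The variable is not a `p`-th power, because its degree `1` is not divisible by `p`. -/
lemma irreducible_X_pow_sub_C_X {k : Type u} [Field k] {p : ℕ} (hp : p.Prime) :
    Irreducible (X ^ p - Polynomial.C RatFunc.X : (RatFunc k)[X]) := by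
  refine X_pow_sub_C_irreducible_of_prime hp fun b hb => ?_
  have h (n : ℕ) : RatFunc.intDegree (b ^ n) = n * RatFunc.intDegree b := by
    induction n with
    | zero => simp
    | succ n ih =>
      have hb0 : b ≠ 0 := by
        rintro rfl
        rw [zero_pow hp.ne_zero] at hb
        exact RatFunc.X_ne_zero hb.symm
      rw [pow_succ, RatFunc.intDegree_mul (pow_ne_zero _ hb0) hb0, ih]
      push_cast
      ring
  have h1 := h p
  rw [hb, RatFunc.intDegree_X] at h1
  exact hp.one_lt.ne' (by exact_mod_cast Int.eq_one_of_mul_eq_one_right (by omega) h1.symm)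

end EnrichedRH

/-! ### The two indices, their sum, and the Riemann-Hurwitz formula. -/

theorem proposition3p1 {k : Type u} [Field k] {p : ℕ} [CharP k p] (hp : Odd p)
    (f : EnrichedRH.P1 (RatFunc k) ⟶ EnrichedRH.P1 (RatFunc k))
    [f.IsOver (EnrichedRH.pt (RatFunc k))]
    (hf : EnrichedRH.IsGivenBy f
      (LaurentPolynomial.C RatFunc.X * LaurentPolynomial.T (-1) -
        LaurentPolynomial.T ((p : ℤ) - 1))) :
    ∃ q : PrimeSpectrum (RatFunc k)[X],
      q.asIdeal = Ideal.span {Polynomial.X ^ p - Polynomial.C RatFunc.X} ∧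
    ∃ ρ : EnrichedRH.RelativeOrientation (RatFunc k) (EnrichedRH.diffBundle (RatFunc k) f),
      {y | (EnrichedRH.diffBundle (RatFunc k) f).VanishesAt
          (EnrichedRH.differential (RatFunc k) f) y} =
        {EnrichedRH.chart (RatFunc k) 0 q, EnrichedRH.infinity (RatFunc k)} ∧
      (∃! α, EnrichedRH.IsLocalIndex ρ (EnrichedRH.differential (RatFunc k) f)
        (EnrichedRH.chart (RatFunc k) 0 q) α) ∧
      (∃! α, EnrichedRH.IsLocalIndex ρ (EnrichedRH.differential (RatFunc k) f)
        (EnrichedRH.infinity (RatFunc k)) α) ∧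
      EnrichedRH.localIndex ρ (EnrichedRH.differential (RatFunc k) f)
          (EnrichedRH.chart (RatFunc k) 0 q) =
        ((p - 1) / 2) • EnrichedRH.GW.h (RatFunc k) + EnrichedRH.GW.unary 1 ∧
      EnrichedRH.localIndex ρ (EnrichedRH.differential (RatFunc k) f)
          (EnrichedRH.infinity (RatFunc k)) =
        ((p - 3) / 2) • EnrichedRH.GW.h (RatFunc k) + EnrichedRH.GW.unary (-1) ∧
      EnrichedRH.eulerNumber ρ (EnrichedRH.differential (RatFunc k) f) =
        (p - 1) • EnrichedRH.GW.h (RatFunc k) ∧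
      EnrichedRH.eulerChar (RatFunc k) (EnrichedRH.P1 (RatFunc k)) =
        EnrichedRH.degree f • EnrichedRH.eulerChar (RatFunc k) (EnrichedRH.P1 (RatFunc k)) -
          EnrichedRH.eulerNumber ρ (EnrichedRH.differential (RatFunc k) f) := by
  open EnrichedRH in
  have hprime : p.Prime := (CharP.char_is_prime_or_zero k p).resolve_right fun h => by
    rw [h] at hp
    exact absurd hp (by decide)
  -- The ranks of the two forms are then `p = 2 (n + 1) + 1` and `p - 2 = 2 n + 1`.
  obtain ⟨n, hn⟩ : ∃ n, p = 2 * n + 3 := by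
    obtain ⟨l, hl⟩ := hp
    have := hprime.two_le
    exact ⟨l - 1, by omega⟩
  have : CharP (RatFunc k) p := charP_of_injective_algebraMap' k p
  have h2 : (2 : RatFunc k) ≠ 0 := by
    intro h
    have h' := (CharP.cast_eq_zero_iff (RatFunc k) p 2).1 (by exact_mod_cast h)
    have := Nat.le_of_dvd two_pos h'
    omega
  have ha : (RatFunc.X : RatFunc k) ≠ 0 := RatFunc.X_ne_zero
  have hp2 : 2 ≤ p := hprime.two_le
  have hirr := irreducible_X_pow_sub_C_X (k := k) hprime
  let q : PrimeSpectrum (RatFunc k)[X] :=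
    ⟨Ideal.span {X ^ p - Polynomial.C RatFunc.X},
      (Ideal.span_singleton_prime hirr.ne_zero).2 hirr.prime⟩
  have hq : q.asIdeal = Ideal.span {X ^ p - Polynomial.C RatFunc.X} := rfl
  obtain ⟨eΩ, he⟩ := exists_cotangent_equiv (chart (RatFunc k) 0) (chart_over (RatFunc k) 0)
    (genericPoint_mem_chartOpen (RatFunc k) 0)
  have he : eΩ (KaehlerDifferential.D (RatFunc k) (P1 (RatFunc k)).functionField
      (affineCoord (RatFunc k) 0)) = 1 := by
    rw [← algebraMap_germCoord (RatFunc k) 0 (genericPoint_mem_chartOpen (RatFunc k) 0)]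
    exact he
  obtain ⟨eP, he'⟩ : ∃ eP, IsPullbackFrame f (apply_genericPoint_mem hf) eP :=
    exists_pullbackCotangent_equiv f (chart (RatFunc k) 0) (chart_over (RatFunc k) 0)
      (apply_genericPoint_mem hf)
  set ρ := orientation ha hp2 hf he he'
  have hzeros := setOf_vanishesAt ha (by omega) hf he he' hirr hq
  have hI0 := isLocalIndex_chart_zero ha hp2 hf he he' hq (m := 2 * (n + 1)) (by omega)
  have hI1 := isLocalIndex_infinity ha (m := 2 * n) hn hp2 hf he he'
  have hne : chart (RatFunc k) 0 q ≠ infinity (RatFunc k) := fun h =>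
    infinity_notMem (RatFunc k) (h ▸ mem_chartOpen.2 ⟨q, rfl⟩)
  have hind0 : localIndex ρ (differential (RatFunc k) f) (chart (RatFunc k) 0 q) =
      ((p - 1) / 2) • GW.h (RatFunc k) + GW.unary 1 := by
    rw [localIndex_eq hI0, antidiagonal_odd h2, show (p - 1) / 2 = n + 1 by omega]
  have hind1 : localIndex ρ (differential (RatFunc k) f) (infinity (RatFunc k)) =
      ((p - 3) / 2) • GW.h (RatFunc k) + GW.unary (-1) := by
    rw [localIndex_eq hI1, antidiagonal_odd h2, show (p - 3) / 2 = n by omega]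
  have hnum : eulerNumber ρ (differential (RatFunc k) f) = (p - 1) • GW.h (RatFunc k) := by
    -- The last summand `1` accounts for the hyperbolic plane formed by `⟨1⟩` and `⟨-1⟩`, one from
    -- each zero.
    have h3 : p - 1 = (p - 1) / 2 + (p - 3) / 2 + 1 := by omega
    rw [eulerNumber, hzeros, finsum_mem_pair hne, hind0, hind1, add_add_add_comm, ← add_smul, ← GW.h,
      ← succ_nsmul, ← h3]
  refine ⟨q, hq, ρ, hzeros, ⟨_, (hI0 _).2 rfl, fun α => (hI0 α).1⟩,
    ⟨_, (hI1 _).2 rfl, fun α => (hI1 α).1⟩, hind0, hind1, hnum, ?_⟩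
  rw [hnum, degree_eq ha (by omega) hf, eulerChar, genus_P1, Nat.cast_zero, sub_zero, one_smul,
    eq_sub_iff_add_eq, ← succ_nsmul']
  congr 1
  omega

end
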